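/- **Lemma (Compactness of the nonlocal terms).** Let $V:\mathbb R\to\mathbb R$ be nondecreasing on $[0,\infty)$ and Lipschitz continuous on $[0,M]$ for every $M>0$ (that is, $V\in W^{1,\infty}_{loc}([0,\infty))$ with $V'\ge 0$), and let $q_0\in L^\infty(\mathbb R)\cap TV(\mathbb R)$. Let $(\gamma_\eta)_{\eta>0}$ be a family of kernels on $(-\infty,0]$ of one of the following two classes. 1. *(Convex kernels.)* $\gamma_\eta(x)=\tfrac1\eta\,\gamma(x/\eta)$, where $\gamma:(-\infty,0]\to[0,\infty)$ is nondecreasing and convex with $\int_{-\infty}^0\gamma=1$. 2. *(Kernels scaled in the exponent.)* $\gamma_\eta=\gamma^{1/\eta}/\|\gamma^{1/\eta}\|_{L^1((-\infty,0])}$, where $\gamma\in BV((-\infty,0];[0,\infty))$ satisfies $\sup_{x\le-\delta}\gamma(x)<\gamma(0)$ for every $\delta>0$, and there are $a,\delta>0$ and $C\in\mathbb R$ with $|\gamma(x)-\gamma(y)-a(x-y)|\le C\max\{|x|,|y|\}\,|x-y|$ for all $x,y\in[-\delta,0]$ (equivalently, $\gamma$ is Lipschitz near $0$ and $\gamma'(x)=a+O(|x|)$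 for a.e. $x$ as $x\uparrow 0$; this holds if $\gamma\in W^{2,\infty}((-\delta,0))$ is continuous at $0$ with $\gamma'(0)=a>0$). Here $BV$ means integrable and of bounded variation. For $T>0$ put $W[|q|,\gamma_\eta](t,x)=\int_{-\infty}^x\gamma_\eta(y-x)\,|q(t,y)|\,dy$. A *weak solution* $q_\eta$ of $$\partial_t q_\eta+\partial_x\big(V(W[|q_\eta|,\gamma_\eta])\,q_\eta\big)=0\ \text{ on }(0,T)\times\mathbb R,\qquad q_\eta(0,\cdot)=q_0,$$ is a function $q_\eta\in C([0,T];L^1_{loc}(\mathbb R))\cap L^\infty((0,T);L^\infty(\mathbb R))$ such that for all $\phi\in C^1_c((-42,T)\times\mathbb R)$ $$\int_0^T\!\!\int_{\mathbb R}q_\eta\big(\phi_t+\phi_x\,V(W[|q_\eta|,\gamma_\eta])\big)\,dx\,dt+\int_{\mathbb R}\phi(0,x)\,q_0(x)\,dx=0 .$$ Then for every $T>0$ there is $\varepsilon>0$ such that, for every $\eta\in(0,\varepsilon)$ and every weak solution $q_\eta$ on $[0,T]$, the nonlocal term $W[|q_\eta|,\gamma_\eta]$ belongs to $C([0,T];L^1_{loc}(\mathbb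 R))$, and the set $$\big\{W[|q_\eta|,\gamma_\eta]:\ \eta\in(0,\varepsilon),\ q_\eta\text{ a weak solution for }\gamma_\eta\big\}$$ is relatively compact in $C([0,T];L^1_{loc}(\mathbb R))$. -/

import Mathlib

open MeasureTheory Set Topology
open scoped NNReal ENNReal

noncomputable section

namespace NonlocalCL

/-- The space `L¹_loc(ℝ)` of (classes modulo null sets of) locally integrable functions. -/
def L1Loc : Type :=
  {f : ℝ →ₘ[(volume : Measure ℝ)] ℝ // LocallyIntegrable (fun x => f x) volume}

namespace L1Loc

instance : CoeFun L1Loc (fun _ => ℝ → ℝ) := ⟨fun f x => f.1 x⟩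

theorem integrableOn_Icc (f : L1Loc) (n : ℕ) :
    Integrable (fun x => f x) (volume.restrict (Icc (-(n : ℝ)) n)) :=
  f.2.integrableOn_isCompact isCompact_Icc

/-- The restriction of `f` to `[-n, n]`, as an element of the Banach space `L¹([-n, n])`. -/
def restrict (n : ℕ) (f : L1Loc) : Lp ℝ 1 ((volume : Measure ℝ).restrict (Icc (-(n : ℝ)) n)) :=
  (f.integrableOn_Icc n).toL1 (fun x => f x)

/-- The Fréchet structure of `L¹_loc(ℝ)`: the uniformity, hence the topology, generated by the
seminorms `f ↦ ∫_{[-n, n]} |f|`, `n ∈ ℕ`. -/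
instance : UniformSpace L1Loc :=
  UniformSpace.comap (fun (f : L1Loc) (n : ℕ) => restrict n f) inferInstance

end L1Loc

/-- The nonlocal term `W[|q|, γ](x) = ∫_{-∞}^x γ(y - x) |q(y)| dy`, for a function `q` of the space
variable. Only the values of `γ` on `(-∞, 0]` matter. -/
def nonlocalTerm (γ : ℝ → ℝ) (q : ℝ → ℝ) (x : ℝ) : ℝ :=
  ∫ y in Iic x, γ (y - x) * |q y|

/-- `q₀ ∈ L^∞(ℝ) ∩ TV(ℝ)`: an essentially bounded function that agrees almost everywhere with a
function of finite total variation on `ℝ`. -/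
structure IsBoundedTV (q₀ : ℝ → ℝ) : Prop where
  memLp_top : MemLp q₀ ⊤ volume
  tv : ∃ g : ℝ → ℝ, q₀ =ᵐ[volume] g ∧ BoundedVariationOn g univ

/-- The velocity restricted to `[0, ∞)`, where it is evaluated: `V` is of class `W^{1,∞}` on every
bounded interval `(0, M)`, i.e. Lipschitz continuous there up to the end points, and `V' ≥ 0`. -/
structure IsVelocity (V : ℝ → ℝ) : Prop where
  lipschitz : ∀ M : ℝ, ∃ K : ℝ≥0, LipschitzOnWith K V (Icc 0 M)
  monotone : MonotoneOn V (Ici 0)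

/-- Lebesgue measure on the time interval `[0, T]`. -/
def timeMeasure (T : ℝ) : Measure (Icc (0 : ℝ) T) :=
  (volume : Measure ℝ).comap Subtype.val

/-- `q ∈ C([0,T]; L¹_loc(ℝ)) ∩ L^∞((0,T); L^∞(ℝ))` is a weak solution of
`∂ₜ q + ∂ₓ (V(W[|q|, γ]) q) = 0` on `(0,T) × ℝ`, `q(0, ·) = q₀`. The test functions are the elements
of `C¹_c((-42, T) × ℝ)`. -/
structure IsWeakSolution (V γ q₀ : ℝ → ℝ) (T : ℝ) (q : C(Icc (0 : ℝ) T, L1Loc)) : Prop where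
  bounded : ∃ M : ℝ, ∀ᵐ t ∂timeMeasure T, ∀ᵐ x : ℝ, |q t x| ≤ M
  weak : ∀ φ : ℝ × ℝ → ℝ, ContDiff ℝ 1 φ → HasCompactSupport φ →
    tsupport φ ⊆ Ioo (-42) T ×ˢ univ →
    (∫ t, (∫ x : ℝ,
        q t x * (fderiv ℝ φ ((t : ℝ), x) (1, 0)
          + fderiv ℝ φ ((t : ℝ), x) (0, 1) * V (nonlocalTerm γ (q t) x))) ∂timeMeasure T)
      + ∫ x : ℝ, φ (0, x) * q₀ x = 0

/-- First kernel class (base kernel): a nonnegative kernel on `(-∞, 0]` of unit mass that increases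
in a convex manner. Being nonnegative, monotone and finite at `0`, it has bounded variation. -/
structure IsConvexKernel (γ : ℝ → ℝ) : Prop where
  nonneg : ∀ x ≤ 0, 0 ≤ γ x
  integrable : IntegrableOn γ (Iic 0)
  mass : ∫ x in Iic (0 : ℝ), γ x = 1
  monotone : MonotoneOn γ (Iic 0)
  convex : ConvexOn ℝ (Iic 0) γ

/-- The usual rescaling `γ_η(x) = η⁻¹ γ(x / η)`. -/
def rescale (γ : ℝ → ℝ) (η x : ℝ) : ℝ := γ (x / η) / η

/-- Second kernel class (base kernel): a function in `BV((-∞, 0]; [0, ∞))`, not necessarily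
monotone, that attains its strict maximum at `0` in the sense that `sup_{x ≤ -δ} γ(x) < γ(0)` for
every `δ > 0`, and that is Lipschitz near `0` with `γ'(x) = a + O(|x|)` as `x ↑ 0` for some `a > 0`.
The last property, written through difference quotients in `expansion`, holds in particular if `γ`
is of class `W^{2,∞}` on some `(-δ, 0)` with `γ'(0) = a > 0`. -/
structure IsPowerKernel (γ : ℝ → ℝ) : Prop where
  nonneg : ∀ x ≤ 0, 0 ≤ γ x
  integrable : IntegrableOn γ (Iic 0)
  bv : BoundedVariationOn γ (Iic 0)
  max_at_zero : ∀ δ > 0, ∃ c < γ 0, ∀ x ≤ -δ, γ x ≤ c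
  expansion : ∃ a > 0, ∃ C : ℝ, ∃ δ > 0, ∀ x ∈ Icc (-δ) 0, ∀ y ∈ Icc (-δ) 0,
    |γ x - γ y - a * (x - y)| ≤ C * max |x| |y| * |x - y|

/-- Scaling in the exponent: `γ_η = γ^{1/η} / ‖γ^{1/η}‖_{L¹((-∞, 0])}`. -/
def powerScale (γ : ℝ → ℝ) (η x : ℝ) : ℝ :=
  γ x ^ (1 / η) / ∫ y in Iic (0 : ℝ), γ y ^ (1 / η)

/-- The admissible families `(γ_η)_{η > 0}` of kernels on `(-∞, 0]`: those of either class. -/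
def IsAdmissibleFamily (Γ : ℝ → ℝ → ℝ) : Prop :=
  (∃ γ, IsConvexKernel γ ∧ ∀ η > 0, ∀ x ≤ 0, Γ η x = rescale γ η x) ∨
  (∃ γ, IsPowerKernel γ ∧ ∀ η > 0, ∀ x ≤ 0, Γ η x = powerScale γ η x)

/-- `w`, as an element of `C([0,T]; L¹_loc(ℝ))`, is the nonlocal term `W[|q|, γ]`. -/
def IsNonlocalTerm (γ : ℝ → ℝ) {T : ℝ} (q w : C(Icc (0 : ℝ) T, L1Loc)) : Prop :=
  ∀ t, ∀ᵐ x : ℝ, w t x = nonlocalTerm γ (q t) x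

/-- The family `{W[|q_η|, γ_η] : η ∈ (0, ε)}` in `C([0,T]; L¹_loc(ℝ))`, where `q_η` is a weak
solution for the kernel `γ_η = Γ η`. -/
def nonlocalTerms (V : ℝ → ℝ) (Γ : ℝ → ℝ → ℝ) (q₀ : ℝ → ℝ) (T ε : ℝ) :
    Set C(Icc (0 : ℝ) T, L1Loc) :=
  {w | ∃ η ∈ Ioo 0 ε, ∃ q, IsWeakSolution V (Γ η) q₀ T q ∧ IsNonlocalTerm (Γ η) q w}

end NonlocalCL

end

open MeasureTheory Set Topology
open scoped NNReal ENNReal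

noncomputable section

namespace NonlocalCL

/-! Relative compactness follows from three bounds on the nonlocal terms $W=W[|q_\eta|,\gamma_\eta]$
that do not depend on $\eta$: a sup bound, a bound on the spatial variation, and Lipschitz
continuity in time of the integrals of $W$ over intervals. Helly's theorem gives compactness at each
time. A function of bounded variation whose integrals over all intervals are small is small in
$L^1_{loc}$, so the weak continuity in time upgrades to equicontinuity, and Arzelà–Ascoli applies
(`isCompact_closure_of_varLe`, `isCompact_closure_nonlocalTerms`).

For fixed $\eta$ the velocity $V(W)$ is Lipschitz in $x$ and has a flow $X$. Testing the weak
formulation with smoothed indicators of the region between two characteristics shows that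
$|q(t)|\,dx$ is the image of $m=|q_0|\,dx$ under $X(t)$ (`map_flow_absMeasure`). Hence
$W(t,X(t,x))=\int\kappa(X(t,y)-X(t,x))\,dm(y)$: the problem becomes a system of ordered particles,
and no regularity of the density is needed (`IsLagrangianSolution`).

Let $U$ be the potential of the particles for a kernel $k$ that increases on $(-\infty,0)$. An
increment of $U(\cdot,x)$ in time is an integral of displacements relative to $x$, weighted with the
secant slopes of $k$, which are nonnegative. As $V$ is nondecreasing, a particle at which $U$ is
maximal is fastest, the particles to its left fall behind, and $U$ does not grow there
(`potential_le_exp`). For the variation one works with the signs of the increments of $U$ along a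
partition. Convexity of $k$ makes the weights decrease in $x$, and a summation by parts bounds the
growth by the variation along a refined partition minus the current one
(`sum_sign_mul_potential_sub_le`, `varLe_potential`). Both arguments are discrete in time, in
implicit Euler form, and are closed by iterating `le_exp_add_exp_of_increment_le`. They tolerate a
velocity driven by a quantity $w$ that is only close to $U$, with relative error $\theta$; the price
is a factor $\exp(2\kappa L\theta t)$, where $\kappa$ bounds the mass of the secant slopes and $L$
is a Lipschitz constant of $V$.

For a convex kernel $U=W$ and $\theta=0$, so the sup bound and the variation of $q_0$ are preserved
exactly (`bounds_of_convexOn`).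

For kernels scaled in the exponent put $p=1/\eta$. After normalisation $\gamma^p$ is close to an
exponential kernel of rate $\alpha=ap$: the error is $O(1/p)$ in mass and $O(1)$ in variation. The
exponential average $E$ of a density satisfies $\rho=E+E'/\alpha$, so a kernel error changes the
average by at most (mass plus variation over $\alpha$) times the size of $E$, both in sup and in
variation (`abs_conv_le_expKernel`, `IsNear.varSum_sub_le`). The mass of the secant slopes is of
order $\alpha$ times a bound on $W$. Since $\alpha\cdot O(1/p)$ stays bounded, the exponential
kernel is a good enough reference for the variation, once $W$ is bounded. It is not good enough for
the sup bound, where the mass depends on the bound being proved. There the reference is the part of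
$\gamma^p$ near $0$, which is monotone though perhaps not convex, and whose error is exponentially
small in $p$; the growth exponent then tends to $0$ and a continuation argument covers all of
$[0,T]$ for small $\eta$ (`conv_le_of_isNearExponential`, `varLe_of_isNearExponential`). -/

/-! ### Variation along finite partitions -/

/-- The variation of `f` along the first `n + 1` points of the sequence `x`. -/
def varSum (f : ℝ → ℝ) (x : ℕ → ℝ) (n : ℕ) : ℝ :=
  ∑ i ∈ Finset.range n, |f (x (i + 1)) - f (x i)|

/-- The total variation of `f` on `ℝ` is at most `A`. -/
def VarLe (f : ℝ → ℝ) (A : ℝ) : Prop :=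
  ∀ (x : ℕ → ℝ), Monotone x → ∀ n, varSum f x n ≤ A

theorem VarLe.nonneg {f : ℝ → ℝ} {A : ℝ} (h : VarLe f A) : 0 ≤ A := by
  simpa [varSum] using h (fun _ => 0) monotone_const 0

theorem VarLe.eVariationOn_le {f : ℝ → ℝ} {A : ℝ} (h : VarLe f A) (s : Set ℝ) :
    eVariationOn f s ≤ ENNReal.ofReal A := by
  refine iSup_le fun p => ?_
  have := h p.2.1 p.2.2.1 p.1
  calc _ = ENNReal.ofReal (varSum f p.2.1 p.1) := by
        rw [varSum, ENNReal.ofReal_sum_of_nonneg (fun _ _ => abs_nonneg _)]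
        exact Finset.sum_congr rfl fun i _ => by rw [edist_dist, Real.dist_eq]
    _ ≤ _ := ENNReal.ofReal_le_ofReal this

theorem varLe_of_boundedVariationOn {f : ℝ → ℝ} (h : BoundedVariationOn f univ) :
    VarLe f (eVariationOn f univ).toReal := by
  intro x hx n
  have := eVariationOn.sum_le (f := f) (s := univ) (n := n) hx (fun i => mem_univ _)
  calc varSum f x n = (∑ i ∈ Finset.range n, edist (f (x (i + 1))) (f (x i))).toReal := by
        rw [varSum, ENNReal.toReal_sum (fun _ _ => edist_ne_top _ _)]
        exact Finset.sum_congr rfl fun i _ => by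
          rw [edist_dist, ENNReal.toReal_ofReal dist_nonneg, Real.dist_eq]
    _ ≤ _ := ENNReal.toReal_mono h this

/-- The increments of a function of bounded variation are dominated by those of a bounded
monotone function. -/
theorem VarLe.exists_monotone {f : ℝ → ℝ} {A : ℝ} (h : VarLe f A) :
    ∃ N : ℝ → ℝ, Monotone N ∧ (∀ x, N x ∈ Icc 0 A) ∧
      ∀ x y, x ≤ y → |f y - f x| ≤ N y - N x := by
  have hfin : ∀ s, eVariationOn f s ≠ ⊤ := fun s =>
    ((h.eVariationOn_le s).trans_lt ENNReal.ofReal_lt_top).ne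
  refine ⟨fun x => (eVariationOn f (Iic x)).toReal, fun x y hxy =>
    ENNReal.toReal_mono (hfin _) (eVariationOn.mono _ (Iic_subset_Iic.2 hxy)), fun x =>
    ⟨ENNReal.toReal_nonneg, ENNReal.toReal_le_of_le_ofReal h.nonneg (h.eVariationOn_le _)⟩, ?_⟩
  intro x y hxy
  have h1 := eVariationOn.add_le_union f (s := Iic x) (t := Icc x y)
    (fun a ha b hb => le_trans ha hb.1)
  have h2 : Iic x ∪ Icc x y ⊆ Iic y := by
    rintro z (hz | hz)
    · exact le_trans hz hxy
    · exact hz.2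
  have h3 : edist (f y) (f x) ≤ eVariationOn f (Icc x y) :=
    eVariationOn.edist_le f (right_mem_Icc.2 hxy) (left_mem_Icc.2 hxy)
  have h4 := (add_le_add_right h3 (eVariationOn f (Iic x))).trans
    (h1.trans (eVariationOn.mono f h2))
  have h5 := ENNReal.toReal_mono (hfin _) h4
  rw [ENNReal.toReal_add (hfin _) (edist_ne_top _ _), edist_dist,
    ENNReal.toReal_ofReal dist_nonneg, Real.dist_eq] at h5
  linarith

theorem VarLe.measurable {f : ℝ → ℝ} {A : ℝ} (h : VarLe f A) : Measurable f := by
  obtain ⟨N, hN, -, hf⟩ := h.exists_monotone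
  have h2 : Monotone (fun x => N x - f x) := fun x y hxy => by
    have := abs_le.1 (hf x y hxy)
    simp only
    linarith [this.2]
  have : f = fun x => N x - (N x - f x) := by ext; ring
  rw [this]
  exact hN.measurable.sub h2.measurable

/-! ### The space `L¹_loc` -/

namespace L1Loc

theorem stronglyMeasurable (f : L1Loc) : StronglyMeasurable (fun x => f x) :=
  f.1.stronglyMeasurable

/-- The class of a locally integrable function. -/
def mk (f : ℝ → ℝ) (hf : LocallyIntegrable f volume) : L1Loc :=
  ⟨AEEqFun.mk f hf.aestronglyMeasurable,
    hf.congr (AEEqFun.coeFn_mk f hf.aestronglyMeasurable).symm⟩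

theorem coeFn_mk (f : ℝ → ℝ) (hf : LocallyIntegrable f volume) :
    (fun x => mk f hf x) =ᵐ[volume] f :=
  AEEqFun.coeFn_mk f hf.aestronglyMeasurable

theorem ext {f g : L1Loc} (h : (fun x => f x) =ᵐ[volume] fun x => g x) : f = g :=
  Subtype.ext (AEEqFun.ext h)

theorem dist_restrict (n : ℕ) (f g : L1Loc) :
    dist (restrict n f) (restrict n g) = ∫ x in Icc (-(n : ℝ)) n, |f x - g x| := by
  rw [restrict, restrict, L1.dist_eq_integral_dist]
  refine integral_congr_ae ?_
  filter_upwards [(f.integrableOn_Icc n).coeFn_toL1, (g.integrableOn_Icc n).coeFn_toL1]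
    with x h1 h2
  rw [h1, h2, Real.dist_eq]

theorem isUniformInducing : IsUniformInducing (fun (f : L1Loc) (n : ℕ) => restrict n f) :=
  ⟨rfl⟩

theorem tendsto_iff {ι : Type*} {l : Filter ι} {f : ι → L1Loc} {g : L1Loc} :
    Filter.Tendsto f l (𝓝 g) ↔
      ∀ n : ℕ, Filter.Tendsto (fun i => ∫ x in Icc (-(n : ℝ)) n, |f i x - g x|) l (𝓝 0) := by
  rw [isUniformInducing.isInducing.tendsto_nhds_iff, tendsto_pi_nhds]
  refine forall_congr' fun n => ?_
  rw [tendsto_iff_dist_tendsto_zero]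
  simp only [Function.comp_def, dist_restrict]

instance : T2Space L1Loc := by
  have hinj : Function.Injective (fun (f : L1Loc) (n : ℕ) => restrict n f) := by
    intro f g h
    apply ext
    have key : ∀ n : ℕ, ∀ᵐ x ∂(volume.restrict (Icc (-(n : ℝ)) n)), f x = g x := fun n => by
      have h1 : (f.integrableOn_Icc n).toL1 _ = (g.integrableOn_Icc n).toL1 _ := congrFun h n
      exact (Integrable.toL1_eq_toL1_iff _ _ _ _).1 h1
    have hU : (⋃ n : ℕ, Icc (-(n : ℝ)) n) = univ := by
      refine eq_univ_of_forall fun x => ?_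
      obtain ⟨n, hn⟩ := exists_nat_ge |x|
      exact mem_iUnion.2 ⟨n, abs_le.1 hn⟩
    have := (ae_restrict_iUnion_iff (μ := volume) (fun n : ℕ => Icc (-(n : ℝ)) n)
      (fun x => f x = g x)).2 key
    rwa [hU, Measure.restrict_univ] at this
  exact T2Space.of_injective_continuous hinj isUniformInducing.isInducing.continuous

end L1Loc

/-! ### Helly's selection theorem in `L¹_loc` -/

/-- Monotone functions on the rationals with values in `[-M, M]`. -/
def ratMonotone (M : ℝ) : Set (ℚ → ℝ) := {f | Monotone f ∧ ∀ r, f r ∈ Icc (-M) M}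

theorem isCompact_ratMonotone (M : ℝ) : IsCompact (ratMonotone M) := by
  have h1 : IsCompact (Set.pi univ (fun _ : ℚ => Icc (-M) M)) :=
    isCompact_univ_pi fun _ => isCompact_Icc
  refine h1.of_isClosed_subset ?_ (fun f hf r _ => hf.2 r)
  have h2 : IsClosed {f : ℚ → ℝ | Monotone f} := by
    simp only [Monotone, ofPred_forall]
    refine isClosed_iInter fun a => isClosed_iInter fun b => isClosed_iInter fun _ => ?_
    exact isClosed_le (continuous_apply a) (continuous_apply b)
  have h3 : IsClosed {f : ℚ → ℝ | ∀ r, f r ∈ Icc (-M) M} := by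
    simp only [ofPred_forall]
    exact isClosed_iInter fun r => isClosed_Icc.preimage (continuous_apply r)
  exact h2.inter h3

/-- The left-continuous extension of a monotone function on `ℚ`. -/
def ratExtend (f : ℚ → ℝ) (x : ℝ) : ℝ := ⨆ r : {r : ℚ // (r : ℝ) < x}, f r

instance nonempty_rat_lt (x : ℝ) : Nonempty {r : ℚ // (r : ℝ) < x} :=
  let ⟨r, hr⟩ := exists_rat_lt x
  ⟨⟨r, hr⟩⟩

theorem bddAbove_ratMonotone {M : ℝ} {f : ℚ → ℝ} (hf : f ∈ ratMonotone M) (x : ℝ) :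
    BddAbove (range fun r : {r : ℚ // (r : ℝ) < x} => f r) :=
  ⟨M, by rintro _ ⟨r, rfl⟩; exact (hf.2 r).2⟩

theorem le_ratExtend {M : ℝ} {f : ℚ → ℝ} (hf : f ∈ ratMonotone M) {r : ℚ} {x : ℝ}
    (h : (r : ℝ) < x) : f r ≤ ratExtend f x :=
  le_ciSup (bddAbove_ratMonotone hf x) (⟨r, h⟩ : {r : ℚ // (r : ℝ) < x})

theorem ratExtend_le {M : ℝ} {f : ℚ → ℝ} (hf : f ∈ ratMonotone M) {r : ℚ} {x : ℝ}
    (h : x ≤ (r : ℝ)) : ratExtend f x ≤ f r :=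
  ciSup_le fun s => hf.1 (by exact_mod_cast (s.2.trans_le h).le)

theorem monotone_ratExtend {M : ℝ} {f : ℚ → ℝ} (hf : f ∈ ratMonotone M) :
    Monotone (ratExtend f) := fun _ _ hxy =>
  ciSup_le fun s => le_ratExtend hf (s.2.trans_le hxy)

theorem abs_ratExtend_le {M : ℝ} {f : ℚ → ℝ} (hf : f ∈ ratMonotone M) (x : ℝ) :
    |ratExtend f x| ≤ M := by
  obtain ⟨r, hr⟩ := exists_rat_lt x
  exact abs_le.2 ⟨(hf.2 r).1.trans (le_ratExtend hf hr), ciSup_le fun s => (hf.2 s).2⟩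

/-- The values at `x` are squeezed between values at nearby rationals, where convergence is assumed.
The lower bound comes from rationals to the left of `x` by definition of the supremum; only the
upper bound, from rationals to the right, uses continuity of the limit. -/
theorem tendsto_ratExtend {M : ℝ} {f : ℕ → ℚ → ℝ} {g : ℚ → ℝ} (hf : ∀ n, f n ∈ ratMonotone M)
    (hg : g ∈ ratMonotone M) (h : ∀ r, Filter.Tendsto (fun n => f n r) Filter.atTop (𝓝 (g r)))
    {x : ℝ} (hx : ContinuousAt (ratExtend g) x) :
    Filter.Tendsto (fun n => ratExtend (f n) x) Filter.atTop (𝓝 (ratExtend g x)) := by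
  refine tendsto_order.2 ⟨fun a ha => ?_, fun a ha => ?_⟩
  · obtain ⟨r, hr⟩ := exists_lt_of_lt_ciSup ha
    filter_upwards [(h r).eventually_const_lt hr] with n hn
    exact hn.trans_le (le_ratExtend (hf n) r.2)
  · have h1 : ∀ᶠ y in 𝓝 x, ratExtend g y < a := hx.eventually_lt_const ha
    obtain ⟨y, hy, hya⟩ := ((h1.filter_mono nhdsWithin_le_nhds).and
      (self_mem_nhdsWithin (s := Ioi x))).exists
    obtain ⟨r, hr1, hr2⟩ := exists_rat_btwn hya
    filter_upwards [(h r).eventually_lt_const ((le_ratExtend hg hr2).trans_lt hy)] with n hn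
    exact (ratExtend_le (hf n) hr1.le).trans_lt hn

theorem ratExtend_restrict {M : ℝ} {g : ℝ → ℝ} (hg : Monotone g) (hM : ∀ x, g x ∈ Icc (-M) M)
    {x : ℝ} (hx : ContinuousAt g x) : ratExtend (fun r => g r) x = g x := by
  have hf : (fun r : ℚ => g r) ∈ ratMonotone M :=
    ⟨fun a b hab => hg (by exact_mod_cast hab), fun r => hM r⟩
  refine le_antisymm (ciSup_le fun s => hg s.2.le) ?_
  refine le_of_tendsto (hx.mono_left (nhdsWithin_le_nhds (s := Iio x))) ?_
  filter_upwards [self_mem_nhdsWithin] with y hy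
  obtain ⟨r, hr1, hr2⟩ := exists_rat_btwn (mem_Iio.1 hy)
  exact (hg hr1.le).trans (le_ratExtend hf hr2)

theorem locallyIntegrable_of_bounded {f : ℝ → ℝ} (hf : Measurable f) {M : ℝ}
    (hM : ∀ x, |f x| ≤ M) : LocallyIntegrable f volume :=
  (locallyIntegrable_const M).mono hf.aestronglyMeasurable
    (Filter.Eventually.of_forall fun x => (hM x).trans (le_abs_self M))

/-- Uniformly bounded functions of uniformly bounded variation form a relatively compact subset
of `L¹_loc`. -/
theorem exists_isCompact_of_varLe (M A : ℝ) :
    ∃ K : Set L1Loc, IsCompact K ∧ ∀ (f : L1Loc) (g : ℝ → ℝ), (fun x => f x) =ᵐ[volume] g →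
      (∀ x, |g x| ≤ M) → VarLe g A → f ∈ K := by
  -- Room for both parts of the Jordan decomposition `g = N - (N - g)`: `N` lies in `[0, A]` and `N
  -- - g` in `[-M, A + M]`.
  set B := A + M
  let Φ₀ : (ratMonotone B) × (ratMonotone B) → ℝ → ℝ :=
    fun p x => ratExtend p.1 x - ratExtend p.2 x
  have hmeas : ∀ p, Measurable (Φ₀ p) := fun p =>
    (monotone_ratExtend p.1.2).measurable.sub (monotone_ratExtend p.2.2).measurable
  have hbd : ∀ p x, |Φ₀ p x| ≤ B + B := fun p x =>
    (abs_sub _ _).trans (add_le_add (abs_ratExtend_le p.1.2 x) (abs_ratExtend_le p.2.2 x))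
  let Φ : (ratMonotone B) × (ratMonotone B) → L1Loc :=
    fun p => L1Loc.mk (Φ₀ p) (locallyIntegrable_of_bounded (hmeas p) (hbd p))
  have hΦ : Continuous Φ := by
    -- Sequences suffice because the index set `ℚ` of the product is countable. Pointwise
    -- convergence holds off the countable set of discontinuities of the two limits, and domination
    -- does the rest.
    refine continuous_iff_seqContinuous.2 fun u p hu => ?_
    refine L1Loc.tendsto_iff.2 fun n => ?_
    have hlim : ∀ᵐ x, Filter.Tendsto (fun i => Φ₀ (u i) x) Filter.atTop (𝓝 (Φ₀ p x)) := by
      have c1 := (monotone_ratExtend p.1.2).countable_not_continuousAt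
      have c2 := (monotone_ratExtend p.2.2).countable_not_continuousAt
      filter_upwards [c1.ae_notMem volume, c2.ae_notMem volume] with x h1 h2
      simp only [not_not] at h1 h2
      have hu1 : Filter.Tendsto (fun i => ((u i).1 : ℚ → ℝ)) Filter.atTop (𝓝 (p.1 : ℚ → ℝ)) :=
        ((continuous_subtype_val.comp continuous_fst).tendsto p).comp hu
      have hu2 : Filter.Tendsto (fun i => ((u i).2 : ℚ → ℝ)) Filter.atTop (𝓝 (p.2 : ℚ → ℝ)) :=
        ((continuous_subtype_val.comp continuous_snd).tendsto p).comp hu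
      exact (tendsto_ratExtend (fun i => (u i).1.2) p.1.2 (tendsto_pi_nhds.1 hu1) h1).sub
        (tendsto_ratExtend (fun i => (u i).2.2) p.2.2 (tendsto_pi_nhds.1 hu2) h2)
    have h0 : (fun i => ∫ x in Icc (-(n : ℝ)) n, |Φ (u i) x - Φ p x|) =
        fun i => ∫ x in Icc (-(n : ℝ)) n, |Φ₀ (u i) x - Φ₀ p x| := by
      ext i
      refine integral_congr_ae (ae_restrict_of_ae ?_)
      filter_upwards [L1Loc.coeFn_mk _ (locallyIntegrable_of_bounded (hmeas (u i)) (hbd (u i))),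
        L1Loc.coeFn_mk _ (locallyIntegrable_of_bounded (hmeas p) (hbd p))] with x h1 h2
      simp only [Φ]
      rw [h1, h2]
    change Filter.Tendsto (fun i => ∫ x in Icc (-(n : ℝ)) n, |Φ (u i) x - Φ p x|) _ _
    rw [h0]
    have := tendsto_integral_of_dominated_convergence
      (μ := volume.restrict (Icc (-(n : ℝ)) n))
      (F := fun i x => |Φ₀ (u i) x - Φ₀ p x|) (f := fun _ => 0) (fun _ => (B + B) + (B + B))
      (fun i => ((hmeas _).sub (hmeas _)).abs.aestronglyMeasurable)
      (integrable_const _) (fun i => Filter.Eventually.of_forall fun x => by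
        rw [Real.norm_eq_abs, abs_abs]
        exact (abs_sub _ _).trans (add_le_add (hbd _ x) (hbd _ x)))
      (ae_restrict_of_ae (hlim.mono fun x hx => by
        simpa using (hx.sub_const (Φ₀ p x)).abs))
    simpa using this
  have : CompactSpace (ratMonotone B) := isCompact_iff_compactSpace.1 (isCompact_ratMonotone B)
  refine ⟨range Φ, isCompact_range hΦ, fun f g hfg hM hg => ?_⟩
  obtain ⟨N, hN, hNA, hNg⟩ := hg.exists_monotone
  have hM0 : 0 ≤ M := (abs_nonneg _).trans (hM 0)
  have hA0 := hg.nonneg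
  have hN' : Monotone (fun x => N x - g x) := fun x y hxy => by
    have := abs_le.1 (hNg x y hxy)
    simp only
    linarith [this.2]
  have hb1 : ∀ x, N x ∈ Icc (-B) B := fun x =>
    ⟨by have := (hNA x).1; simp only [B]; linarith, by have := (hNA x).2; simp only [B]; linarith⟩
  have hb2 : ∀ x, N x - g x ∈ Icc (-B) B := fun x => by
    have h1 := hNA x
    have h2 := abs_le.1 (hM x)
    exact ⟨by simp only [B]; linarith [h1.1, h2.2], by simp only [B]; linarith [h1.2, h2.1]⟩
  have hm1 : (fun r : ℚ => N r) ∈ ratMonotone B :=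
    ⟨fun a b hab => hN (by exact_mod_cast hab), fun r => hb1 r⟩
  have hm2 : (fun r : ℚ => N r - g r) ∈ ratMonotone B :=
    ⟨fun a b hab => hN' (by exact_mod_cast hab), fun r => hb2 r⟩
  refine ⟨(⟨_, hm1⟩, ⟨_, hm2⟩), L1Loc.ext ?_⟩
  refine (L1Loc.coeFn_mk _ _).trans (Filter.EventuallyEq.trans ?_ hfg.symm)
  filter_upwards [hN.countable_not_continuousAt.ae_notMem volume,
    hN'.countable_not_continuousAt.ae_notMem volume] with x h1 h2
  simp only [not_not] at h1 h2
  simp only [Φ₀]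
  rw [ratExtend_restrict hN hb1 h1, ratExtend_restrict hN' hb2 h2]
  ring

/-! ### Compactness in `C([0,T]; L¹_loc)` -/

/-- At each point `F` differs from its mean over the interval by at most its oscillation, which is
bounded by `N b - N a`. -/
theorem integral_abs_le_of_monotone_bound {F N : ℝ → ℝ} (hF : LocallyIntegrable F volume)
    {a b : ℝ} (hab : a ≤ b) (hN : ∀ x ∈ Icc a b, ∀ y ∈ Icc a b, |F y - F x| ≤ N b - N a) :
    ∫ x in a..b, |F x| ≤ |∫ x in a..b, F x| + (b - a) * (N b - N a) := by
  rcases hab.eq_or_lt with rfl | hlt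
  · simp
  have hFi : IntervalIntegrable F volume a b :=
    (hF.integrableOn_isCompact isCompact_uIcc).intervalIntegrable
  have hpt : ∀ x ∈ Icc a b, |F x| ≤ |∫ z in a..b, F z| / (b - a) + (N b - N a) := by
    intro x hx
    have h1 : (b - a) * F x = (∫ z in a..b, F z) + ∫ z in a..b, (F x - F z) := by
      rw [intervalIntegral.integral_sub intervalIntegrable_const hFi]
      simp
    have h2 : |∫ z in a..b, (F x - F z)| ≤ (N b - N a) * |b - a| := by
      rw [← Real.norm_eq_abs (∫ z in a..b, (F x - F z))]
      refine intervalIntegral.norm_integral_le_of_norm_le_const fun z hz => ?_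
      rw [uIoc_of_le hab] at hz
      exact hN z ⟨hz.1.le, hz.2⟩ x hx
    rw [abs_of_pos (sub_pos.2 hlt)] at h2
    have h3 : (b - a) * |F x| ≤ |∫ z in a..b, F z| + (N b - N a) * (b - a) := by
      rw [← abs_of_pos (sub_pos.2 hlt), ← abs_mul, h1, abs_of_pos (sub_pos.2 hlt)]
      exact (abs_add_le _ _).trans (by linarith)
    rw [div_add' _ _ _ (sub_pos.2 hlt).ne', le_div_iff₀ (sub_pos.2 hlt)]
    linarith
  calc ∫ x in a..b, |F x| ≤ ∫ x in a..b, (|∫ z in a..b, F z| / (b - a) + (N b - N a)) :=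
        intervalIntegral.integral_mono_on hab hFi.abs intervalIntegrable_const hpt
    _ = _ := by
        rw [intervalIntegral.integral_const, smul_eq_mul, mul_add,
          mul_div_cancel₀ _ (sub_pos.2 hlt).ne']

/-- Interpolation between a weak norm and the variation: cut `[-n, n]` into `K` equal cells and
compare `F` with its mean on each. The means contribute `D` per cell, and the oscillations telescope
to at most `A`. Choosing `K` large first and then `D` small makes the right side small. -/
theorem integral_Icc_abs_le {F N : ℝ → ℝ} (hF : LocallyIntegrable F volume) {A D : ℝ}
    (hNA : ∀ x, N x ∈ Icc 0 A) (hNm : Monotone N)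
    (hN : ∀ x y, x ≤ y → |F y - F x| ≤ N y - N x)
    (hD : ∀ a b, a ≤ b → |∫ x in a..b, F x| ≤ D) (n K : ℕ) (hK : 0 < K) :
    ∫ x in Icc (-(n : ℝ)) n, |F x| ≤ K * D + 2 * n / K * A := by
  set h : ℝ := 2 * n / K
  have hh : 0 ≤ h := by positivity
  set x : ℕ → ℝ := fun i => -(n : ℝ) + i * h
  have hx0 : x 0 = -n := by simp [x]
  have hxK : x K = n := by
    have : (K : ℝ) ≠ 0 := by positivity
    simp only [x, h]; field_simp; ring
  have hdx : ∀ i, x (i + 1) - x i = h := fun i => by simp only [x]; push_cast; ring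
  have hcell : ∀ i, ∫ z in (x i)..(x (i + 1)), |F z| ≤ D + h * (N (x (i + 1)) - N (x i)) := by
    intro i
    have hle : x i ≤ x (i + 1) := by linarith [hdx i]
    refine (integral_abs_le_of_monotone_bound (N := N) hF hle ?_).trans ?_
    · have key : ∀ p ∈ Icc (x i) (x (i + 1)), ∀ q ∈ Icc (x i) (x (i + 1)), p ≤ q →
          |F q - F p| ≤ N (x (i + 1)) - N (x i) := fun p hp q hq hpq =>
        (hN p q hpq).trans (sub_le_sub (hNm hq.2) (hNm hp.1))
      intro p hp q hq
      rcases le_total p q with hpq | hpq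
      · exact key p hp q hq hpq
      · rw [abs_sub_comm]; exact key q hq p hp hpq
    · rw [hdx]
      linarith [hD _ _ hle]
  have hint : ∀ a b, IntervalIntegrable (fun z => |F z|) volume a b := fun a b =>
    ((hF.integrableOn_isCompact isCompact_uIcc).intervalIntegrable).abs
  have hnn : -(n : ℝ) ≤ n := by
    have : (0 : ℝ) ≤ n := n.cast_nonneg
    linarith
  rw [integral_Icc_eq_integral_Ioc, ← intervalIntegral.integral_of_le hnn]
  calc ∫ z in (-(n : ℝ))..n, |F z| = ∑ i ∈ Finset.range K, ∫ z in (x i)..(x (i + 1)), |F z| := by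
        rw [intervalIntegral.sum_integral_adjacent_intervals fun i _ => hint _ _, hx0, hxK]
    _ ≤ ∑ i ∈ Finset.range K, (D + h * (N (x (i + 1)) - N (x i))) :=
        Finset.sum_le_sum fun i _ => hcell i
    _ = K * D + h * (N (x K) - N (x 0)) := by
        rw [Finset.sum_add_distrib, ← Finset.mul_sum, Finset.sum_range_sub (fun i => N (x i))]
        simp
    _ ≤ K * D + 2 * n / K * A := by
        have := (hNA (x K)).2
        have := (hNA (x 0)).1
        gcongr
        linarith

/-- Arzelà–Ascoli. Values at a fixed time lie in a Helly compact set, and equicontinuity follows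
from the weak Lipschitz bound `h2` through `integral_Icc_abs_le`. -/
theorem isCompact_closure_of_varLe {T M A C : ℝ} (S : Set C(Icc (0 : ℝ) T, L1Loc))
    (h1 : ∀ w ∈ S, ∀ t, ∃ g : ℝ → ℝ, (fun x => w t x) =ᵐ[volume] g ∧ (∀ x, |g x| ≤ M) ∧ VarLe g A)
    (h2 : ∀ w ∈ S, ∀ s t : Icc (0 : ℝ) T, ∀ a b : ℝ, a ≤ b →
      |∫ x in a..b, (w t x - w s x)| ≤ C * |(t : ℝ) - s|) :
    IsCompact (closure S) := by
  obtain ⟨K, hK, hKS⟩ := exists_isCompact_of_varLe M A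
  have hclosed : IsClosed (range (ContinuousMap.toUniformOnFunIsCompact :
      C(Icc (0 : ℝ) T, L1Loc) → _)) := by
    rw [ContinuousMap.range_toUniformOnFunIsCompact]
    exact UniformOnFun.isClosed_setOfPred_continuous CompactlyCoherentSpace.isCoherentWith
  refine ArzelaAscoli.isCompact_closure_of_isClosedEmbedding
    (F := fun (w : C(Icc (0 : ℝ) T, L1Loc)) => (w : Icc (0 : ℝ) T → L1Loc))
    (𝔖 := {K | IsCompact K}) (fun _ h => h)
    ⟨ContinuousMap.isUniformEmbedding_toUniformOnFunIsCompact.isEmbedding, hclosed⟩ ?_ ?_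
  · intro Q _
    refine Equicontinuous.equicontinuousOn (fun s => ?_) Q
    rw [L1Loc.isUniformInducing.equicontinuousAt_iff, Pi.uniformSpace_eq, equicontinuousAt_iInf_rng]
    intro n
    let _ : UniformSpace (∀ n : ℕ, Lp ℝ 1 ((volume : Measure ℝ).restrict (Icc (-(n : ℝ)) n))) :=
      UniformSpace.comap (Function.eval n) inferInstance
    have hui : IsUniformInducing
      (fun u : (∀ n : ℕ, Lp ℝ 1 ((volume : Measure ℝ).restrict (Icc (-(n : ℝ)) n))) => u n) := ⟨rfl⟩
    rw [hui.equicontinuousAt_iff, Metric.equicontinuousAt_iff_right]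
    intro ε hε
    -- The number of cells is fixed before `t`. The difference of two functions of variation `A` has
    -- variation at most `A + A`, which determines how fine the cells must be.
    obtain ⟨k, hk⟩ := exists_nat_gt (2 * n * (A + A) / (ε / 2))
    set k' := k + 1
    have hk' : 2 * n / (k' : ℝ) * (A + A) < ε / 2 := by
      rw [div_mul_eq_mul_div, div_lt_iff₀ (by positivity)]
      rw [div_lt_iff₀ (by positivity)] at hk
      have : (k' : ℝ) = k + 1 := by simp [k']
      rw [this]
      nlinarith
    have hev : ∀ᶠ t : Icc (0 : ℝ) T in 𝓝 s, k' * (|C| * |(t : ℝ) - s|) < ε / 2 := by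
      have : Filter.Tendsto (fun t : Icc (0 : ℝ) T => (k' : ℝ) * (|C| * |(t : ℝ) - s|)) (𝓝 s)
          (𝓝 (k' * (|C| * |(s : ℝ) - s|))) := by
        apply Continuous.tendsto
        fun_prop
      refine this.eventually_lt_const ?_
      simpa using hε
    filter_upwards [hev] with t ht w
    obtain ⟨f, hf, -, hfA⟩ := h1 w w.2 t
    obtain ⟨g, hg, -, hgA⟩ := h1 w w.2 s
    obtain ⟨N1, hN1, hN1A, hfN⟩ := hfA.exists_monotone
    obtain ⟨N2, hN2, hN2A, hgN⟩ := hgA.exists_monotone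
    simp only [Function.comp_def]
    rw [dist_comm, L1Loc.dist_restrict]
    have hfg : (fun x => w.1 t x - w.1 s x) =ᵐ[volume] fun x => f x - g x := hf.sub hg
    have hloc : LocallyIntegrable (fun x => f x - g x) volume :=
      (((w.1 t).2.sub (w.1 s).2)).congr hfg
    have := integral_Icc_abs_le (F := fun x => f x - g x) (N := fun x => N1 x + N2 x) hloc
      (A := A + A) (D := |C| * |(t : ℝ) - s|)
      (fun x => ⟨add_nonneg (hN1A x).1 (hN2A x).1, add_le_add (hN1A x).2 (hN2A x).2⟩)
      (hN1.add hN2) (fun x y hxy => by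
        have e : f y - g y - (f x - g x) = (f y - f x) - (g y - g x) := by ring
        rw [e]
        refine (abs_sub _ _).trans ?_
        linarith [hfN x y hxy, hgN x y hxy])
      (fun a b hab => by
        have e : ∫ x in a..b, (f x - g x) = ∫ x in a..b, (w.1 t x - w.1 s x) :=
          intervalIntegral.integral_congr_ae_restrict (ae_restrict_of_ae hfg.symm)
        rw [e]
        exact (h2 w w.2 s t a b hab).trans (by gcongr; exact le_abs_self C)) n k' (by simp [k'])
    have e : ∫ x in Icc (-(n : ℝ)) n, |w.1 t x - w.1 s x|
        = ∫ x in Icc (-(n : ℝ)) n, |f x - g x| :=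
      integral_congr_ae (ae_restrict_of_ae (hfg.mono fun x hx => by simp only at hx ⊢; rw [hx]))
    calc _ = ∫ x in Icc (-(n : ℝ)) n, |w.1 t x - w.1 s x| := rfl
      _ < ε := by rw [e]; linarith
  · intro Q _ t _
    refine ⟨K, hK, fun w hw => ?_⟩
    obtain ⟨g, hg, hgM, hgA⟩ := h1 w hw t
    exact hKS _ g hg hgM hgA

/-! ### Essential bounds in `C([0,T]; L¹_loc)` -/

/-- If `|g| ≤ M`, then the excess of `|f|` over `M` is at most `|g - f|`. So for `f` in the closure
the integral of the excess over every `[-n, n]` vanishes. -/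
theorem L1Loc.isClosed_abs_le (M : ℝ) : IsClosed {f : L1Loc | ∀ᵐ x : ℝ, |f x| ≤ M} := by
  refine isClosed_iff_frequently.2 fun f hf => ?_
  have key : ∀ n : ℕ, ∫ x in Icc (-(n : ℝ)) n, max (|f x| - M) 0 = 0 := by
    intro n
    have hfi := f.integrableOn_Icc n
    have hint : Integrable (fun x => max (|f x| - M) 0) (volume.restrict (Icc (-(n : ℝ)) n)) :=
      (hfi.abs.sub (integrable_const M)).sup (integrable_zero _ _ _)
    refine le_antisymm (le_of_forall_pos_le_add fun ε hε => ?_)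
      (integral_nonneg fun x => le_max_right _ _)
    have h1 : ∀ᶠ g in 𝓝 f, ∫ x in Icc (-(n : ℝ)) n, |g x - f x| < ε :=
      (L1Loc.tendsto_iff.1 (Filter.tendsto_id (x := 𝓝 f)) n).eventually_lt_const hε
    obtain ⟨g, hg1, hg2⟩ := (hf.and_eventually h1).exists
    rw [zero_add]
    refine le_trans (integral_mono_ae hint ((g.integrableOn_Icc n).sub hfi).abs ?_) hg2.le
    have hg1' : ∀ᵐ x : ℝ, |g x| ≤ M := hg1
    filter_upwards [ae_restrict_of_ae hg1'] with x hx
    refine max_le ?_ (abs_nonneg _)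
    have := abs_sub_abs_le_abs_sub (f x) (g x)
    rw [abs_sub_comm] at this
    simp only [Pi.sub_apply]
    linarith
  have key2 : ∀ n : ℕ, ∀ᵐ x ∂(volume.restrict (Icc (-(n : ℝ)) n)), |f x| ≤ M := fun n => by
    have hfi := f.integrableOn_Icc n
    have hint : Integrable (fun x => max (|f x| - M) 0) (volume.restrict (Icc (-(n : ℝ)) n)) :=
      (hfi.abs.sub (integrable_const M)).sup (integrable_zero _ _ _)
    have := (integral_eq_zero_iff_of_nonneg (fun x => le_max_right _ _) hint).1 (key n)
    filter_upwards [this] with x hx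
    have hx' : max (|f x| - M) 0 = 0 := hx
    have := le_max_left (|f x| - M) 0
    linarith
  have hU : (⋃ n : ℕ, Icc (-(n : ℝ)) n) = univ := by
    refine eq_univ_of_forall fun x => ?_
    obtain ⟨n, hn⟩ := exists_nat_ge |x|
    exact mem_iUnion.2 ⟨n, abs_le.1 hn⟩
  have := (ae_restrict_iUnion_iff (μ := volume) (fun n : ℕ => Icc (-(n : ℝ)) n)
    (fun x => |f x| ≤ M)).2 key2
  rwa [hU, Measure.restrict_univ] at this

/-- Nonempty relatively open subsets of `[0, T]` have positive measure because `T > 0`. Together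
with closedness of the essential bound this upgrades "almost every time" to "every time". -/
theorem dense_of_ae_timeMeasure {T : ℝ} (hT : 0 < T) {p : Icc (0 : ℝ) T → Prop}
    (h : ∀ᵐ t ∂timeMeasure T, p t) : Dense {t | p t} := by
  rw [dense_iff_inter_open]
  rintro U hU ⟨t, ht⟩
  obtain ⟨O, hO, rfl⟩ := isOpen_induced_iff.1 hU
  by_contra hne
  have hsub : Subtype.val ⁻¹' O ⊆ {t : Icc (0 : ℝ) T | ¬ p t} := fun s hs hp =>
    hne ⟨s, hs, hp⟩
  have h0 : timeMeasure T (Subtype.val ⁻¹' O) = 0 := measure_mono_null hsub h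
  rw [timeMeasure, comap_subtype_coe_apply measurableSet_Icc, Subtype.image_preimage_coe] at h0
  have hcl : (t : ℝ) ∈ closure (Ioo 0 T) := by
    rw [closure_Ioo hT.ne]
    exact t.2
  obtain ⟨s, hs1, hs2⟩ := mem_closure_iff.1 hcl O hO ht
  have h1 : 0 < volume (O ∩ Ioo 0 T) := (hO.inter isOpen_Ioo).measure_pos _ ⟨s, hs1, hs2⟩
  have h2 : volume (O ∩ Ioo 0 T) ≤ volume (Icc 0 T ∩ O) :=
    measure_mono fun x hx => ⟨Ioo_subset_Icc_self hx.2, hx.1⟩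
  rw [h0] at h2
  exact absurd h2 (not_le.2 h1)

/-- The essential bound of a weak solution holds at every time. -/
theorem IsWeakSolution.exists_bound {V γ q₀ : ℝ → ℝ} {T : ℝ} (hT : 0 < T)
    {q : C(Icc (0 : ℝ) T, L1Loc)} (h : IsWeakSolution V γ q₀ T q) :
    ∃ M : ℝ, 0 ≤ M ∧ ∀ t, ∀ᵐ x : ℝ, |q t x| ≤ M := by
  obtain ⟨M, hM⟩ := h.bounded
  have hcl : IsClosed {t | ∀ᵐ x : ℝ, |q t x| ≤ M} :=
    (L1Loc.isClosed_abs_le M).preimage q.continuous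
  have hall : ∀ t, ∀ᵐ x : ℝ, |q t x| ≤ M := fun t => by
    have := hcl.closure_eq ▸ (dense_of_ae_timeMeasure hT hM) t
    exact this
  refine ⟨M, ?_, hall⟩
  obtain ⟨x, hx⟩ := (hall ⟨0, le_rfl, hT.le⟩).exists
  exact (abs_nonneg _).trans hx

/-- Truncate the weight to `min G n` on `[-n, n]`. The discarded part costs at most `2M ∫ (G - H
n)`, uniformly in `t`, and the rest is controlled by convergence in `L¹([-n, n])`. -/
theorem tendsto_integral_abs_sub_mul {T M : ℝ} {q : C(Icc (0 : ℝ) T, L1Loc)}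
    (hM : ∀ t, ∀ᵐ x : ℝ, |q t x| ≤ M) {G : ℝ → ℝ} (hG : Integrable G) (hG0 : ∀ x, 0 ≤ G x)
    (s : Icc (0 : ℝ) T) :
    Filter.Tendsto (fun t => ∫ x, |q t x - q s x| * G x) (𝓝 s) (𝓝 0) := by
  have hM0 : 0 ≤ M := by
    obtain ⟨x, hx⟩ := (hM s).exists
    exact (abs_nonneg _).trans hx
  let H : ℕ → ℝ → ℝ := fun n => (Icc (-(n : ℝ)) n).indicator (fun x => min (G x) n)
  have hHi : ∀ n, Integrable (H n) := fun n => by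
    refine Integrable.indicator ?_ measurableSet_Icc
    refine hG.mono (hG.aestronglyMeasurable.inf aestronglyMeasurable_const)
      (Filter.Eventually.of_forall fun x => ?_)
    have : (0 : ℝ) ≤ n := n.cast_nonneg
    rw [Real.norm_eq_abs, Real.norm_eq_abs, abs_of_nonneg (le_min (hG0 x) this),
      abs_of_nonneg (hG0 x)]
    exact min_le_left _ _
  have hHG : ∀ n x, H n x ≤ G x ∧ 0 ≤ H n x := fun n x => by
    have : (0 : ℝ) ≤ n := n.cast_nonneg
    by_cases hx : x ∈ Icc (-(n : ℝ)) n
    · simp only [H, indicator_of_mem hx]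
      exact ⟨min_le_left _ _, le_min (hG0 x) this⟩
    · simp only [H, indicator_of_notMem hx]
      exact ⟨hG0 x, le_rfl⟩
  have hlim : Filter.Tendsto (fun n => ∫ x, (G x - H n x)) Filter.atTop (𝓝 0) := by
    have := tendsto_integral_of_dominated_convergence (F := fun n x => G x - H n x)
      (f := fun _ => 0) (fun x => G x)
      (fun n => (hG.sub (hHi n)).aestronglyMeasurable) hG
      (fun n => Filter.Eventually.of_forall fun x => by
        rw [Real.norm_eq_abs, abs_of_nonneg (sub_nonneg.2 (hHG n x).1)]
        linarith [(hHG n x).2])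
      (Filter.Eventually.of_forall fun x => by
        refine tendsto_const_nhds.congr' ?_
        obtain ⟨n₀, hn₀⟩ := exists_nat_ge (max |x| (G x))
        filter_upwards [Filter.eventually_ge_atTop n₀] with n hn
        have hn' : (n₀ : ℝ) ≤ n := by exact_mod_cast hn
        have hx : x ∈ Icc (-(n : ℝ)) n := abs_le.1 ((le_max_left _ _).trans (hn₀.trans hn'))
        simp only [H, indicator_of_mem hx]
        rw [min_eq_left ((le_max_right _ _).trans (hn₀.trans hn')), sub_self])
    simpa using this
  refine tendsto_order.2 ⟨fun a ha => Filter.Eventually.of_forall fun t =>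
    ha.trans_le (integral_nonneg fun x => mul_nonneg (abs_nonneg _) (hG0 x)), fun ε hε => ?_⟩
  obtain ⟨n, hn⟩ := (hlim.eventually_lt_const
    (show (0 : ℝ) < ε / 2 / (2 * M + 1) by positivity)).exists
  have h1 : ∀ᶠ t in 𝓝 s, ∫ x in Icc (-(n : ℝ)) n, |q t x - q s x| < ε / 2 / (n + 1) :=
    (L1Loc.tendsto_iff.1 (q.continuous.tendsto s) n).eventually_lt_const (by positivity)
  filter_upwards [h1] with t ht
  have hi1 : Integrable (fun x => (Icc (-(n : ℝ)) n).indicator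
      (fun x => |q t x - q s x|) x) :=
    (integrable_indicator_iff measurableSet_Icc).2
      (((q t).integrableOn_Icc n).sub ((q s).integrableOn_Icc n)).abs
  have hle : ∫ x, |q t x - q s x| * G x ≤
      ∫ x, (n * (Icc (-(n : ℝ)) n).indicator (fun x => |q t x - q s x|) x
        + 2 * M * (G x - H n x)) := by
    refine integral_mono_of_nonneg
      (Filter.Eventually.of_forall fun x => mul_nonneg (abs_nonneg _) (hG0 x))
      ((hi1.const_mul _).add ((hG.sub (hHi n)).const_mul _)) ?_
    filter_upwards [hM t, hM s] with x h1 h2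
    have h3 : |q t x - q s x| ≤ 2 * M := (abs_sub _ _).trans (by linarith)
    have h4 : |q t x - q s x| * G x =
      |q t x - q s x| * H n x + |q t x - q s x| * (G x - H n x) := by ring
    have h5 : |q t x - q s x| * (G x - H n x) ≤ 2 * M * (G x - H n x) :=
      mul_le_mul_of_nonneg_right h3 (sub_nonneg.2 (hHG n x).1)
    have h6 : |q t x - q s x| * H n x ≤
        n * (Icc (-(n : ℝ)) n).indicator (fun x => |q t x - q s x|) x := by
      by_cases hx : x ∈ Icc (-(n : ℝ)) n
      · simp only [H, indicator_of_mem hx]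
        rw [mul_comm]
        exact mul_le_mul_of_nonneg_right (min_le_right _ _) (abs_nonneg _)
      · simp only [H, indicator_of_notMem hx, mul_zero, le_refl]
    linarith
  have hGH : Integrable (fun x => G x - H n x) := hG.sub (hHi n)
  rw [integral_add (hi1.const_mul _) (hGH.const_mul _), integral_const_mul,
    integral_const_mul, integral_indicator measurableSet_Icc] at hle
  have h7 : (n : ℝ) * ∫ x in Icc (-(n : ℝ)) n, |q t x - q s x| ≤ ε / 2 := by
    have : (n : ℝ) * ∫ x in Icc (-(n : ℝ)) n, |q t x - q s x| ≤ (n + 1) * (ε / 2 / (n + 1)) :=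
      mul_le_mul (by linarith) ht.le (integral_nonneg fun x => abs_nonneg _) (by positivity)
    rwa [mul_div_cancel₀ _ (by positivity)] at this
  have h8 : 2 * M * ∫ x, (G x - H n x) < ε / 2 := by
    have h9 : 0 ≤ ∫ x, (G x - H n x) := integral_nonneg fun x => sub_nonneg.2 (hHG n x).1
    rw [lt_div_iff₀ (by positivity)] at hn
    nlinarith
  linarith

/-- `t ↦ ∫ q(t, x) g(t, x) dx` is continuous, if `g` is dominated by an integrable function and
continuous in `t` for almost every `x`. -/
theorem continuous_integral_mul {T M : ℝ} {q : C(Icc (0 : ℝ) T, L1Loc)}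
    (hM : ∀ t, ∀ᵐ x : ℝ, |q t x| ≤ M) {G : ℝ → ℝ} (hG : Integrable G)
    {g : Icc (0 : ℝ) T → ℝ → ℝ} (hgm : ∀ t, AEStronglyMeasurable (g t) volume)
    (hgG : ∀ t x, |g t x| ≤ G x) (hg : ∀ s, ∀ᵐ x : ℝ, ContinuousAt (fun t => g t x) s) :
    Continuous fun t => ∫ x, q t x * g t x := by
  refine continuous_iff_continuousAt.2 fun s => ?_
  have hG0 : ∀ x, 0 ≤ G x := fun x => (abs_nonneg _).trans (hgG s x)
  have hqm : ∀ t, AEStronglyMeasurable (fun x => q t x) volume := fun t =>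
    (q t).stronglyMeasurable.aestronglyMeasurable
  have hgi : ∀ t, Integrable (g t) := fun t =>
    hG.mono' (hgm t) (Filter.Eventually.of_forall (hgG t))
  have hi : ∀ t t', Integrable (fun x => q t x * g t' x) := fun t t' =>
    (hgi t').bdd_mul (hqm t) (hM t)
  have h1 : Filter.Tendsto (fun t => ∫ x, (q t x - q s x) * g t x) (𝓝 s) (𝓝 0) := by
    refine squeeze_zero_norm (fun t => ?_) (tendsto_integral_abs_sub_mul hM hG hG0 s)
    refine (norm_integral_le_integral_norm _).trans (integral_mono_of_nonneg
      (Filter.Eventually.of_forall fun x => norm_nonneg _) ?_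
      (Filter.Eventually.of_forall fun x => ?_))
    · refine hG.bdd_mul (c := M + M) ((hqm t).sub (hqm s)).norm ?_
      filter_upwards [hM t, hM s] with x h1 h2
      simp only [norm_abs_eq_norm, Real.norm_eq_abs]
      exact (abs_sub _ _).trans (add_le_add h1 h2)
    · simp only [norm_mul, Real.norm_eq_abs]
      exact mul_le_mul_of_nonneg_left (hgG t x) (abs_nonneg _)
  have h2 : Filter.Tendsto (fun t => ∫ x, q s x * g t x) (𝓝 s) (𝓝 (∫ x, q s x * g s x)) := by
    refine tendsto_integral_filter_of_dominated_convergence (fun x => M * G x)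
      (Filter.Eventually.of_forall fun t => (hqm s).mul (hgm t))
      (Filter.Eventually.of_forall fun t => ?_) (hG.const_mul M) ?_
    · filter_upwards [hM s] with x hx
      rw [norm_mul]
      exact mul_le_mul hx (hgG t x) (norm_nonneg _) ((abs_nonneg _).trans hx)
    · filter_upwards [hg s] with x hx
      exact hx.const_mul (q s x)
  have h3 := h1.add h2
  rw [zero_add] at h3
  refine h3.congr fun t => ?_
  rw [← integral_add]
  · exact integral_congr_ae (Filter.Eventually.of_forall fun x => by simp only; ring)
  · simp_rw [sub_mul]
    exact (hi t t).sub (hi s t)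
  · exact hi s t

/-! ### Convolution with one-sided kernels -/

/-- A nonnegative integrable kernel supported in `(-∞, 0)` whose translates are Lipschitz continuous
in `L¹`, with constant `c`. -/
structure IsKernel (k : ℝ → ℝ) (c : ℝ) : Prop where
  measurable : Measurable k
  nonneg : ∀ s, 0 ≤ k s
  zero : ∀ s, 0 ≤ s → k s = 0
  integrable : Integrable k
  shift : ∀ h, ∫ s, |k (s + h) - k s| ≤ c * |h|

/-- The function `x ↦ ∫ k(y - x) ρ(y) dy`. -/
def conv (k ρ : ℝ → ℝ) (x : ℝ) : ℝ := ∫ y, k (y - x) * ρ y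

theorem conv_congr {k ρ ρ' : ℝ → ℝ} (h : ρ =ᵐ[volume] ρ') (x : ℝ) : conv k ρ x = conv k ρ' x :=
  integral_congr_ae (h.mono fun y hy => by simp only; rw [hy])

/-- Dropping the endpoint changes nothing in the integral. It makes the kernel vanish at `0`, so
that a particle at `x` is influenced only by particles strictly to its left. -/
theorem nonlocalTerm_eq_conv (γ q : ℝ → ℝ) (x : ℝ) :
    nonlocalTerm γ q x = conv ((Iio 0).indicator γ) (fun y => |q y|) x := by
  rw [nonlocalTerm, conv, integral_Iic_eq_integral_Iio, ← integral_indicator measurableSet_Iio]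
  congr 1
  ext y
  by_cases hy : y < x
  · rw [indicator_of_mem (mem_Iio.2 hy), indicator_of_mem (mem_Iio.2 (sub_neg.2 hy))]
  · rw [indicator_of_notMem (by simpa using hy), indicator_of_notMem (by simpa using hy), zero_mul]

section conv

variable {k ρ : ℝ → ℝ} {M : ℝ}

theorem integrable_conv (hk : Integrable k) (hρ : AEStronglyMeasurable ρ volume)
    (hM : ∀ᵐ x, |ρ x| ≤ M) (x : ℝ) : Integrable fun y => k (y - x) * ρ y := by
  have := (hk.comp_sub_right x).bdd_mul hρ hM
  simpa only [mul_comm] using this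

theorem conv_eq_integral_mul_add (k ρ : ℝ → ℝ) (x : ℝ) :
    conv k ρ x = ∫ s, k s * ρ (s + x) := by
  rw [conv, ← integral_add_right_eq_self _ x]
  simp

theorem abs_conv_le (hk : Integrable k) (hM : ∀ᵐ x, |ρ x| ≤ M) (x : ℝ) :
    |conv k ρ x| ≤ M * ∫ s, |k s| := by
  rw [conv, ← integral_sub_right_eq_self (fun s => |k s|) x, ← integral_const_mul,
    ← Real.norm_eq_abs]
  refine (norm_integral_le_integral_norm _).trans (integral_mono_of_nonneg
    (Filter.Eventually.of_forall fun _ => norm_nonneg _)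
    ((hk.comp_sub_right x).abs.const_mul M) ?_)
  filter_upwards [hM] with y hy
  rw [norm_mul, mul_comm]
  exact mul_le_mul_of_nonneg_right hy (norm_nonneg _)

theorem conv_nonneg (hk : ∀ s, 0 ≤ k s) (hρ : ∀ x, 0 ≤ ρ x) (x : ℝ) : 0 ≤ conv k ρ x :=
  integral_nonneg fun _ => mul_nonneg (hk _) (hρ _)

/-- Translating the average means translating the kernel, so the regularity in space comes from the
kernel alone and only boundedness of `ρ` is used. -/
theorem abs_conv_sub_le {c : ℝ} (hk : IsKernel k c) (hρ : AEStronglyMeasurable ρ volume)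
    (hM : ∀ᵐ x, |ρ x| ≤ M) (x y : ℝ) : |conv k ρ x - conv k ρ y| ≤ M * c * |x - y| := by
  have hM0 : 0 ≤ M := by
    obtain ⟨z, hz⟩ := hM.exists
    exact (abs_nonneg _).trans hz
  have hki := hk.integrable
  rw [conv, conv, ← integral_sub (integrable_conv hki hρ hM x) (integrable_conv hki hρ hM y)]
  have hi : Integrable fun z => k (z - x) - k (z - y) :=
    (hki.comp_sub_right x).sub (hki.comp_sub_right y)
  calc |∫ z, (k (z - x) * ρ z - k (z - y) * ρ z)| ≤ ∫ z, M * |k (z - x) - k (z - y)| := by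
        rw [← Real.norm_eq_abs]
        refine (norm_integral_le_integral_norm _).trans (integral_mono_of_nonneg
          (Filter.Eventually.of_forall fun _ => norm_nonneg _) (hi.abs.const_mul M) ?_)
        filter_upwards [hM] with z hz
        rw [← sub_mul, norm_mul, mul_comm]
        exact mul_le_mul_of_nonneg_right hz (norm_nonneg _)
    _ = M * ∫ s, |k (s + (y - x)) - k s| := by
        rw [integral_const_mul, ← integral_add_right_eq_self _ y]
        congr 2
        ext s
        congr 3 <;> ring
    _ ≤ M * (c * |y - x|) := mul_le_mul_of_nonneg_left (hk.shift _) hM0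
    _ = M * c * |x - y| := by rw [abs_sub_comm]; ring

theorem continuous_conv {c : ℝ} (hk : IsKernel k c) (hρ : AEStronglyMeasurable ρ volume)
    (hM : ∀ᵐ x, |ρ x| ≤ M) : Continuous (conv k ρ) := by
  refine (LipschitzWith.of_dist_le_mul (K := (M * c).toNNReal) fun x y => ?_).continuous
  rw [Real.dist_eq, Real.dist_eq]
  exact (abs_conv_sub_le hk hρ hM x y).trans
    (mul_le_mul_of_nonneg_right (Real.le_coe_toNNReal _) (abs_nonneg _))

end conv

/-- The absolute value on `L¹_loc`. -/
def L1Loc.abs (f : L1Loc) : L1Loc := L1Loc.mk (fun x => |f x|) (fun x => IntegrableAtFilter.norm (f.2 x))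

theorem L1Loc.coeFn_abs (f : L1Loc) : (fun x => L1Loc.abs f x) =ᵐ[volume] fun x => |f x| :=
  L1Loc.coeFn_mk _ _

theorem L1Loc.continuous_abs : Continuous L1Loc.abs := by
  refine continuous_iff_continuousAt.2 fun f => L1Loc.tendsto_iff.2 fun n => ?_
  refine squeeze_zero (fun g => integral_nonneg fun x => abs_nonneg _) (fun g => ?_)
    (L1Loc.tendsto_iff.1 (Filter.tendsto_id (x := 𝓝 f)) n)
  refine integral_mono_ae ((L1Loc.integrableOn_Icc _ n).sub (L1Loc.integrableOn_Icc _ n)).abs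
    ((L1Loc.integrableOn_Icc _ n).sub (L1Loc.integrableOn_Icc _ n)).abs ?_
  filter_upwards [ae_restrict_of_ae (L1Loc.coeFn_abs g), ae_restrict_of_ae (L1Loc.coeFn_abs f)]
    with x h1 h2
  rw [h1, h2]
  exact abs_abs_sub_abs_le _ _

/-- The absolute value of a curve in `L¹_loc`. -/
def absCurve {T : ℝ} (q : C(Icc (0 : ℝ) T, L1Loc)) : C(Icc (0 : ℝ) T, L1Loc) :=
  ⟨fun t => L1Loc.abs (q t), L1Loc.continuous_abs.comp q.continuous⟩

theorem coeFn_absCurve {T : ℝ} (q : C(Icc (0 : ℝ) T, L1Loc)) (t : Icc (0 : ℝ) T) :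
    (fun x => absCurve q t x) =ᵐ[volume] fun x => |q t x| := L1Loc.coeFn_abs _

theorem aestronglyMeasurable_abs (f : L1Loc) :
    AEStronglyMeasurable (fun x => |f x|) volume :=
  f.stronglyMeasurable.aestronglyMeasurable.norm

theorem continuous_conv_abs {T M c : ℝ} {q : C(Icc (0 : ℝ) T, L1Loc)}
    (hM : ∀ t, ∀ᵐ x : ℝ, |q t x| ≤ M) {k : ℝ → ℝ} (hk : IsKernel k c) (x : ℝ) :
    Continuous fun t => conv k (fun y => |q t y|) x := by
  have hM' : ∀ t, ∀ᵐ x : ℝ, |absCurve q t x| ≤ M := fun t => by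
    filter_upwards [coeFn_absCurve q t, hM t] with x h1 h2
    rwa [h1, abs_abs]
  have := continuous_integral_mul hM' (G := fun y => |k (y - x)|)
    (hk.integrable.comp_sub_right x).abs (g := fun _ y => k (y - x))
    (fun t => (hk.integrable.comp_sub_right x).aestronglyMeasurable) (fun t y => le_rfl)
    (fun s => Filter.Eventually.of_forall fun y => continuousAt_const)
  refine this.congr fun t => ?_
  rw [← conv_congr (coeFn_absCurve q t) x, conv]
  simp only [mul_comm]

/-- The nonlocal term of a bounded curve is a continuous curve. -/
theorem exists_isNonlocalTerm {T M c : ℝ} {q : C(Icc (0 : ℝ) T, L1Loc)}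
    (hM : ∀ t, ∀ᵐ x : ℝ, |q t x| ≤ M) {γ : ℝ → ℝ} (hk : IsKernel ((Iio 0).indicator γ) c) :
    ∃ w : C(Icc (0 : ℝ) T, L1Loc), IsNonlocalTerm γ q w := by
  set k := (Iio (0 : ℝ)).indicator γ
  have hM' : ∀ t, ∀ᵐ x : ℝ, |(|q t x|)| ≤ M := fun t => (hM t).mono fun x hx => by rwa [abs_abs]
  have hbd : ∀ t x, |conv k (fun y => |q t y|) x| ≤ M * ∫ s, |k s| := fun t x =>
    abs_conv_le hk.integrable (hM' t) x
  have hm : ∀ t, Measurable (conv k (fun y => |q t y|)) := fun t =>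
    (continuous_conv hk (aestronglyMeasurable_abs _) (hM' t)).measurable
  let w : Icc (0 : ℝ) T → L1Loc := fun t =>
    L1Loc.mk (conv k (fun y => |q t y|)) (locallyIntegrable_of_bounded (hm t) (hbd t))
  have hw : ∀ t, (fun x => w t x) =ᵐ[volume] conv k (fun y => |q t y|) := fun t =>
    L1Loc.coeFn_mk _ _
  refine ⟨⟨w, ?_⟩, fun t => ?_⟩
  · refine continuous_iff_continuousAt.2 fun s => L1Loc.tendsto_iff.2 fun n => ?_
    have h0 : (fun t => ∫ x in Icc (-(n : ℝ)) n, |w t x - w s x|) = fun t =>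
        ∫ x in Icc (-(n : ℝ)) n, |conv k (fun y => |q t y|) x - conv k (fun y => |q s y|) x| := by
      ext t
      refine integral_congr_ae (ae_restrict_of_ae ?_)
      filter_upwards [hw t, hw s] with x h1 h2
      rw [h1, h2]
    rw [h0]
    have := tendsto_integral_filter_of_dominated_convergence (l := 𝓝 s)
      (μ := volume.restrict (Icc (-(n : ℝ)) n))
      (F := fun t x => |conv k (fun y => |q t y|) x - conv k (fun y => |q s y|) x|)
      (f := fun _ => 0) (fun _ => (M * ∫ s, |k s|) + M * ∫ s, |k s|)
      (Filter.Eventually.of_forall fun t => ((hm t).sub (hm s)).abs.aestronglyMeasurable)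
      (Filter.Eventually.of_forall fun t => Filter.Eventually.of_forall fun x => by
        rw [Real.norm_eq_abs, abs_abs]
        exact (abs_sub _ _).trans (add_le_add (hbd _ x) (hbd _ x)))
      (integrable_const _) (Filter.Eventually.of_forall fun x => by
        have := (((continuous_conv_abs hM hk x).tendsto s).sub_const
          (conv k (fun y => |q s y|) x)).abs
        simpa using this)
    simpa using this
  · filter_upwards [hw t] with x hx
    rw [nonlocalTerm_eq_conv]
    exact hx

/-! ### Flows of bounded Lipschitz fields on the line -/

/-- `X` is the flow on `[0, T]` of the field `b`, which is bounded by `C` and Lipschitz continuous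
with constant `L` in the space variable. The curves are extended to `C¹` curves on `ℝ`. -/
structure IsFlow (b : ℝ → ℝ → ℝ) (T C : ℝ) (L : ℝ≥0) (X : ℝ → ℝ → ℝ) : Prop where
  cont : ∀ x, Continuous fun t => b t x
  lip : ∀ t, LipschitzWith L (b t)
  bound : ∀ t x, |b t x| ≤ C
  init : ∀ x, X 0 x = x
  contDiff : ∀ x, ContDiff ℝ 1 fun t => X t x
  deriv : ∀ x, ∀ t ∈ Icc (0 : ℝ) T, HasDerivAt (fun t => X t x) (b t (X t x)) t

/-- Picard–Lindelöf provides curves `α x` on `[0, T]`. Integrating the field along `α x`, with the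
position frozen outside `[0, T]`, yields curves that are `C¹` on all of `ℝ`; the test functions
built from them have to be `C¹` on the whole plane. -/
theorem exists_isFlow {b : ℝ → ℝ → ℝ} {T C : ℝ} {L : ℝ≥0} (hT : 0 ≤ T)
    (cont : ∀ x, Continuous fun t => b t x) (lip : ∀ t, LipschitzWith L (b t))
    (bound : ∀ t x, |b t x| ≤ C) : ∃ X, IsFlow b T C L X := by
  have hC : 0 ≤ C := (abs_nonneg _).trans (bound 0 0)
  have hbc : Continuous (fun p : ℝ × ℝ => b p.1 p.2) :=
    continuous_prod_of_continuous_lipschitzWith' _ L lip cont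
  have hex : ∀ x, ∃ α : ℝ → ℝ, α 0 = x ∧
      ∀ t ∈ Icc (0 : ℝ) T, HasDerivWithinAt α (b t (α t)) (Icc 0 T) t := fun x => by
    have hpl : IsPicardLindelof b (⟨0, le_rfl, hT⟩ : Icc (0 : ℝ) T) x (C * T).toNNReal 0
        C.toNNReal L := by
      refine ⟨fun t _ => (lip t).lipschitzOnWith, fun x _ => (cont x).continuousOn,
        fun t _ x _ => ?_, ?_⟩
      · rw [Real.coe_toNNReal _ hC]; exact bound t x
      · rw [Real.coe_toNNReal _ hC, Real.coe_toNNReal _ (by positivity)]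
        simp [hT]
    exact hpl.exists_eq_forall_mem_Icc_hasDerivWithinAt₀
  choose α hα0 hα using hex
  let B : ℝ → ℝ → ℝ := fun x s => b s (α x (projIcc 0 T hT s))
  have hαc : ∀ x, ContinuousOn (α x) (Icc 0 T) := fun x t ht => (hα x t ht).continuousWithinAt
  have hBc : ∀ x, Continuous (B x) := fun x => by
    have h1 : Continuous fun s => α x (projIcc 0 T hT s) :=
      (continuousOn_iff_continuous_domRestrict.1 (hαc x)).comp continuous_projIcc
    exact hbc.comp (continuous_id.prodMk h1)
  let X : ℝ → ℝ → ℝ := fun t x => x + ∫ s in (0 : ℝ)..t, B x s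
  have hder : ∀ x t, HasDerivAt (fun t => X t x) (B x t) t := fun x t =>
    (((hBc x).integral_hasStrictDerivAt 0 t).hasDerivAt).const_add x
  have hXα : ∀ x, ∀ t ∈ Icc (0 : ℝ) T, X t x = α x t := fun x t ht => by
    have h1 := intervalIntegral.integral_eq_sub_of_hasDeriv_right_of_le (f := α x) (f' := B x) ht.1
      ((hαc x).mono (Icc_subset_Icc_right ht.2)) (fun s hs => by
        have hs' : s ∈ Icc (0 : ℝ) T := ⟨hs.1.le, hs.2.le.trans ht.2⟩
        have := ((hα x s hs').hasDerivAt (Icc_mem_nhds hs.1 (hs.2.trans_le ht.2))).hasDerivWithinAt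
          (s := Ioi s)
        simpa only [B, projIcc_of_mem hT hs'] using this) ((hBc x).intervalIntegrable _ _)
    simp only [X]
    rw [h1, hα0]
    ring
  refine ⟨X, cont, lip, bound, fun x => by simp [X], fun x => ?_, fun x t ht => ?_⟩
  · rw [contDiff_one_iff_deriv]
    refine ⟨fun t => (hder x t).differentiableAt, ?_⟩
    have : _root_.deriv (fun t => X t x) = B x := funext fun t => (hder x t).deriv
    rw [this]
    exact hBc x
  · have := hder x t
    rw [hXα x t ht]
    simpa only [B, projIcc_of_mem hT ht] using this

namespace IsFlow

variable {b : ℝ → ℝ → ℝ} {T C : ℝ} {L : ℝ≥0} {X : ℝ → ℝ → ℝ}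

theorem bound_nonneg (h : IsFlow b T C L X) : 0 ≤ C := (abs_nonneg _).trans (h.bound 0 0)

theorem continuous_time (h : IsFlow b T C L X) (x : ℝ) : Continuous fun t => X t x :=
  (h.contDiff x).continuous

theorem continuous_field (h : IsFlow b T C L X) (x : ℝ) : Continuous fun t => b t (X t x) := by
  have hbc : Continuous (fun p : ℝ × ℝ => b p.1 p.2) :=
    continuous_prod_of_continuous_lipschitzWith' _ L h.lip h.cont
  exact hbc.comp (continuous_id.prodMk (h.continuous_time x))

theorem sub_eq_integral (h : IsFlow b T C L X) (x : ℝ) {s t : ℝ} (hs : s ∈ Icc 0 T)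
    (ht : t ∈ Icc 0 T) : X t x - X s x = ∫ r in s..t, b r (X r x) := by
  rw [intervalIntegral.integral_eq_sub_of_hasDerivAt
    (fun r hr => h.deriv x r (uIcc_subset_Icc hs ht hr))
    ((h.continuous_field x).intervalIntegrable _ _)]

theorem abs_sub_time_le (h : IsFlow b T C L X) (x : ℝ) {s t : ℝ} (hs : s ∈ Icc 0 T)
    (ht : t ∈ Icc 0 T) : |X t x - X s x| ≤ C * |t - s| := by
  rw [h.sub_eq_integral x hs ht, ← Real.norm_eq_abs]
  exact intervalIntegral.norm_integral_le_of_norm_le_const fun r _ => h.bound r _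

theorem dist_le (h : IsFlow b T C L X) (x y : ℝ) {t : ℝ} (ht : t ∈ Icc 0 T) :
    |X t x - X t y| ≤ |x - y| * Real.exp (L * t) := by
  have := dist_le_of_trajectories_ODE (v := b) (K := L) (f := fun t => X t x)
    (g := fun t => X t y) (a := 0) (b := T) (δ := |x - y|) h.lip
    (h.continuous_time x).continuousOn
    (fun r hr => (h.deriv x r (Ico_subset_Icc_self hr)).hasDerivWithinAt)
    (h.continuous_time y).continuousOn
    (fun r hr => (h.deriv y r (Ico_subset_Icc_self hr)).hasDerivWithinAt)
    (by rw [h.init, h.init, Real.dist_eq]) t ht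
  rwa [Real.dist_eq, sub_zero] at this

/-- Grönwall's inequality for the time-reversed trajectories, which solve an equation with the same
Lipschitz constant. -/
theorem le_dist (h : IsFlow b T C L X) (x y : ℝ) {t : ℝ} (ht : t ∈ Icc 0 T) :
    |x - y| ≤ |X t x - X t y| * Real.exp (L * t) := by
  have hd : ∀ x, ∀ r ∈ Ico 0 t, HasDerivWithinAt (fun r => X (t - r) x)
      ((fun r z => - b (t - r) z) r (X (t - r) x)) (Ici r) r := fun x r hr => by
    have h1 := h.deriv x (t - r) ⟨by linarith [hr.2], by linarith [hr.1, ht.2]⟩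
    have h2 : HasDerivAt (fun r => t - r) (-1) r := by
      simpa using (hasDerivAt_id r).const_sub t
    have h3 := (h1.comp r h2).hasDerivWithinAt (s := Ici r)
    simpa [Function.comp_def] using h3
  have hc : ∀ x, Continuous fun r => X (t - r) x := fun x =>
    (h.continuous_time x).comp (continuous_const.sub continuous_id)
  have := dist_le_of_trajectories_ODE (v := fun r z => - b (t - r) z) (K := L)
    (f := fun r => X (t - r) x) (g := fun r => X (t - r) y) (a := 0) (b := t)
    (δ := |X t x - X t y|) (fun r => (h.lip (t - r)).neg)
    (hc x).continuousOn (hd x) (hc y).continuousOn (hd y)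
    (by rw [sub_zero, Real.dist_eq]) t ⟨ht.1, le_rfl⟩
  simpa [Real.dist_eq, h.init] using this

/-- Two characteristics that exchange their order meet at some time, by the intermediate value
theorem; `le_dist` at that time says that they started at the same point. -/
theorem strictMono (h : IsFlow b T C L X) {t : ℝ} (ht : t ∈ Icc 0 T) : StrictMono (X t) := by
  intro x y hxy
  by_contra hle
  push Not at hle
  have hc : ContinuousOn (fun r => X r y - X r x) (Icc 0 t) :=
    ((h.continuous_time y).sub (h.continuous_time x)).continuousOn
  have h0 : (0 : ℝ) ∈ Icc ((fun r => X r y - X r x) t) ((fun r => X r y - X r x) 0) := by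
    simp only [h.init]
    exact ⟨by linarith, by linarith⟩
  obtain ⟨r, hr, hr0⟩ := intermediate_value_Icc' ht.1 hc h0
  have := h.le_dist y x (t := r) ⟨hr.1, hr.2.trans ht.2⟩
  simp only at hr0
  rw [hr0, abs_zero, zero_mul] at this
  have := abs_pos.2 (sub_pos.2 hxy).ne'
  linarith

theorem continuous (h : IsFlow b T C L X) {t : ℝ} (ht : t ∈ Icc 0 T) : Continuous (X t) := by
  refine (LipschitzWith.of_dist_le_mul (K := (Real.exp (L * t)).toNNReal) fun x y => ?_).continuous
  rw [Real.dist_eq, Real.dist_eq, Real.coe_toNNReal _ (Real.exp_pos _).le, mul_comm]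
  exact h.dist_le x y ht

theorem surjective (h : IsFlow b T C L X) {t : ℝ} (ht : t ∈ Icc 0 T) :
    Function.Surjective (X t) := by
  have hd : ∀ x, |X t x - x| ≤ C * t := fun x => by
    have := h.abs_sub_time_le x (s := 0) (t := t) ⟨le_rfl, ht.1.trans ht.2⟩ ht
    rwa [h.init, sub_zero, abs_of_nonneg ht.1] at this
  refine (h.continuous ht).surjective ?_ ?_
  · refine Filter.tendsto_atTop_mono (f := fun x => x - C * t) (fun x => ?_)
      (Filter.tendsto_atTop_add_const_right _ _ Filter.tendsto_id)
    linarith [(abs_le.1 (hd x)).1]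
  · refine Filter.tendsto_atBot_mono (f := fun x => x + C * t) (g := X t) (fun x => ?_)
      (Filter.tendsto_atBot_add_const_right _ _ Filter.tendsto_id)
    linarith [(abs_le.1 (hd x)).2]

end IsFlow

/-! ### Conservation of mass along the flow -/

open Real (smoothTransition)

theorem deriv_smoothTransition_eq_zero {z : ℝ} (hz : z ∉ Icc (0 : ℝ) 1) :
    deriv smoothTransition z = 0 := by
  rw [mem_Icc, not_and_or, not_le, not_le] at hz
  rcases hz with hz | hz
  · have : smoothTransition =ᶠ[𝓝 z] fun _ => 0 := by
      filter_upwards [Iio_mem_nhds hz] with y hy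
      exact Real.smoothTransition.zero_of_nonpos (le_of_lt hy)
    rw [this.deriv_eq, deriv_const]
  · have : smoothTransition =ᶠ[𝓝 z] fun _ => 1 := by
      filter_upwards [Ioi_mem_nhds hz] with y hy
      exact Real.smoothTransition.one_of_one_le (le_of_lt hy)
    rw [this.deriv_eq, deriv_const]

theorem contDiff_smoothTransition_one : ContDiff ℝ 1 smoothTransition :=
  Real.smoothTransition.contDiff (n := 1)

theorem hasDerivAt_smoothTransition (z : ℝ) :
    HasDerivAt smoothTransition (deriv smoothTransition z) z :=
  (contDiff_smoothTransition_one.differentiable one_ne_zero z).hasDerivAt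

theorem exists_abs_deriv_smoothTransition_le : ∃ D : ℝ, 0 ≤ D ∧ ∀ z,
    |deriv smoothTransition z| ≤ D := by
  have hc : Continuous (deriv smoothTransition) :=
    (contDiff_one_iff_deriv.1 contDiff_smoothTransition_one).2
  obtain ⟨D, hD⟩ := (isCompact_Icc (a := (0 : ℝ)) (b := 1)).exists_bound_of_continuousOn
    hc.continuousOn
  refine ⟨max D 0, le_max_right _ _, fun z => ?_⟩
  by_cases hz : z ∈ Icc (0 : ℝ) 1
  · exact (hD z hz).trans (le_max_left _ _)
  · rw [deriv_smoothTransition_eq_zero hz, abs_zero]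
    exact le_max_right _ _

theorem abs_smoothTransition_sub_indicator_le {ε : ℝ} (hε : 0 < ε) (α x : ℝ) :
    |smoothTransition ((x - α) / ε) - (Ioi α).indicator 1 x| ≤
      (Icc α (α + ε)).indicator 1 x := by
  by_cases h1 : α < x
  · rw [indicator_of_mem (mem_Ioi.2 h1)]
    by_cases h2 : x ≤ α + ε
    · rw [indicator_of_mem (show x ∈ Icc α (α + ε) from ⟨h1.le, h2⟩)]
      have := Real.smoothTransition.nonneg ((x - α) / ε)
      have := Real.smoothTransition.le_one ((x - α) / ε)
      rw [abs_le]
      constructor <;> simp only [Pi.one_apply] <;> linarith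
    · rw [Real.smoothTransition.one_of_one_le ((one_le_div hε).2 (by linarith))]
      simp only [Pi.one_apply, sub_self, abs_zero]
      exact indicator_nonneg (fun _ _ => zero_le_one) _
  · rw [indicator_of_notMem (by simpa using h1), Real.smoothTransition.zero_of_nonpos
      (div_nonpos_of_nonpos_of_nonneg (by linarith) hε.le), sub_zero, abs_zero]
    exact indicator_nonneg (fun _ _ => zero_le_one) _

/-- The slope of the ramp is of order `1/ε`, but it is nonzero only on a strip of width `ε`, where
the Lipschitz function deviates from `f α` by at most `L ε`. The product is bounded independently of
`ε`. -/
theorem abs_ramp_deriv_mul_le {D ε L : ℝ} (hε : 0 < ε) (hL : 0 ≤ L) (hD0 : 0 ≤ D)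
    (hD : ∀ z, |deriv smoothTransition z| ≤ D) {f : ℝ → ℝ} {α : ℝ}
    (hf : ∀ x, |f x - f α| ≤ L * |x - α|) (x : ℝ) :
    |deriv smoothTransition ((x - α) / ε) / ε * (f x - f α)| ≤
      D * L * (Icc α (α + ε)).indicator 1 x := by
  by_cases hx : x ∈ Icc α (α + ε)
  · rw [indicator_of_mem hx, Pi.one_apply, mul_one, abs_mul, abs_div, abs_of_pos hε]
    have h1 : |f x - f α| ≤ L * ε := (hf x).trans (by
      refine mul_le_mul_of_nonneg_left ?_ hL
      rw [abs_of_nonneg (by linarith [hx.1])]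
      linarith [hx.2])
    calc |deriv smoothTransition ((x - α) / ε)| / ε * |f x - f α| ≤ D / ε * (L * ε) := by
          refine mul_le_mul ?_ h1 (abs_nonneg _) (by positivity)
          exact div_le_div_of_nonneg_right (hD _) hε.le
      _ = D * L := by field_simp
  · rw [indicator_of_notMem hx, mul_zero, deriv_smoothTransition_eq_zero]
    · simp
    · rintro ⟨h1, h2⟩
      rw [le_div_iff₀ hε] at h1
      rw [div_le_iff₀ hε] at h2
      exact hx ⟨by linarith, by linarith⟩

/-- The test function `χ(t) (Ψ((x - X(t,a))/ε) - Ψ((x - X(t,b))/ε))`, localized between two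
characteristics. -/
def rampTest (X : ℝ → ℝ → ℝ) (χ : ℝ → ℝ) (ε a b : ℝ) (p : ℝ × ℝ) : ℝ :=
  χ p.1 * (smoothTransition ((p.2 - X p.1 a) / ε) - smoothTransition ((p.2 - X p.1 b) / ε))

section

variable {β : ℝ → ℝ → ℝ} {T C : ℝ} {L : ℝ≥0} {X : ℝ → ℝ → ℝ} {χ : ℝ → ℝ} {ε a b : ℝ}

theorem contDiff_rampTest (hX : IsFlow β T C L X) (hχ : ContDiff ℝ 1 χ) :
    ContDiff ℝ 1 (rampTest X χ ε a b) := by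
  have h : ∀ c, ContDiff ℝ 1 fun p : ℝ × ℝ => smoothTransition ((p.2 - X p.1 c) / ε) := fun c =>
    contDiff_smoothTransition_one.comp
      ((contDiff_snd.sub ((hX.contDiff c).comp contDiff_fst)).div_const ε)
  exact (hχ.comp contDiff_fst).mul ((h a).sub (h b))

theorem rampTest_eq_zero_of_notMem (hε : 0 < ε) {A B t x : ℝ} (hA : A ≤ X t a ∧ A ≤ X t b)
    (hB : X t a + ε ≤ B ∧ X t b + ε ≤ B) (hx : x ∉ Icc A B) : rampTest X χ ε a b (t, x) = 0 := by
  rw [mem_Icc, not_and_or, not_le, not_le] at hx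
  simp only [rampTest]
  rcases hx with hx | hx
  · rw [Real.smoothTransition.zero_of_nonpos (div_nonpos_of_nonpos_of_nonneg
      (by linarith [hA.1]) hε.le), Real.smoothTransition.zero_of_nonpos
      (div_nonpos_of_nonpos_of_nonneg (by linarith [hA.2]) hε.le)]
    ring
  · rw [Real.smoothTransition.one_of_one_le ((one_le_div hε).2 (by linarith [hB.1])),
      Real.smoothTransition.one_of_one_le ((one_le_div hε).2 (by linarith [hB.2]))]
    ring

theorem hasCompactSupport_rampTest (hX : IsFlow β T C L X) (hχs : HasCompactSupport χ)
    (hε : 0 < ε) : HasCompactSupport (rampTest X χ ε a b) := by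
  have hc : ∀ c, ∃ K, ∀ t ∈ tsupport χ, |X t c| ≤ K := fun c => by
    obtain ⟨K, hK⟩ := IsCompact.exists_bound_of_continuousOn hχs
      (hX.continuous_time c).continuousOn
    exact ⟨K, hK⟩
  obtain ⟨K1, hK1⟩ := hc a
  obtain ⟨K2, hK2⟩ := hc b
  have hcomp : IsCompact (tsupport χ ×ˢ Icc (-(max K1 K2)) (max K1 K2 + ε)) :=
    IsCompact.prod hχs isCompact_Icc
  refine HasCompactSupport.intro hcomp fun p hp => ?_
  by_cases ht : p.1 ∈ tsupport χ
  · have hx : p.2 ∉ Icc (-(max K1 K2)) (max K1 K2 + ε) := fun h => hp ⟨ht, h⟩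
    have h1 := abs_le.1 ((hK1 _ ht).trans (le_max_left K1 K2))
    have h2 := abs_le.1 ((hK2 _ ht).trans (le_max_right K1 K2))
    exact rampTest_eq_zero_of_notMem hε ⟨h1.1, h2.1⟩ ⟨by linarith [h1.2], by linarith [h2.2]⟩ hx
  · simp [rampTest, image_eq_zero_of_notMem_tsupport ht]

theorem tsupport_rampTest_subset {s : Set ℝ} (hχs : tsupport χ ⊆ s) :
    tsupport (rampTest X χ ε a b) ⊆ s ×ˢ univ := by
  have : tsupport (rampTest X χ ε a b) ⊆ tsupport χ ×ˢ univ := by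
    refine closure_minimal (fun p hp => ⟨?_, mem_univ _⟩) ((isClosed_tsupport χ).prod isClosed_univ)
    by_contra ht
    exact hp (by simp [rampTest, image_eq_zero_of_notMem_tsupport ht])
  exact this.trans (prod_mono_left hχs)

/-- The ramps travel with the characteristics, so the transport operator sees only the difference
between the field at `x` and the field on the characteristic, apart from the derivative of `χ`. -/
theorem fderiv_rampTest (hX : IsFlow β T C L X) (hχ : ContDiff ℝ 1 χ) {t : ℝ}
    (ht : t ∈ Icc 0 T) (x : ℝ) :
    fderiv ℝ (rampTest X χ ε a b) (t, x) (1, 0)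
        + fderiv ℝ (rampTest X χ ε a b) (t, x) (0, 1) * β t x =
      deriv χ t * (smoothTransition ((x - X t a) / ε) - smoothTransition ((x - X t b) / ε))
        + χ t * (deriv smoothTransition ((x - X t a) / ε) / ε * (β t x - β t (X t a))
          - deriv smoothTransition ((x - X t b) / ε) / ε * (β t x - β t (X t b))) := by
  have hd : DifferentiableAt ℝ (rampTest X χ ε a b) (t, x) :=
    (contDiff_rampTest hX hχ).differentiable one_ne_zero _
  have h1 : HasDerivAt (fun s => rampTest X χ ε a b (s, x))
      (fderiv ℝ (rampTest X χ ε a b) (t, x) (1, 0)) t :=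
    hd.hasFDerivAt.comp_hasDerivAt (f := fun s => (s, x)) t
      ((hasDerivAt_id' t).prodMk (hasDerivAt_const t x))
  have h2 : HasDerivAt (fun y => rampTest X χ ε a b (t, y))
      (fderiv ℝ (rampTest X χ ε a b) (t, x) (0, 1)) x :=
    hd.hasFDerivAt.comp_hasDerivAt (f := fun y => (t, y)) x
      ((hasDerivAt_const x t).prodMk (hasDerivAt_id' x))
  have g1 : ∀ c, HasDerivAt (fun s => smoothTransition ((x - X s c) / ε))
      (deriv smoothTransition ((x - X t c) / ε) * (-(β t (X t c)) / ε)) t := fun c =>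
    (hasDerivAt_smoothTransition _).comp t (((hX.deriv c t ht).const_sub x).div_const ε)
  have g2 : ∀ c, HasDerivAt (fun y => smoothTransition ((y - X t c) / ε))
      (deriv smoothTransition ((x - X t c) / ε) * (1 / ε)) x := fun c =>
    (hasDerivAt_smoothTransition _).comp x (((hasDerivAt_id x).sub_const _).div_const ε)
  have hχd : HasDerivAt χ (deriv χ t) t := (hχ.differentiable one_ne_zero t).hasDerivAt
  have e1 := h1.unique (hχd.mul ((g1 a).sub (g1 b)))
  have e2 := h2.unique (((g2 a).sub (g2 b)).const_mul (χ t))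
  rw [e1, e2]
  ring

end

theorem indicator_one_nonneg (s : Set ℝ) (x : ℝ) : 0 ≤ s.indicator (1 : ℝ → ℝ) x :=
  indicator_nonneg (fun _ _ => zero_le_one) _

theorem indicator_one_le_of_subset {s t : Set ℝ} (h : s ⊆ t) (x : ℝ) :
    s.indicator (1 : ℝ → ℝ) x ≤ t.indicator 1 x :=
  indicator_le_indicator_of_subset h (fun _ => zero_le_one) x

theorem integral_Icc_indicator_one {α ε : ℝ} (hε : 0 ≤ ε) :
    ∫ x, (Icc α (α + ε)).indicator (1 : ℝ → ℝ) x = ε := by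
  rw [integral_indicator_one measurableSet_Icc, measureReal_def, Real.volume_Icc,
    ENNReal.toReal_ofReal (by linarith)]
  ring

theorem integrable_Icc_indicator_one (α β : ℝ) :
    Integrable ((Icc α β).indicator (1 : ℝ → ℝ)) :=
  (integrable_indicator_iff measurableSet_Icc).2 (integrableOn_const (by simp))

theorem integrable_Ioc_indicator_one (α β : ℝ) :
    Integrable ((Ioc α β).indicator (1 : ℝ → ℝ)) :=
  (integrable_indicator_iff measurableSet_Ioc).2 (integrableOn_const (by simp))

theorem abs_integral_mul_sub_le {u g j : ℝ → ℝ} {M K ε α β : ℝ} (hε : 0 ≤ ε) (hM0 : 0 ≤ M)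
    (hu : AEStronglyMeasurable u volume) (hM : ∀ᵐ x, |u x| ≤ M) (hg : Integrable g)
    (hj : Integrable j) (h : ∀ x, |g x - j x| ≤
      K * ((Icc α (α + ε)).indicator 1 x + (Icc β (β + ε)).indicator 1 x)) :
    |(∫ x, u x * g x) - ∫ x, u x * j x| ≤ M * K * (2 * ε) := by
  rw [← integral_sub (hg.bdd_mul hu hM) (hj.bdd_mul hu hM), ← Real.norm_eq_abs]
  have hi := (integrable_Icc_indicator_one α (α + ε)).add
    (integrable_Icc_indicator_one β (β + ε))
  calc ‖∫ x, (u x * g x - u x * j x)‖ ≤ ∫ x, M * (K * ((Icc α (α + ε)).indicator 1 x +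
        (Icc β (β + ε)).indicator 1 x)) := by
        refine (norm_integral_le_integral_norm _).trans (integral_mono_of_nonneg
          (Filter.Eventually.of_forall fun _ => norm_nonneg _)
          ((hi.const_mul K).const_mul M) ?_)
        filter_upwards [hM] with x hx
        rw [← mul_sub, norm_mul]
        exact mul_le_mul hx (h x) (norm_nonneg _) hM0
    _ = M * K * (2 * ε) := by
        rw [integral_const_mul, integral_const_mul, integral_add
          (integrable_Icc_indicator_one _ _) (integrable_Icc_indicator_one _ _),
          integral_Icc_indicator_one hε, integral_Icc_indicator_one hε]
        ring

theorem abs_ramp_sub_le {ε : ℝ} (hε : 0 < ε) {α β : ℝ} (hαβ : α ≤ β) (x : ℝ) :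
    |smoothTransition ((x - α) / ε) - smoothTransition ((x - β) / ε) - (Ioc α β).indicator 1 x| ≤
      (Icc α (α + ε)).indicator 1 x + (Icc β (β + ε)).indicator 1 x := by
  have h1 := abs_smoothTransition_sub_indicator_le hε α x
  have h2 := abs_smoothTransition_sub_indicator_le hε β x
  have e : (Ioc α β).indicator (1 : ℝ → ℝ) x = (Ioi α).indicator 1 x - (Ioi β).indicator 1 x := by
    by_cases hx : α < x <;> by_cases hx' : β < x
    · rw [indicator_of_notMem (by simp [hx']), indicator_of_mem (mem_Ioi.2 hx),
        indicator_of_mem (mem_Ioi.2 hx')]; simp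
    · rw [indicator_of_mem (show x ∈ Ioc α β from ⟨hx, not_lt.1 hx'⟩),
        indicator_of_mem (mem_Ioi.2 hx), indicator_of_notMem (by simpa using hx')]; simp
    · exact absurd (hαβ.trans_lt hx') hx
    · rw [indicator_of_notMem (by simp [hx]), indicator_of_notMem (by simpa using hx),
        indicator_of_notMem (by simpa using hx')]; simp
  rw [e]
  calc _ = |(smoothTransition ((x - α) / ε) - (Ioi α).indicator 1 x) -
        (smoothTransition ((x - β) / ε) - (Ioi β).indicator 1 x)| := by congr 1; ring
    _ ≤ _ := (abs_sub _ _).trans (add_le_add h1 h2)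

/-- The weak formulation of the linear continuity equation `∂ₜ q + ∂ₓ (b q) = 0`. -/
def IsWeakTransport (b : ℝ → ℝ → ℝ) (q₀ : ℝ → ℝ) {T : ℝ} (q : C(Icc (0 : ℝ) T, L1Loc)) : Prop :=
  ∀ φ : ℝ × ℝ → ℝ, ContDiff ℝ 1 φ → HasCompactSupport φ → tsupport φ ⊆ Ioo (-42) T ×ˢ univ →
    (∫ t, (∫ x : ℝ, q t x * (fderiv ℝ φ ((t : ℝ), x) (1, 0)
      + fderiv ℝ φ ((t : ℝ), x) (0, 1) * b t x)) ∂timeMeasure T)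
      + ∫ x : ℝ, φ (0, x) * q₀ x = 0

instance isFiniteMeasure_timeMeasure (T : ℝ) : IsFiniteMeasure (timeMeasure T) := by
  refine ⟨?_⟩
  rw [timeMeasure, comap_subtype_coe_apply measurableSet_Icc]
  exact (measure_mono (Subtype.coe_image_subset _ _)).trans_lt measure_Icc_lt_top

section transport

variable {β : ℝ → ℝ → ℝ} {T C M Q : ℝ} {L : ℝ≥0} {X : ℝ → ℝ → ℝ} {q₀ : ℝ → ℝ}
  {q : C(Icc (0 : ℝ) T, L1Loc)}

/-- For fixed `x` the indicator is locally constant in time near `s` unless `x` lies on one of the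
two characteristics at time `s`, which happens at two points only. -/
theorem continuous_integral_between (hX : IsFlow β T C L X)
    (hM : ∀ t, ∀ᵐ x : ℝ, |q t x| ≤ M) (a b : ℝ) :
    Continuous fun t : Icc (0 : ℝ) T => ∫ x, q t x * (Ioc (X t a) (X t b)).indicator 1 x := by
  have hC := hX.bound_nonneg
  refine continuous_integral_mul hM (G := (Icc (a - C * T) (b + C * T)).indicator 1)
    (integrable_Icc_indicator_one _ _)
    (fun t => (integrable_Ioc_indicator_one _ _).aestronglyMeasurable) (fun t x => ?_) fun s => ?_
  · have h0 : ∀ c, |X t c - c| ≤ C * T := fun c => by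
      have := hX.abs_sub_time_le c (s := 0) (t := t) ⟨le_rfl, t.2.1.trans t.2.2⟩ t.2
      rw [hX.init, sub_zero, abs_of_nonneg t.2.1] at this
      exact this.trans (mul_le_mul_of_nonneg_left t.2.2 hC)
    rw [abs_of_nonneg (indicator_one_nonneg _ _)]
    refine indicator_one_le_of_subset (fun y hy => ?_) x
    have h1 := abs_le.1 (h0 a)
    have h2 := abs_le.1 (h0 b)
    exact ⟨by linarith [hy.1, h1.1], by linarith [hy.2, h2.2]⟩
  · have hne : ∀ c : ℝ, ∀ᵐ x : ℝ, x ≠ c := fun c => by simp [ae_iff, measure_singleton]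
    filter_upwards [hne (X s a), hne (X s b)] with x ha hb
    have hc : ∀ c, ContinuousAt (fun t : Icc (0 : ℝ) T => X t c) s := fun c =>
      ((hX.continuous_time c).comp continuous_subtype_val).continuousAt
    have key : ∀ c, x ≠ X s c → ∀ᶠ t : Icc (0 : ℝ) T in 𝓝 s, (X t c < x ↔ X s c < x) :=
      fun c hc' => by
        rcases lt_or_gt_of_ne hc' with h | h
        · filter_upwards [(hc c).eventually_const_lt h] with t ht
          exact ⟨fun h' => absurd h' (not_lt.2 ht.le), fun h' => absurd h' (not_lt.2 h.le)⟩
        · filter_upwards [(hc c).eventually_lt_const h] with t ht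
          exact ⟨fun _ => h, fun _ => ht⟩
    refine (continuousAt_const (y := (Ioc (X s a) (X s b)).indicator 1 x)).congr ?_
    filter_upwards [key a ha, key b hb] with t h1 h2
    have h3 : x ∈ Ioc (X t a) (X t b) ↔ x ∈ Ioc (X s a) (X s b) := by
      simp only [mem_Ioc, ← not_lt, h1, h2]
    by_cases hx : x ∈ Ioc (X s a) (X s b)
    · rw [indicator_of_mem hx, indicator_of_mem (h3.2 hx)]
    · rw [indicator_of_notMem hx, indicator_of_notMem (fun h => hx (h3.1 h))]

/-- Test with `rampTest` and let the width `ε` of the ramps tend to `0`. At each time the integrand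
differs from `deriv χ` times the indicator by a bounded function on two strips of width `ε`, so the
total error is `O(ε)`. -/
theorem integral_deriv_mul_add_eq_zero (hX : IsFlow β T C L X)
    (hM : ∀ t, ∀ᵐ x : ℝ, |q t x| ≤ M) (hM0 : 0 ≤ M) (hq₀ : Measurable q₀)
    (hQ : ∀ x, |q₀ x| ≤ Q) (hw : IsWeakTransport β q₀ q) {a b : ℝ} (hab : a ≤ b) {χ : ℝ → ℝ}
    (hχ : ContDiff ℝ 1 χ) (hχc : HasCompactSupport χ) (hχs : tsupport χ ⊆ Ioo (-42) T) :
    (∫ t, deriv χ (t : Icc (0 : ℝ) T) *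
        (∫ x, q t x * (Ioc (X t a) (X t b)).indicator 1 x) ∂timeMeasure T)
      + χ 0 * ∫ x, q₀ x * (Ioc a b).indicator 1 x = 0 := by
  obtain ⟨D, hD0, hD⟩ := exists_abs_deriv_smoothTransition_le
  have hC := hX.bound_nonneg
  have hQ0 : 0 ≤ Q := (abs_nonneg _).trans (hQ 0)
  have hχ'c : Continuous (deriv χ) := (contDiff_one_iff_deriv.1 hχ).2
  obtain ⟨K₁, hK₁⟩ := hχc.deriv.exists_bound_of_continuous hχ'c
  obtain ⟨K₂, hK₂⟩ := hχc.exists_bound_of_continuous hχ.continuous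
  have hK₁0 : 0 ≤ K₁ := (norm_nonneg _).trans (hK₁ 0)
  have hK₂0 : 0 ≤ K₂ := (norm_nonneg _).trans (hK₂ 0)
  set J : Icc (0 : ℝ) T → ℝ := fun t => ∫ x, q t x * (Ioc (X t a) (X t b)).indicator 1 x
  have hJc : Continuous J := continuous_integral_between hX hM a b
  set J₀ := ∫ x, q₀ x * (Ioc a b).indicator 1 x
  set K := M * (K₁ + K₂ * (D * L)) * 2
  have main : ∀ ε > 0, |(∫ t, deriv χ (t : Icc (0 : ℝ) T) * J t ∂timeMeasure T) + χ 0 * J₀| ≤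
      ((timeMeasure T).real univ * K + K₂ * (Q * 2)) * ε := by
    intro ε hε
    set φ := rampTest X χ ε a b
    have hφ : ContDiff ℝ 1 φ := contDiff_rampTest hX hχ
    have hφc : HasCompactSupport φ := hasCompactSupport_rampTest hX hχc hε
    have hφ' : Continuous (fderiv ℝ φ) := hφ.continuous_fderiv one_ne_zero
    have hweak := hw φ hφ hφc (tsupport_rampTest_subset hχs)
    set g : Icc (0 : ℝ) T → ℝ → ℝ := fun t x => fderiv ℝ φ ((t : ℝ), x) (1, 0)
      + fderiv ℝ φ ((t : ℝ), x) (0, 1) * β t x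
    set A := a - C * T
    set B := b + C * T + ε
    have hAB : ∀ t : Icc (0 : ℝ) T, ∀ c ∈ Icc a b, A ≤ X t c ∧ X t c + ε ≤ B := fun t c hc => by
      have := hX.abs_sub_time_le c (s := 0) (t := t) ⟨le_rfl, t.2.1.trans t.2.2⟩ t.2
      rw [hX.init, sub_zero, abs_of_nonneg t.2.1] at this
      have := abs_le.1 (this.trans (mul_le_mul_of_nonneg_left t.2.2 hC))
      exact ⟨by simp only [A]; linarith [hc.1, this.1], by simp only [B]; linarith [hc.2, this.2]⟩
    have hgc : ∀ x, Continuous fun t => g t x := fun x => by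
      have h1 : Continuous fun t : Icc (0 : ℝ) T => fderiv ℝ φ ((t : ℝ), x) :=
        hφ'.comp (continuous_subtype_val.prodMk continuous_const)
      exact (h1.clm_apply continuous_const).add ((h1.clm_apply continuous_const).mul
        ((hX.cont x).comp continuous_subtype_val))
    have hβm : ∀ t, Continuous (β t) := fun t => (hX.lip t).continuous
    have hgm : ∀ t, Continuous (g t) := fun t => by
      have h1 : Continuous fun x : ℝ => fderiv ℝ φ ((t : ℝ), x) :=
        hφ'.comp (continuous_const.prodMk continuous_id)
      exact (h1.clm_apply continuous_const).add ((h1.clm_apply continuous_const).mul (hβm t))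
    have hpt : ∀ t x, |g t x - deriv χ t * (Ioc (X t a) (X t b)).indicator 1 x| ≤
        (K₁ + K₂ * (D * L)) * ((Icc (X t a) (X t a + ε)).indicator 1 x
          + (Icc (X t b) (X t b + ε)).indicator 1 x) := fun t x => by
      have hlip : ∀ c y, |β t y - β t (X t c)| ≤ L * |y - X t c| := fun c y => by
        have := (hX.lip t).dist_le_mul y (X t c)
        rwa [Real.dist_eq, Real.dist_eq] at this
      have h1 := abs_ramp_deriv_mul_le hε L.2 hD0 hD (hlip a) x
      have h2 := abs_ramp_deriv_mul_le hε L.2 hD0 hD (hlip b) x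
      have h3 := abs_ramp_sub_le hε ((hX.strictMono t.2).monotone hab) x
      have e : g t x - deriv χ t * (Ioc (X t a) (X t b)).indicator 1 x = deriv χ t *
          (smoothTransition ((x - X t a) / ε) - smoothTransition ((x - X t b) / ε)
            - (Ioc (X t a) (X t b)).indicator 1 x)
          + χ t * (deriv smoothTransition ((x - X t a) / ε) / ε * (β t x - β t (X t a))
          - deriv smoothTransition ((x - X t b) / ε) / ε * (β t x - β t (X t b))) := by
        simp only [g, φ]
        rw [fderiv_rampTest hX hχ t.2 x]
        ring
      rw [e]
      refine (abs_add_le _ _).trans ?_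
      rw [abs_mul, abs_mul, add_mul]
      refine add_le_add (mul_le_mul (hK₁ _) h3 (abs_nonneg _) hK₁0) ?_
      rw [mul_assoc]
      refine mul_le_mul (hK₂ _) ?_ (abs_nonneg _) hK₂0
      refine (abs_sub _ _).trans ?_
      rw [mul_add]
      exact add_le_add h1 h2
    have hS0 : 0 ≤ K₁ + K₂ * (D * L) := by positivity
    have hgG : ∀ t x, |g t x| ≤ (K₁ + (K₁ + K₂ * (D * L)) * 2) * (Icc A B).indicator 1 x := by
      intro t x
      have h1 := hpt t x
      have ha := hAB t a ⟨le_rfl, hab⟩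
      have hb := hAB t b ⟨hab, le_rfl⟩
      have s1 : Icc (X t a) (X t a + ε) ⊆ Icc A B := Icc_subset_Icc ha.1 ha.2
      have s2 : Icc (X t b) (X t b + ε) ⊆ Icc A B := Icc_subset_Icc hb.1 hb.2
      have s3 : Ioc (X t a) (X t b) ⊆ Icc A B := fun y hy =>
        ⟨ha.1.trans hy.1.le, hy.2.trans (by linarith [hb.2])⟩
      have i1 := indicator_one_le_of_subset s1 x
      have i2 := indicator_one_le_of_subset s2 x
      have i3 := indicator_one_le_of_subset s3 x
      have i4 := mul_le_mul_of_nonneg_left (add_le_add i1 i2) hS0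
      have i5 : |deriv χ t * (Ioc (X t a) (X t b)).indicator 1 x| ≤
          K₁ * (Icc A B).indicator 1 x := by
        rw [abs_mul, abs_of_nonneg (indicator_one_nonneg _ _)]
        exact mul_le_mul (hK₁ _) i3 (indicator_one_nonneg _ _) hK₁0
      have i6 := abs_sub_abs_le_abs_sub (g t x) (deriv χ t * (Ioc (X t a) (X t b)).indicator 1 x)
      linarith
    have hGi : Integrable fun x => (K₁ + (K₁ + K₂ * (D * L)) * 2) * (Icc A B).indicator 1 x :=
      (integrable_Icc_indicator_one A B).const_mul _
    have hgi : ∀ t, Integrable (g t) := fun t =>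
      hGi.mono' (hgm t).aestronglyMeasurable (Filter.Eventually.of_forall (hgG t))
    set I : Icc (0 : ℝ) T → ℝ := fun t => ∫ x, q t x * g t x
    have hIc : Continuous I := continuous_integral_mul hM hGi
      (fun t => (hgm t).aestronglyMeasurable) hgG
      (fun s => Filter.Eventually.of_forall fun x => (hgc x).continuousAt)
    have hIJ : ∀ t, |I t - deriv χ t * J t| ≤ K * ε := fun t => by
      have := abs_integral_mul_sub_le hε.le hM0 (q t).stronglyMeasurable.aestronglyMeasurable
        (hM t) (hgi t) ((integrable_Ioc_indicator_one (X t a) (X t b)).const_mul (deriv χ t))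
        (hpt t)
      have e : ∫ x, q t x * (deriv χ t * (Ioc (X t a) (X t b)).indicator 1 x)
          = deriv χ t * J t := by
        simp only [J]
        rw [← integral_const_mul]
        congr 1
        ext x
        ring
      rw [e] at this
      refine this.trans (le_of_eq ?_)
      simp only [K]
      ring
    have hb0 : |(∫ x, φ (0, x) * q₀ x) - χ 0 * J₀| ≤ K₂ * (Q * 2) * ε := by
      have h1 := abs_integral_mul_sub_le (K := 1) hε.le hQ0 hq₀.aestronglyMeasurable
        (Filter.Eventually.of_forall hQ) (α := a) (β := b)
        (g := fun x => smoothTransition ((x - a) / ε) - smoothTransition ((x - b) / ε))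
        (j := (Ioc a b).indicator 1) ?_ (integrable_Ioc_indicator_one a b)
        (fun x => by rw [one_mul]; exact abs_ramp_sub_le hε hab x)
      · have e : (∫ x, φ (0, x) * q₀ x) - χ 0 * J₀ = χ 0 * ((∫ x, q₀ x *
            (smoothTransition ((x - a) / ε) - smoothTransition ((x - b) / ε))) - J₀) := by
          have e' : ∫ x, φ (0, x) * q₀ x = χ 0 * ∫ x, q₀ x *
              (smoothTransition ((x - a) / ε) - smoothTransition ((x - b) / ε)) := by
            rw [← integral_const_mul]
            congr 1
            ext x
            simp only [φ, rampTest, hX.init]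
            ring
          rw [e', mul_sub]
        rw [e, abs_mul]
        refine (mul_le_mul (hK₂ 0) h1 (abs_nonneg _) hK₂0).trans (le_of_eq ?_)
        ring
      · have hi := ((integrable_Icc_indicator_one a (a + ε)).add
          (integrable_Icc_indicator_one b (b + ε))).add (integrable_Ioc_indicator_one a b)
        have hst := Real.smoothTransition.continuous
        refine hi.mono' (by fun_prop) (Filter.Eventually.of_forall fun x => ?_)
        have h1 := abs_ramp_sub_le hε hab x
        have h2 := abs_sub_abs_le_abs_sub (smoothTransition ((x - a) / ε) -
          smoothTransition ((x - b) / ε)) ((Ioc a b).indicator 1 x)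
        rw [abs_of_nonneg (indicator_one_nonneg (Ioc a b) x)] at h2
        simp only [Pi.add_apply, Real.norm_eq_abs]
        linarith
    have hdχ : Continuous fun t : Icc (0 : ℝ) T => deriv χ t * J t :=
      (hχ'c.comp continuous_subtype_val).mul hJc
    have hint : ∀ {f : Icc (0 : ℝ) T → ℝ}, Continuous f → Integrable f (timeMeasure T) :=
      fun hf => hf.integrable_of_hasCompactSupport (HasCompactSupport.of_compactSpace _)
    have e : (∫ t, deriv χ (t : Icc (0 : ℝ) T) * J t ∂timeMeasure T) + χ 0 * J₀ =
        -((∫ t, (I t - deriv χ t * J t) ∂timeMeasure T) +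
          ((∫ x, φ (0, x) * q₀ x) - χ 0 * J₀)) := by
      rw [integral_sub (hint hIc) (hint hdχ)]
      have : (∫ t, I t ∂timeMeasure T) + ∫ x, φ (0, x) * q₀ x = 0 := hweak
      linarith
    rw [e, abs_neg]
    refine (abs_add_le _ _).trans ?_
    rw [add_mul]
    refine add_le_add ?_ hb0
    have := norm_integral_le_of_norm_le_const (μ := timeMeasure T) (C := K * ε)
      (f := fun t => I t - deriv χ t * J t) (Filter.Eventually.of_forall hIJ)
    rw [Real.norm_eq_abs] at this
    linarith
  by_contra hne
  have hpos := abs_pos.2 hne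
  set R := (timeMeasure T).real univ * K + K₂ * (Q * 2)
  have hR : 0 ≤ R := by positivity
  have h := main (|(∫ t, deriv χ (t : Icc (0 : ℝ) T) * J t ∂timeMeasure T) + χ 0 * J₀| /
    (2 * (R + 1))) (by positivity)
  rw [mul_div_assoc', le_div_iff₀ (by positivity)] at h
  nlinarith

end transport

/-! ### Constancy in time of the mass between two characteristics -/

theorem integral_timeMeasure {T : ℝ} (f : ℝ → ℝ) :
    ∫ t : Icc (0 : ℝ) T, f t ∂timeMeasure T = ∫ t in Icc 0 T, f t :=
  integral_subtype_comap measurableSet_Icc f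

/-- A continuous function on `[0, T]` that is orthogonal to `χ'`, up to the initial value, for all
test functions `χ`, is constant. -/
theorem eq_const_of_integral_deriv_mul {T : ℝ} (hT : 0 < T) {J : Icc (0 : ℝ) T → ℝ}
    (hJ : Continuous J) {J₀ : ℝ}
    (h : ∀ χ : ℝ → ℝ, ContDiff ℝ 1 χ → HasCompactSupport χ → tsupport χ ⊆ Ioo (-42) T →
      (∫ t, deriv χ (t : Icc (0 : ℝ) T) * J t ∂timeMeasure T) + χ 0 * J₀ = 0)
    (t : Icc (0 : ℝ) T) : J t = J₀ := by
  set f : ℝ → ℝ := fun s => J (projIcc 0 T hT.le s) - J₀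
  have hf : Continuous f := (hJ.comp continuous_projIcc).sub continuous_const
  have key : ∀ᵐ s : ℝ, s ∈ Ioo 0 T → f s = 0 := by
    refine isOpen_Ioo.ae_eq_zero_of_integral_contDiff_smul_eq_zero
      (hf.locallyIntegrable.locallyIntegrableOn _) fun g hg hgc hgs => ?_
    have hgcont : Continuous g := hg.continuous
    obtain ⟨c, hc0, hcT, hc⟩ : ∃ c, 0 < c ∧ c < T ∧ ∀ s, c ≤ s → g s = 0 := by
      rcases (tsupport g).eq_empty_or_nonempty with he | hne
      · refine ⟨T / 2, by linarith, by linarith, fun s _ => ?_⟩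
        exact image_eq_zero_of_notMem_tsupport (by simp [he])
      · obtain ⟨m, hm, hmax⟩ := hgc.isCompact.exists_isMaxOn hne continuousOn_id
        have := hgs hm
        refine ⟨(m + T) / 2, by linarith [this.1, this.2], by linarith [this.2], fun s hs => ?_⟩
        refine image_eq_zero_of_notMem_tsupport fun hs' => ?_
        have h1 : s ≤ m := hmax hs'
        linarith [this.2]
    have hneg : ∀ s, s ≤ 0 → g s = 0 := fun s hs =>
      image_eq_zero_of_notMem_tsupport fun h' => absurd (hgs h').1 (not_lt.2 hs)
    set G : ℝ → ℝ := fun s => ∫ r in c..s, g r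
    have hGd : ∀ s, HasDerivAt G (g s) s := fun s =>
      intervalIntegral.integral_hasDerivAt_right (hgcont.intervalIntegrable _ _)
        (hgcont.stronglyMeasurableAtFilter _ _) hgcont.continuousAt
    have hGc : ContDiff ℝ 1 G := by
      rw [contDiff_one_iff_deriv]
      refine ⟨fun s => (hGd s).differentiableAt, ?_⟩
      rw [show deriv G = g from funext fun s => (hGd s).deriv]
      exact hgcont
    have hG0 : ∀ s, c ≤ s → G s = 0 := fun s hs => by
      simp only [G]
      rw [intervalIntegral.integral_congr (g := fun _ => 0), intervalIntegral.integral_zero]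
      intro r hr
      rw [uIcc_of_le hs] at hr
      exact hc r hr.1
    -- `G` is the primitive of `g` that vanishes to the right of `c`, a point beyond the support of
    -- `g` and before `T`. The cutoff is `1` on `[-1, ∞)` and `0` on `(-∞, -2]`, so the support
    -- stays inside `(-42, T)` while `χ' = g` on `[0, T]` and `χ 0 = -∫ g`.
    set χ : ℝ → ℝ := fun s => smoothTransition (s + 2) * G s
    have hst : ContDiff ℝ 1 fun s : ℝ => smoothTransition (s + 2) :=
      Real.smoothTransition.contDiff.comp (contDiff_id.add contDiff_const)
    have hχ : ContDiff ℝ 1 χ := hst.mul hGc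
    have hsupp : tsupport χ ⊆ Icc (-2) c := by
      refine closure_minimal (fun s hs => ?_) isClosed_Icc
      by_contra hs'
      rw [mem_Icc, not_and_or, not_le, not_le] at hs'
      refine hs ?_
      rcases hs' with h1 | h1
      · simp only [χ]
        rw [Real.smoothTransition.zero_of_nonpos (by linarith), zero_mul]
      · simp only [χ]
        rw [hG0 s h1.le, mul_zero]
    have h1 := h χ hχ (HasCompactSupport.intro' isCompact_Icc isClosed_Icc fun s hs =>
      image_eq_zero_of_notMem_tsupport fun h' => hs (hsupp h'))
      (hsupp.trans fun s hs => ⟨by linarith [hs.1], by linarith [hs.2]⟩)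
    have hd : ∀ s, 0 ≤ s → deriv χ s = g s := fun s hs => by
      have : χ =ᶠ[𝓝 s] G := by
        filter_upwards [eventually_gt_nhds (show -1 < s by linarith)] with r hr
        simp only [χ]
        rw [Real.smoothTransition.one_of_one_le (by linarith), one_mul]
      rw [this.deriv_eq, (hGd s).deriv]
    have e1 : ∫ t, deriv χ (t : Icc (0 : ℝ) T) * J t ∂timeMeasure T =
        ∫ s in Icc 0 T, g s * J (projIcc 0 T hT.le s) := by
      rw [← integral_timeMeasure]
      congr 1
      ext s
      rw [hd s s.2.1, projIcc_val]
    have e2 : χ 0 = - ∫ s in Icc 0 T, g s := by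
      have : ∫ s in Icc 0 T, g s = ∫ s in (0 : ℝ)..c, g s := by
        rw [integral_Icc_eq_integral_Ioc, ← intervalIntegral.integral_of_le hT.le,
          ← intervalIntegral.integral_add_adjacent_intervals
          (hgcont.intervalIntegrable 0 c) (hgcont.intervalIntegrable c T)]
        rw [show ∫ s in c..T, g s = 0 from hG0 T hcT.le, add_zero]
      rw [this, ← intervalIntegral.integral_symm]
      simp only [χ, G]
      rw [Real.smoothTransition.one_of_one_le (by norm_num), one_mul]
    have e3 : ∫ s, g s • f s = ∫ s in Icc 0 T, g s • f s := by
      refine (setIntegral_eq_integral_of_forall_compl_eq_zero fun s hs => ?_).symm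
      rw [mem_Icc, not_and_or, not_le, not_le] at hs
      rcases hs with h' | h'
      · rw [hneg s h'.le, zero_smul]
      · rw [hc s (by linarith), zero_smul]
    have i1 : IntegrableOn (fun s => g s * J (projIcc 0 T hT.le s)) (Icc 0 T) :=
      (hgcont.mul (hJ.comp continuous_projIcc)).continuousOn.integrableOn_Icc
    have i2 : IntegrableOn (fun s => g s * J₀) (Icc 0 T) :=
      (hgcont.mul continuous_const).continuousOn.integrableOn_Icc
    rw [e3]
    simp only [f, smul_eq_mul, mul_sub]
    rw [integral_sub i1 i2, integral_mul_const]
    rw [e1, e2] at h1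
    linarith
  have hzero : ∀ s ∈ Ioo 0 T, f s = 0 := by
    have h2 : ∀ᵐ s ∂volume.restrict (Ioo 0 T), f s = 0 := (ae_restrict_iff' measurableSet_Ioo).2 key
    have := Measure.eqOn_open_of_ae_eq (f := f) (g := fun _ => 0) h2 isOpen_Ioo hf.continuousOn
      continuousOn_const
    exact this
  have hzero' : ∀ s ∈ Icc 0 T, f s = 0 := by
    have : EqOn f (fun _ => 0) (closure (Ioo 0 T)) :=
      EqOn.closure (fun s hs => hzero s hs) hf continuous_const
    rwa [closure_Ioo hT.ne] at this
  have := hzero' t t.2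
  simp only [f, projIcc_val] at this
  linarith

section

variable {β : ℝ → ℝ → ℝ} {T C M Q : ℝ} {L : ℝ≥0} {X : ℝ → ℝ → ℝ} {q₀ : ℝ → ℝ}
  {q : C(Icc (0 : ℝ) T, L1Loc)}

theorem setIntegral_Ioc_flow (hT : 0 < T) (hX : IsFlow β T C L X)
    (hM : ∀ t, ∀ᵐ x : ℝ, |q t x| ≤ M) (hM0 : 0 ≤ M) (hq₀ : Measurable q₀)
    (hQ : ∀ x, |q₀ x| ≤ Q) (hw : IsWeakTransport β q₀ q) {a b : ℝ} (hab : a ≤ b)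
    (t : Icc (0 : ℝ) T) :
    ∫ x in Ioc (X t a) (X t b), q t x = ∫ x in Ioc a b, q₀ x := by
  have := eq_const_of_integral_deriv_mul hT (continuous_integral_between hX hM a b)
    (J₀ := ∫ x, q₀ x * (Ioc a b).indicator 1 x)
    (fun χ h1 h2 h3 => integral_deriv_mul_add_eq_zero hX hM hM0 hq₀ hQ hw hab h1 h2 h3) t
  simpa only [← indicator_mul_right, Pi.one_apply, mul_one,
    integral_indicator measurableSet_Ioc] using this

end

/-! ### Transport of the measure `|q| dx` by the flow -/

/-- Two Hahn decompositions of the same signed measure have the same total variation. -/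
theorem add_eq_add_of_mutuallySingular {μ₁ μ₂ ν₁ ν₂ : Measure ℝ} (h : μ₁ + ν₂ = ν₁ + μ₂)
    {A B : Set ℝ} (hA : MeasurableSet A) (hB : MeasurableSet B) (hμ₁ : μ₁ Aᶜ = 0) (hμ₂ : μ₂ A = 0)
    (hν₁ : ν₁ Bᶜ = 0) (hν₂ : ν₂ B = 0) : μ₁ + μ₂ = ν₁ + ν₂ := by
  have hS : ∀ S, μ₁ S + ν₂ S = ν₁ S + μ₂ S := fun S => by
    rw [← Measure.add_apply, h, Measure.add_apply]
  have z1 : ∀ S, S ⊆ Aᶜ → μ₁ S = 0 := fun S h => measure_mono_null h hμ₁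
  have z2 : ∀ S, S ⊆ A → μ₂ S = 0 := fun S h => measure_mono_null h hμ₂
  have z3 : ∀ S, S ⊆ Bᶜ → ν₁ S = 0 := fun S h => measure_mono_null h hν₁
  have z4 : ∀ S, S ⊆ B → ν₂ S = 0 := fun S h => measure_mono_null h hν₂
  have hloc : ∀ S, (μ₁ + μ₂) ((S ∩ A) ∩ B) = (ν₁ + ν₂) ((S ∩ A) ∩ B) ∧
      (μ₁ + μ₂) ((S ∩ A) \ B) = (ν₁ + ν₂) ((S ∩ A) \ B) ∧
      (μ₁ + μ₂) ((S \ A) ∩ B) = (ν₁ + ν₂) ((S \ A) ∩ B) ∧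
      (μ₁ + μ₂) ((S \ A) \ B) = (ν₁ + ν₂) ((S \ A) \ B) := by
    intro S
    simp only [Measure.add_apply]
    refine ⟨?_, ?_, ?_, ?_⟩
    · have := hS ((S ∩ A) ∩ B)
      rw [z4 _ inter_subset_right, z2 _ (inter_subset_left.trans inter_subset_right)] at this
      rw [z4 _ inter_subset_right, z2 _ (inter_subset_left.trans inter_subset_right), this]
    · have := hS ((S ∩ A) \ B)
      rw [z3 _ (fun x hx => hx.2), z2 _ (sdiff_subset.trans inter_subset_right)] at this
      rw [z3 _ (fun x hx => hx.2), z2 _ (sdiff_subset.trans inter_subset_right)]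
      simp only [add_zero, zero_add, add_eq_zero] at this ⊢
      rw [this.1, this.2]
    · have := hS ((S \ A) ∩ B)
      rw [z4 _ inter_subset_right, z1 _ (inter_subset_left.trans fun x hx => hx.2)] at this
      rw [z4 _ inter_subset_right, z1 _ (inter_subset_left.trans fun x hx => hx.2)]
      simp only [add_zero, zero_add] at this ⊢
      have := add_eq_zero.1 this.symm
      rw [this.1, this.2]
    · have := hS ((S \ A) \ B)
      rw [z3 _ (fun x hx => hx.2), z1 _ (sdiff_subset.trans fun x hx => hx.2)] at this
      rw [z3 _ (fun x hx => hx.2), z1 _ (sdiff_subset.trans fun x hx => hx.2)]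
      simp only [zero_add] at this ⊢
      rw [this]
  ext S hS'
  obtain ⟨h1, h2, h3, h4⟩ := hloc S
  rw [← measure_inter_add_sdiff S hA, ← measure_inter_add_sdiff (S ∩ A) hB,
    ← measure_inter_add_sdiff (S \ A) hB, h1, h2, h3, h4, measure_inter_add_sdiff (S \ A) hB,
    measure_inter_add_sdiff (S ∩ A) hB, measure_inter_add_sdiff S hA]

/-- The measure `|f| dx`. -/
def absMeasure (f : ℝ → ℝ) : Measure ℝ := volume.withDensity fun x => ENNReal.ofReal |f x|

theorem absMeasure_eq_add {f : ℝ → ℝ} (hf : Measurable f) :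
    absMeasure f = volume.withDensity (fun x => ENNReal.ofReal (f x)) +
      volume.withDensity fun x => ENNReal.ofReal (-f x) := by
  rw [absMeasure, ← withDensity_add_left hf.ennreal_ofReal]
  congr 1
  ext x
  rcases le_total 0 (f x) with h | h
  · simp [abs_of_nonneg h, ENNReal.ofReal_of_nonpos (neg_nonpos.2 h)]
  · simp [abs_of_nonpos h, ENNReal.ofReal_of_nonpos h]

theorem integral_absMeasure {f : ℝ → ℝ} (hf : Measurable f) (g : ℝ → ℝ) :
    ∫ x, g x ∂absMeasure f = ∫ x, g x * |f x| := by
  rw [absMeasure, integral_withDensity_eq_integral_toReal_smul hf.abs.ennreal_ofReal (by simp)]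
  congr 1
  ext x
  rw [ENNReal.toReal_ofReal (abs_nonneg _), smul_eq_mul, mul_comm]

theorem withDensity_ofReal_null {f : ℝ → ℝ} {s : Set ℝ} (hs : MeasurableSet s)
    (h : ∀ x ∈ s, f x ≤ 0) : volume.withDensity (fun x => ENNReal.ofReal (f x)) s = 0 := by
  rw [withDensity_apply _ hs, setLIntegral_congr_fun hs
    (fun x hx => ENNReal.ofReal_of_nonpos (h x hx)), lintegral_zero]

theorem withDensity_ofReal_Ioc_ne_top {f : ℝ → ℝ} {M : ℝ} (hM : ∀ᵐ x, |f x| ≤ M) (a b : ℝ) :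
    volume.withDensity (fun x => ENNReal.ofReal (f x)) (Ioc a b) ≠ ∞ := by
  rw [withDensity_apply _ measurableSet_Ioc]
  refine (lt_of_le_of_lt (lintegral_mono_ae (g := fun _ => ENNReal.ofReal M)
    (ae_restrict_of_ae (hM.mono fun x hx => ENNReal.ofReal_le_ofReal ((le_abs_self _).trans hx))))
    ?_).ne
  rw [setLIntegral_const, Real.volume_Ioc]
  exact ENNReal.mul_lt_top ENNReal.ofReal_lt_top ENNReal.ofReal_lt_top

theorem setIntegral_Ioc_eq_withDensity {f : ℝ → ℝ} (hf : Measurable f) {M : ℝ}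
    (hM : ∀ᵐ x, |f x| ≤ M) (a b : ℝ) : ∫ x in Ioc a b, f x =
      (volume.withDensity (fun x => ENNReal.ofReal (f x)) (Ioc a b)).toReal -
      (volume.withDensity (fun x => ENNReal.ofReal (-f x)) (Ioc a b)).toReal := by
  rw [withDensity_apply _ measurableSet_Ioc, withDensity_apply _ measurableSet_Ioc]
  refine integral_eq_lintegral_pos_part_sub_lintegral_neg_part ?_
  exact IntegrableOn.of_bound (by simp) hf.aestronglyMeasurable M (ae_restrict_of_ae hM)

/-- The Lagrangian description of the measure `|q(t)| dx`. -/
theorem map_flow_absMeasure {β : ℝ → ℝ → ℝ} {T C M Q : ℝ} {L : ℝ≥0} {X : ℝ → ℝ → ℝ} {q₀ : ℝ → ℝ}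
    {q : C(Icc (0 : ℝ) T, L1Loc)} (hT : 0 < T) (hX : IsFlow β T C L X)
    (hM : ∀ t, ∀ᵐ x : ℝ, |q t x| ≤ M) (hM0 : 0 ≤ M) (hq₀ : Measurable q₀)
    (hQ : ∀ x, |q₀ x| ≤ Q) (hw : IsWeakTransport β q₀ q) (t : Icc (0 : ℝ) T) :
    (absMeasure q₀).map (X t) = absMeasure (q t) := by
  have hmono := hX.strictMono t.2
  have hsurj := hX.surjective t.2
  have hXm : Measurable (X t) := hmono.monotone.measurable
  have hemb : MeasurableEmbedding (X t) :=
    ((hmono.orderIsoOfSurjective _ hsurj).toHomeomorph).measurableEmbedding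
  have hqm : Measurable (q t) := (q t).stronglyMeasurable.measurable
  have hpre : ∀ a b, X t ⁻¹' Ioc (X t a) (X t b) = Ioc a b := fun a b => by
    ext y
    simp only [mem_preimage, mem_Ioc, hmono.lt_iff_lt, hmono.le_iff_le]
  have hQ' : ∀ᵐ x, |q₀ x| ≤ Q := Filter.Eventually.of_forall hQ
  have hQn : ∀ᵐ x, |-q₀ x| ≤ Q := Filter.Eventually.of_forall fun x => by rw [abs_neg]; exact hQ x
  have hMn : ∀ᵐ x, |-q t x| ≤ M := (hM t).mono fun x hx => by rwa [abs_neg]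
  rw [absMeasure_eq_add hq₀, absMeasure_eq_add hqm, Measure.map_add _ _ hXm]
  -- Conservation between characteristics identifies the signed measures `q(t) dx` and the image of
  -- `q₀ dx` on half-open intervals. As `X t` is injective, the images of the positive and negative
  -- parts of `q₀` remain mutually singular, so they also form a Hahn decomposition of `q(t) dx`.
  refine add_eq_add_of_mutuallySingular (A := X t '' {x | 0 ≤ q₀ x}) (B := {x | 0 ≤ q t x})
    ?_ (hemb.measurableSet_image.2 (measurableSet_le measurable_const hq₀))
    (measurableSet_le measurable_const hqm) ?_ ?_ ?_ ?_
  · refine Measure.ext_of_Ioc' _ _ (fun α β _ => ?_) fun α β hαβ => ?_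
    all_goals obtain ⟨a, rfl⟩ := hsurj α
    all_goals obtain ⟨b, rfl⟩ := hsurj β
    all_goals simp only [Measure.add_apply, Measure.map_apply hXm measurableSet_Ioc, hpre]
    · exact ENNReal.add_ne_top.2 ⟨withDensity_ofReal_Ioc_ne_top hQ' _ _,
        withDensity_ofReal_Ioc_ne_top hMn _ _⟩
    · have h := setIntegral_Ioc_flow hT hX hM hM0 hq₀ hQ hw (hmono.lt_iff_lt.1 hαβ).le t
      rw [setIntegral_Ioc_eq_withDensity hqm (hM t), setIntegral_Ioc_eq_withDensity hq₀ hQ'] at h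
      have f1 := withDensity_ofReal_Ioc_ne_top hQ' a b
      have f2 := withDensity_ofReal_Ioc_ne_top hQn a b
      have f3 := withDensity_ofReal_Ioc_ne_top (hM t) (X t a) (X t b)
      have f4 := withDensity_ofReal_Ioc_ne_top hMn (X t a) (X t b)
      rw [← ENNReal.toReal_eq_toReal_iff' (ENNReal.add_ne_top.2 ⟨f1, f4⟩)
        (ENNReal.add_ne_top.2 ⟨f3, f2⟩), ENNReal.toReal_add f1 f4, ENNReal.toReal_add f3 f2]
      linarith
  · rw [hemb.map_apply, preimage_compl, hmono.injective.preimage_image]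
    refine withDensity_ofReal_null (measurableSet_le measurable_const hq₀).compl fun x hx => ?_
    exact (not_le.1 (show ¬0 ≤ q₀ x from hx)).le
  · rw [hemb.map_apply, hmono.injective.preimage_image]
    exact withDensity_ofReal_null (measurableSet_le measurable_const hq₀)
      fun x hx => neg_nonpos.2 hx
  · refine withDensity_ofReal_null (measurableSet_le measurable_const hqm).compl fun x hx => ?_
    exact (not_le.1 (show ¬0 ≤ q t x from hx)).le
  · exact withDensity_ofReal_null (measurableSet_le measurable_const hqm)
      fun x hx => neg_nonpos.2 hx

theorem conv_abs_eq_integral_flow {β : ℝ → ℝ → ℝ} {T C M Q : ℝ} {L : ℝ≥0} {X : ℝ → ℝ → ℝ}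
    {q₀ : ℝ → ℝ} {q : C(Icc (0 : ℝ) T, L1Loc)} (hT : 0 < T) (hX : IsFlow β T C L X)
    (hM : ∀ t, ∀ᵐ x : ℝ, |q t x| ≤ M) (hM0 : 0 ≤ M) (hq₀ : Measurable q₀)
    (hQ : ∀ x, |q₀ x| ≤ Q) (hw : IsWeakTransport β q₀ q) (t : Icc (0 : ℝ) T) {k : ℝ → ℝ}
    (hk : Measurable k) (x : ℝ) :
    conv k (fun y => |q t y|) x = ∫ y, k (X t y - x) ∂absMeasure q₀ := by
  have hXm : Measurable (X t) := (hX.strictMono t.2).monotone.measurable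
  rw [conv, ← integral_absMeasure (q t).stronglyMeasurable.measurable (fun y => k (y - x)),
    ← map_flow_absMeasure hT hX hM hM0 hq₀ hQ hw t]
  exact integral_map hXm.aemeasurable (hk.comp (measurable_id.sub_const x)).aestronglyMeasurable

/-! ### An implicit Euler comparison principle -/

/-- With `N + 1` equal time steps the quadratic errors add up to `|C| t² / (N + 1)`, which tends to
`0`. -/
theorem nonpos_of_forall_le_max_add {h : ℝ → ℝ} {T C : ℝ} (h0 : h 0 ≤ 0)
    (hstep : ∀ s t, 0 ≤ s → s ≤ t → t ≤ T → h t ≤ max (h s) 0 + C * (t - s) ^ 2)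
    {t : ℝ} (ht : t ∈ Icc 0 T) : h t ≤ 0 := by
  have hC : 0 ≤ |C| := abs_nonneg C
  have key : ∀ N : ℕ, h t ≤ |C| * t ^ 2 / (N + 1) := fun N => by
    have hN : (0 : ℝ) < N + 1 := by positivity
    have hδ : 0 ≤ t / (N + 1) := div_nonneg ht.1 hN.le
    have hind : ∀ i : ℕ, i ≤ N + 1 → h (i * (t / (N + 1))) ≤ i * (|C| * (t / (N + 1)) ^ 2) := by
      intro i
      induction i with
      | zero => intro _; simpa using h0
      | succ i ih =>
        intro hi
        have h1 := ih (by omega)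
        have hi' : ((i : ℝ) + 1) ≤ N + 1 := by exact_mod_cast hi
        have h2 := hstep (i * (t / (N + 1))) ((i + 1 : ℕ) * (t / (N + 1))) (by positivity)
          (by push_cast; nlinarith) (by
            push_cast
            calc ((i : ℝ) + 1) * (t / (N + 1)) ≤ (N + 1) * (t / (N + 1)) :=
                  mul_le_mul_of_nonneg_right hi' hδ
              _ = t := by field_simp
              _ ≤ T := ht.2)
        have h3 : max (h (i * (t / (N + 1)))) 0 ≤ i * (|C| * (t / (N + 1)) ^ 2) :=
          max_le h1 (by positivity)
        have h4 : ((i + 1 : ℕ) : ℝ) * (t / (N + 1)) - i * (t / (N + 1)) = t / (N + 1) := by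
          push_cast; ring
        rw [h4] at h2
        have h5 : C * (t / (N + 1)) ^ 2 ≤ |C| * (t / (N + 1)) ^ 2 :=
          mul_le_mul_of_nonneg_right (le_abs_self C) (sq_nonneg _)
        push_cast at h2 ⊢
        linarith
    have := hind (N + 1) le_rfl
    push_cast at this
    have e : ((N : ℝ) + 1) * (t / (N + 1)) = t := by field_simp
    rw [e] at this
    refine this.trans (le_of_eq ?_)
    field_simp
  have hlim : Filter.Tendsto (fun N : ℕ => |C| * t ^ 2 / ((N : ℝ) + 1)) Filter.atTop (𝓝 0) := by
    have := (tendsto_one_div_add_atTop_nhds_zero_nat (𝕜 := ℝ)).const_mul (|C| * t ^ 2)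
    simpa only [mul_zero, mul_one_div] using this
  exact ge_of_tendsto' hlim key

theorem sub_sq_le_one_sub_exp_neg {u : ℝ} (hu : 0 ≤ u) : u - u ^ 2 ≤ 1 - Real.exp (-u) := by
  have h1 := Real.add_one_le_exp u
  have h2 : Real.exp (-u) * Real.exp u = 1 := by rw [← Real.exp_add]; simp
  have h3 : Real.exp (-u) * (1 + u) ≤ 1 := by
    nlinarith [Real.exp_pos (-u)]
  have h5 : Real.exp (-u) ≤ 1 - u + u ^ 2 := by
    by_contra hc
    rw [not_le] at hc
    have : (1 - u + u ^ 2) * (1 + u) < 1 := by nlinarith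
    nlinarith [pow_nonneg hu 3]
  linarith

/-- The function `V₀ exp(l(μ-1)t) + (E/4) exp(4lμt)` is a supersolution of `g' = l(μ b - g)`, where
`b` is the bound assumed inside the increment: the first exponential solves the equation exactly,
and the rate `4lμ` of the second leaves room for the factor `1/4`. This gain is what makes iteration
possible, even when `E` is doubled beforehand. Having `f t` rather than `f s` on the right
corresponds to an implicit Euler step. -/
theorem le_exp_add_exp_of_increment_le {f : ℝ → ℝ} {T l μ V₀ E C : ℝ} (hl : 0 ≤ l) (hμ : 1 ≤ μ)
    (hV₀ : 0 ≤ V₀) (hE : 0 ≤ E) (hC : 0 ≤ C) (h0 : f 0 ≤ V₀)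
    (hstep : ∀ s t, 0 ≤ s → s ≤ t → t ≤ T → f t - f s ≤ l * (t - s) *
      (μ * (V₀ * Real.exp (l * (μ - 1) * t) + E * Real.exp (4 * l * μ * t)) - f t)
        + C * (t - s) ^ 2) {t : ℝ} (ht : t ∈ Icc 0 T) :
    f t ≤ V₀ * Real.exp (l * (μ - 1) * t) + E / 4 * Real.exp (4 * l * μ * t) := by
  set c := l * (μ - 1)
  set K := 4 * l * μ
  have hc : 0 ≤ c := mul_nonneg hl (by linarith)
  have hK : 0 ≤ K := by positivity
  set g : ℝ → ℝ := fun t => V₀ * Real.exp (c * t) + E / 4 * Real.exp (K * t)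
  set C₂ := V₀ * Real.exp (c * T) * c ^ 2 + E / 4 * Real.exp (K * T) * K ^ 2
  suffices hs : f t - g t ≤ 0 by simp only [g] at hs; linarith
  refine nonpos_of_forall_le_max_add (h := fun t => f t - g t) (C := C + C₂) (T := T) ?_ ?_ ht
  · simp only [g, mul_zero, Real.exp_zero]
    linarith
  · intro s t hs hst htT
    have h1 := hstep s t hs hst htT
    have hτ : 0 ≤ t - s := by linarith
    have hexp : ∀ a, 0 ≤ a → Real.exp (a * t) * (a * (t - s)) -
        Real.exp (a * T) * a ^ 2 * (t - s) ^ 2 ≤ Real.exp (a * t) - Real.exp (a * s) := fun a ha => by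
      have e1 := sub_sq_le_one_sub_exp_neg (mul_nonneg ha hτ)
      have e2 : Real.exp (a * s) = Real.exp (a * t) * Real.exp (-(a * (t - s))) := by
        rw [← Real.exp_add]; congr 1; ring
      have e3 : Real.exp (a * t) ≤ Real.exp (a * T) :=
        Real.exp_le_exp.2 (mul_le_mul_of_nonneg_left htT ha)
      have e4 := mul_le_mul_of_nonneg_left e1 (Real.exp_pos (a * t)).le
      have e5 := mul_le_mul_of_nonneg_right e3 (sq_nonneg (a * (t - s)))
      rw [e2]
      nlinarith
    have g1 := mul_le_mul_of_nonneg_left (hexp c hc) hV₀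
    have g2 := mul_le_mul_of_nonneg_left (hexp K hK) (show 0 ≤ E / 4 by linarith)
    have g3 : l * (t - s) * (μ * (V₀ * Real.exp (c * t) + E * Real.exp (K * t)) - g t) ≤
        V₀ * (Real.exp (c * t) * (c * (t - s))) +
        E / 4 * (Real.exp (K * t) * (K * (t - s))) := by
      have : V₀ * (Real.exp (c * t) * (c * (t - s))) +
          E / 4 * (Real.exp (K * t) * (K * (t - s))) -
          l * (t - s) * (μ * (V₀ * Real.exp (c * t) + E * Real.exp (K * t)) - g t) =
          l * (t - s) * (E / 4) * Real.exp (K * t) := by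
        simp only [g, c, K]; ring
      have h0 : 0 ≤ l * (t - s) * (E / 4) * Real.exp (K * t) := by positivity
      linarith
    have h2 : (f t - g t) * (1 + l * (t - s)) ≤ (f s - g s) + (C + C₂) * (t - s) ^ 2 := by
      have : g t - g s = V₀ * (Real.exp (c * t) - Real.exp (c * s)) +
        E / 4 * (Real.exp (K * t) - Real.exp (K * s)) := by simp only [g]; ring
      simp only [C₂]
      nlinarith
    -- The implicit step puts a factor `1 + l(t - s) ≥ 1` on the left, which may be dropped when `f
    -- t - g t` is positive; otherwise there is nothing to prove.
    rcases le_or_gt (f t - g t) 0 with hneg | hpos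
    · have hC₂ : 0 ≤ C + C₂ := by positivity
      exact hneg.trans (add_nonneg (le_max_right _ _) (mul_nonneg hC₂ (sq_nonneg _)))
    · have : (f t - g t) * 1 ≤ (f t - g t) * (1 + l * (t - s)) :=
        mul_le_mul_of_nonneg_left (by have := mul_nonneg hl hτ; linarith) hpos.le
      have := le_max_left (f s - g s) 0
      linarith

/-! ### Secant slopes -/

/-- The slope of the secant of `k` through `a` and `b`; it is `0` for `a = b`. -/
def secant (k : ℝ → ℝ) (a b : ℝ) : ℝ := (k b - k a) / (b - a)

theorem secant_mul (k : ℝ → ℝ) (a b : ℝ) : secant k a b * (b - a) = k b - k a := by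
  rcases eq_or_ne b a with rfl | h
  · simp
  · exact div_mul_cancel₀ _ (sub_ne_zero.2 h)

theorem secant_self (k : ℝ → ℝ) (a : ℝ) : secant k a a = 0 := by simp [secant]

theorem secant_comm (k : ℝ → ℝ) (a b : ℝ) : secant k a b = secant k b a := by
  rw [secant, secant, ← neg_sub (k b), ← neg_sub b, neg_div_neg_eq]

theorem secant_nonneg {k : ℝ → ℝ} {s : Set ℝ} (hk : MonotoneOn k s) {a b : ℝ} (ha : a ∈ s)
    (hb : b ∈ s) : 0 ≤ secant k a b := by
  rcases le_total a b with h | h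
  · exact div_nonneg (sub_nonneg.2 (hk ha hb h)) (sub_nonneg.2 h)
  · rw [secant_comm]
    exact div_nonneg (sub_nonneg.2 (hk hb ha h)) (sub_nonneg.2 h)

/-- Move one endpoint at a time. The intermediate pair `(a, b')` could be degenerate; then one
passes through `(b, a')` instead, and if that is degenerate too, the two secants coincide. -/
theorem secant_le_secant {k : ℝ → ℝ} {s : Set ℝ} (hk : ConvexOn ℝ s k) {a b a' b' : ℝ}
    (ha : a ∈ s) (hb : b ∈ s) (ha' : a' ∈ s) (hb' : b' ∈ s) (haa : a ≤ a') (hbb : b ≤ b')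
    (hab : a ≠ b) (hab' : a' ≠ b') : secant k a b ≤ secant k a' b' := by
  have key : ∀ {a b a' b' : ℝ}, a ∈ s → b ∈ s → a' ∈ s → b' ∈ s → a ≤ a' → b ≤ b' → a ≠ b →
      a' ≠ b' → a ≠ b' → secant k a b ≤ secant k a' b' := by
    intro a b a' b' ha hb ha' hb' haa hbb hab hab' h
    refine (hk.secant_mono ha hb hb' hab.symm h.symm hbb).trans ?_
    change secant k a b' ≤ _
    rw [secant_comm, secant_comm k a']
    exact hk.secant_mono hb' ha ha' h hab' haa
  rcases ne_or_eq a b' with h | h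
  · exact key ha hb ha' hb' haa hbb hab hab' h
  · rcases ne_or_eq b a' with h' | h'
    · rw [secant_comm, secant_comm k a']
      exact key hb ha hb' ha' hbb haa hab.symm hab'.symm h'
    · rw [h, h', secant_comm]

/-! ### Potentials in Lagrangian coordinates -/

/-- The potential `∫ k(X(t,y) - X(t,x)) dm(y)`. -/
def potential (m : Measure ℝ) (X : ℝ → ℝ → ℝ) (k : ℝ → ℝ) (t x : ℝ) : ℝ :=
  ∫ y, k (X t y - X t x) ∂m

/-- The secant slopes of `k` between the times `s` and `t`, seen from the particle `x`. -/
def secantWeight (X : ℝ → ℝ → ℝ) (k : ℝ → ℝ) (s t x : ℝ) : ℝ → ℝ :=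
  (Iio x).indicator fun y => secant k (X s y - X s x) (X t y - X t x)

/-- Particles `X` that move on `[0, T]` with the velocities `v`, bounded by `C`, together with a
kernel `k`, supported in `(-∞, 0)` and monotone there, with potential bounded by `S` and secant
slopes of mass at most `κ`. -/
structure IsParticleSystem (m : Measure ℝ) (X v : ℝ → ℝ → ℝ) (k : ℝ → ℝ) (T C κ S : ℝ) :
    Prop where
  strictMono : ∀ t ∈ Icc 0 T, StrictMono (X t)
  cont : ∀ x, Continuous fun t => v t x
  bound : ∀ t ∈ Icc 0 T, ∀ x, |v t x| ≤ C
  sub_eq : ∀ x, ∀ s ∈ Icc 0 T, ∀ t ∈ Icc 0 T, X t x - X s x = ∫ r in s..t, v r x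
  zero : ∀ s, 0 ≤ s → k s = 0
  mono : MonotoneOn k (Iio 0)
  integrable : ∀ t ∈ Icc 0 T, ∀ x, Integrable (fun y => k (X t y - X t x)) m
  integrable_secant : ∀ s ∈ Icc 0 T, ∀ t ∈ Icc 0 T, ∀ x, Integrable (secantWeight X k s t x) m
  integral_secant_le : ∀ s ∈ Icc 0 T, ∀ t ∈ Icc 0 T, ∀ x, ∫ y, secantWeight X k s t x y ∂m ≤ κ
  potential_le : ∀ t ∈ Icc 0 T, ∀ x, |potential m X k t x| ≤ S

namespace IsParticleSystem

variable {m : Measure ℝ} {X v : ℝ → ℝ → ℝ} {k : ℝ → ℝ} {T C κ S : ℝ}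

theorem sub_neg (h : IsParticleSystem m X v k T C κ S) {t : ℝ} (ht : t ∈ Icc 0 T) {x y : ℝ}
    (hy : y < x) : X t y - X t x < 0 := _root_.sub_neg.2 (h.strictMono t ht hy)

theorem secantWeight_nonneg (h : IsParticleSystem m X v k T C κ S) {s t : ℝ} (hs : s ∈ Icc 0 T)
    (ht : t ∈ Icc 0 T) (x y : ℝ) : 0 ≤ secantWeight X k s t x y := by
  refine indicator_nonneg (fun y hy => ?_) y
  exact secant_nonneg h.mono (h.sub_neg hs hy) (h.sub_neg ht hy)

theorem mass_nonneg (h : IsParticleSystem m X v k T C κ S) (hT : 0 ≤ T) : 0 ≤ κ :=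
  (integral_nonneg (h.secantWeight_nonneg ⟨le_rfl, hT⟩ ⟨le_rfl, hT⟩ 0)).trans
    (h.integral_secant_le _ ⟨le_rfl, hT⟩ _ ⟨le_rfl, hT⟩ 0)

theorem speed_nonneg (h : IsParticleSystem m X v k T C κ S) (hT : 0 ≤ T) : 0 ≤ C :=
  (abs_nonneg _).trans (h.bound 0 ⟨le_rfl, hT⟩ 0)

/-- Particles keep their order, so those with `y ≥ x` never enter. For the others the increment of
`k` is its secant slope times the relative displacement; no derivative of `k` is needed, and the
value `0` of a degenerate secant is harmless because the displacement factor vanishes there. -/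
theorem kernel_sub (h : IsParticleSystem m X v k T C κ S) {s t : ℝ} (hs : s ∈ Icc 0 T)
    (ht : t ∈ Icc 0 T) (x y : ℝ) : k (X t y - X t x) - k (X s y - X s x) =
      secantWeight X k s t x y * ((X t y - X s y) - (X t x - X s x)) := by
  rcases lt_or_ge y x with hy | hy
  · rw [secantWeight, indicator_of_mem (mem_Iio.2 hy), ← secant_mul]
    ring
  · rw [secantWeight, indicator_of_notMem (by simpa using hy), zero_mul,
      h.zero _ (sub_nonneg.2 ((h.strictMono t ht).monotone hy)),
      h.zero _ (sub_nonneg.2 ((h.strictMono s hs).monotone hy)), sub_zero]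

theorem potential_sub (h : IsParticleSystem m X v k T C κ S) {s t : ℝ} (hs : s ∈ Icc 0 T)
    (ht : t ∈ Icc 0 T) (x : ℝ) : potential m X k t x - potential m X k s x =
      ∫ y, secantWeight X k s t x y * ((X t y - X s y) - (X t x - X s x)) ∂m := by
  rw [potential, potential, ← integral_sub (h.integrable t ht x) (h.integrable s hs x)]
  exact integral_congr_ae (.of_forall (h.kernel_sub hs ht x))

theorem displacement_le (h : IsParticleSystem m X v k T C κ S) {s t : ℝ} (hs : s ∈ Icc 0 T)
    (ht : t ∈ Icc 0 T) (x : ℝ) : |X t x - X s x| ≤ C * |t - s| := by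
  rw [h.sub_eq x s hs t ht, ← Real.norm_eq_abs]
  refine intervalIntegral.norm_integral_le_of_norm_le_const fun r hr => ?_
  have hr' : r ∈ uIcc s t := uIoc_subset_uIcc hr
  exact h.bound r ((ordConnected_Icc.uIcc_subset hs ht) hr') x

theorem displacement_sub_le (h : IsParticleSystem m X v k T C κ S) {s t : ℝ} (hs : s ∈ Icc 0 T)
    (ht : t ∈ Icc 0 T) (x y : ℝ) :
    |(X t y - X s y) - (X t x - X s x)| ≤ 2 * C * |t - s| := by
  have h1 := h.displacement_le hs ht x
  have h2 := h.displacement_le hs ht y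
  have h3 := abs_sub (X t y - X s y) (X t x - X s x)
  linarith

theorem integrable_secant_mul (h : IsParticleSystem m X v k T C κ S) {s t : ℝ} (hs : s ∈ Icc 0 T)
    (ht : t ∈ Icc 0 T) (x : ℝ) :
    Integrable (fun y => secantWeight X k s t x y * ((X t y - X s y) - (X t x - X s x))) m :=
  ((h.integrable t ht x).sub (h.integrable s hs x)).congr
    (.of_forall (h.kernel_sub hs ht x))

/-- A crude Lipschitz bound in time. Its constant depends on the solution, but it enters only terms
of second order in the time step, or the length of a continuation step. -/
theorem abs_potential_sub_le (h : IsParticleSystem m X v k T C κ S) {s t : ℝ} (hs : s ∈ Icc 0 T)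
    (ht : t ∈ Icc 0 T) (x : ℝ) :
    |potential m X k t x - potential m X k s x| ≤ 2 * κ * C * |t - s| := by
  have hC := h.speed_nonneg (hs.1.trans hs.2)
  rw [h.potential_sub hs ht, ← Real.norm_eq_abs]
  calc _ ≤ ∫ y, secantWeight X k s t x y * (2 * C * |t - s|) ∂m := by
        refine (norm_integral_le_integral_norm _).trans (integral_mono_of_nonneg
          (.of_forall fun _ => norm_nonneg _) ((h.integrable_secant s hs t ht x).mul_const _)
          (.of_forall fun y => ?_))
        simp only [norm_mul]
        rw [Real.norm_of_nonneg (h.secantWeight_nonneg hs ht x y)]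
        exact mul_le_mul_of_nonneg_left (h.displacement_sub_le hs ht x y)
          (h.secantWeight_nonneg hs ht x y)
    _ ≤ κ * (2 * C * |t - s|) := by
        rw [integral_mul_const]
        exact mul_le_mul_of_nonneg_right (h.integral_secant_le s hs t ht x) (by positivity)
    _ = _ := by ring

/-- The displacements are controlled by the velocities. -/
theorem displacement_sub_eq (h : IsParticleSystem m X v k T C κ S) {s t : ℝ} (hs : s ∈ Icc 0 T)
    (ht : t ∈ Icc 0 T) (x y : ℝ) :
    (X t y - X s y) - (X t x - X s x) = ∫ r in s..t, (v r y - v r x) := by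
  rw [h.sub_eq y s hs t ht, h.sub_eq x s hs t ht, intervalIntegral.integral_sub
    ((h.cont y).intervalIntegrable _ _) ((h.cont x).intervalIntegrable _ _)]

/-- The maximum principle: a velocity that is increasing in a quantity close to the potential does
not let the potential grow. -/
theorem potential_le_exp (h : IsParticleSystem m X v k T C κ S) {w : ℝ → ℝ → ℝ} {L θ Q : ℝ}
    (hL : 0 ≤ L) (hθ : 0 ≤ θ) (hQ : 0 ≤ Q)
    (hv : ∀ r ∈ Icc 0 T, ∀ x y, w r x ≤ w r y →
      0 ≤ v r y - v r x ∧ v r y - v r x ≤ L * (w r y - w r x))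
    (hw : ∀ r ∈ Icc 0 T, ∀ B, (∀ x, potential m X k r x ≤ B) →
      ∀ x, |w r x - potential m X k r x| ≤ θ * B)
    (h0 : ∀ x, potential m X k 0 x ≤ Q) {t : ℝ} (ht : t ∈ Icc 0 T) (x : ℝ) :
    potential m X k t x ≤ Q * Real.exp (κ * L * (2 * θ) * t) := by
  have hT : 0 ≤ T := ht.1.trans ht.2
  have hκ := h.mass_nonneg hT
  have hC := h.speed_nonneg hT
  have hS : 0 ≤ S := (abs_nonneg _).trans (h.potential_le t ht x)
  set l := κ * L
  have hl : 0 ≤ l := mul_nonneg hκ hL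
  set μ := 1 + 2 * θ
  have hμ1 : μ - 1 = 2 * θ := by simp only [μ]; ring
  -- One pass improves an a priori bound from `E` to `E / 4`. Starting from `E = S` and iterating
  -- removes the second exponential.
  have step : ∀ E, 0 ≤ E → (∀ t ∈ Icc 0 T, ∀ x, potential m X k t x ≤
      Q * Real.exp (l * (μ - 1) * t) + E * Real.exp (4 * l * μ * t)) → ∀ t ∈ Icc 0 T, ∀ x,
      potential m X k t x ≤
      Q * Real.exp (l * (μ - 1) * t) + E / 4 * Real.exp (4 * l * μ * t) := by
    intro E hE hB t ht x
    refine le_exp_add_exp_of_increment_le (f := fun t => potential m X k t x)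
      (C := l * (2 * κ * C)) (T := T) hl (by simp only [μ]; linarith) hQ hE (by positivity)
      (h0 x) ?_ ht
    intro s t hs0 hst htT
    have hs : s ∈ Icc 0 T := ⟨hs0, hst.trans htT⟩
    have ht : t ∈ Icc 0 T := ⟨hs0.trans hst, htT⟩
    set B := Q * Real.exp (l * (μ - 1) * t) + E * Real.exp (4 * l * μ * t)
    have hBr : ∀ r ∈ Icc s t, ∀ x, potential m X k r x ≤ B := fun r hr x => by
      refine (hB r ⟨hs0.trans hr.1, hr.2.trans htT⟩ x).trans ?_
      have hμ0 : 0 ≤ μ - 1 := by rw [hμ1]; linarith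
      have hμ0' : 0 ≤ μ := by linarith
      have := hr.2
      simp only [B]
      gcongr
    have hτ : 0 ≤ t - s := sub_nonneg.2 hst
    -- `B` bounds the potential on `[s, t]`. The velocity of any `y` exceeds that of `x` by at most
    -- `L` times the excess of `w` at `y` over `w` at `x`; replacing `w` by the potential at both
    -- particles costs `2θB`, and replacing time `r` by time `t` at `x` costs `2κC(t - s)`. The
    -- latter produces the implicit form.
    set P := L * (t - s) * (μ * B - potential m X k t x + 2 * κ * C * (t - s))
    have hdisp : ∀ y, (X t y - X s y) - (X t x - X s x) ≤ P := fun y => by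
      rw [h.displacement_sub_eq hs ht]
      have hpt : ∀ r ∈ Icc s t, v r y - v r x ≤
          L * (μ * B - potential m X k t x + 2 * κ * C * (t - s)) := fun r hr => by
        have hr' : r ∈ Icc 0 T := ⟨hs0.trans hr.1, hr.2.trans htT⟩
        have d1 := abs_le.1 (hw r hr' B (hBr r hr) x)
        have d2 := abs_le.1 (hw r hr' B (hBr r hr) y)
        have d3 := abs_le.1 (h.abs_potential_sub_le hr' ht x)
        rw [abs_of_nonneg (sub_nonneg.2 hr.2)] at d3
        have d4 : 2 * κ * C * (t - r) ≤ 2 * κ * C * (t - s) :=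
          mul_le_mul_of_nonneg_left (by linarith [hr.1]) (by positivity)
        have d5 := hBr r hr y
        have d6 := hBr r hr x
        have d7 : 0 ≤ μ * B - potential m X k t x + 2 * κ * C * (t - s) := by
          have : μ * B = B + 2 * θ * B := by simp only [μ]; ring
          linarith [d1.1, d1.2, d3.2]
        rcases le_total (w r x) (w r y) with hxy | hxy
        · refine (hv r hr' x y hxy).2.trans (mul_le_mul_of_nonneg_left ?_ hL)
          have : μ * B = B + 2 * θ * B := by simp only [μ]; ring
          linarith [d1.1, d2.2, d3.2]
        · have := (hv r hr' y x hxy).1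
          have := mul_nonneg hL d7
          linarith
      calc _ ≤ ∫ r in s..t, L * (μ * B - potential m X k t x + 2 * κ * C * (t - s)) :=
            intervalIntegral.integral_mono_on hst
              (((h.cont y).sub (h.cont x)).intervalIntegrable _ _) (by simp) hpt
        _ = P := by rw [intervalIntegral.integral_const, smul_eq_mul]; simp only [P]; ring
    have hP : 0 ≤ P := by
      have := hdisp x
      simpa using this
    rw [h.potential_sub hs ht]
    calc _ ≤ ∫ y, secantWeight X k s t x y * P ∂m :=
          integral_mono (h.integrable_secant_mul hs ht x)
            ((h.integrable_secant s hs t ht x).mul_const _) fun y =>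
            mul_le_mul_of_nonneg_left (hdisp y) (h.secantWeight_nonneg hs ht x y)
      _ ≤ κ * P := by
          rw [integral_mul_const]
          exact mul_le_mul_of_nonneg_right (h.integral_secant_le s hs t ht x) hP
      _ = _ := by simp only [P, l]; ring
  have iter : ∀ n : ℕ, ∀ t ∈ Icc 0 T, ∀ x, potential m X k t x ≤
      Q * Real.exp (l * (μ - 1) * t) + S / 4 ^ n * Real.exp (4 * l * μ * t) := by
    intro n
    induction n with
    | zero =>
      intro t ht x
      have h1 := (le_abs_self _).trans (h.potential_le t ht x)
      have h2 : 0 ≤ Q * Real.exp (l * (μ - 1) * t) := by positivity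
      have h3 : 1 ≤ Real.exp (4 * l * μ * t) := Real.one_le_exp (by
        have := ht.1; have : 0 ≤ μ := by simp only [μ]; linarith
        positivity)
      have h4 := mul_le_mul_of_nonneg_left h3 hS
      simp only [pow_zero, div_one]
      linarith
    | succ n ih =>
      have := step _ (by positivity) ih
      simpa only [pow_succ, div_div] using this
  have hlim : Filter.Tendsto (fun n : ℕ => Q * Real.exp (l * (μ - 1) * t) +
      S / 4 ^ n * Real.exp (4 * l * μ * t)) Filter.atTop
      (𝓝 (Q * Real.exp (l * (μ - 1) * t) + 0 * Real.exp (4 * l * μ * t))) := by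
    refine tendsto_const_nhds.add (Filter.Tendsto.mul_const _ ?_)
    have := (tendsto_pow_atTop_nhds_zero_of_lt_one (show (0 : ℝ) ≤ 1 / 4 by norm_num)
      (by norm_num)).const_mul S
    simpa only [mul_zero, div_pow, one_pow, mul_one_div] using this
  have := ge_of_tendsto' hlim fun n => iter n t ht x
  rwa [zero_mul, add_zero, hμ1] at this

end IsParticleSystem

/-! ### The variation of the potential -/

/-- The sequence `ζ 0, x 0, ζ 1, x 1, …`. -/
def interleave (ζ x : ℕ → ℝ) (n : ℕ) : ℝ := if Even n then ζ (n / 2) else x (n / 2)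

theorem interleave_two_mul (ζ x : ℕ → ℝ) (i : ℕ) : interleave ζ x (2 * i) = ζ i := by
  rw [interleave, if_pos (even_two_mul i), Nat.mul_div_cancel_left i two_pos]

theorem interleave_two_mul_add_one (ζ x : ℕ → ℝ) (i : ℕ) :
    interleave ζ x (2 * i + 1) = x i := by
  rw [interleave, if_neg (by simp)]
  congr 1
  omega

theorem monotone_interleave {ζ x : ℕ → ℝ} (h1 : ∀ i, ζ i ≤ x i) (h2 : ∀ i, x i ≤ ζ (i + 1)) :
    Monotone (interleave ζ x) := by
  refine monotone_nat_of_le_succ fun n => ?_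
  obtain ⟨i, rfl | rfl⟩ : ∃ i, n = 2 * i ∨ n = 2 * i + 1 := ⟨n / 2, by omega⟩
  · rw [interleave_two_mul, interleave_two_mul_add_one]
    exact h1 i
  · rw [interleave_two_mul_add_one, show 2 * i + 1 + 1 = 2 * (i + 1) by ring, interleave_two_mul]
    exact h2 i

theorem varSum_interleave (f : ℝ → ℝ) (ζ x : ℕ → ℝ) (n : ℕ) :
    varSum f (interleave ζ x) (2 * n + 1) = ∑ i ∈ Finset.range (n + 1), |f (x i) - f (ζ i)| +
      ∑ i ∈ Finset.range n, |f (ζ (i + 1)) - f (x i)| := by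
  induction n with
  | zero =>
    have := interleave_two_mul ζ x 0
    have h1 := interleave_two_mul_add_one ζ x 0
    simp only [mul_zero, zero_add] at this h1
    simp [varSum, this, h1]
  | succ n ih =>
    rw [Finset.sum_range_succ (fun i => |f (x i) - f (ζ i)|) (n + 1),
      Finset.sum_range_succ (fun i => |f (ζ (i + 1)) - f (x i)|) n]
    rw [varSum, show 2 * (n + 1) + 1 = 2 * n + 1 + 1 + 1 by ring, Finset.sum_range_succ,
      Finset.sum_range_succ, ← varSum, ih, show 2 * n + 1 + 1 + 1 = 2 * (n + 1) + 1 by ring,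
      interleave_two_mul_add_one, show 2 * n + 1 + 1 = 2 * (n + 1) by ring, interleave_two_mul,
      interleave_two_mul_add_one]
    ring

/-- The points can be chosen independently for each index, so the sum of the suprema is approached
by admissible choices, each within `ε / (N + 1)` of its supremum. -/
theorem sum_sSup_le {A : ℕ → Set ℝ} {F : ℕ → ℝ → ℝ} {N : ℕ} {E : ℝ}
    (hA : ∀ i, (A i).Nonempty)
    (h : ∀ ζ : ℕ → ℝ, (∀ i, ζ i ∈ A i) → ∑ i ∈ Finset.range N, F i (ζ i) ≤ E) :
    ∑ i ∈ Finset.range N, sSup (F i '' A i) ≤ E := by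
  refine le_of_forall_pos_le_add fun ε hε => ?_
  have hex : ∀ i, ∃ z ∈ A i, sSup (F i '' A i) - ε / (N + 1) < F i z := fun i => by
    obtain ⟨_, ⟨z, hz, rfl⟩, hlt⟩ := exists_lt_of_lt_csSup ((hA i).image (F i))
      (show sSup (F i '' A i) - ε / (N + 1) < sSup (F i '' A i) by
        have : 0 < ε / ((N : ℝ) + 1) := by positivity
        linarith)
    exact ⟨z, hz, hlt⟩
  choose ζ hζ hlt using hex
  calc _ ≤ ∑ i ∈ Finset.range N, (F i (ζ i) + ε / (N + 1)) :=
        Finset.sum_le_sum fun i _ => by linarith [hlt i]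
    _ = ∑ i ∈ Finset.range N, F i (ζ i) + N * (ε / (N + 1)) := by
        rw [Finset.sum_add_distrib, Finset.sum_const, Finset.card_range, nsmul_eq_mul]
    _ ≤ E + ε := by
        refine add_le_add (h ζ hζ) ?_
        rw [mul_div_assoc', div_le_iff₀ (by positivity)]
        nlinarith

/-- Summation by parts against signs. -/
theorem sum_sign_mul_sub_le {n : ℕ} {σ K D S : ℕ → ℝ} (hσ : ∀ i, |σ i| ≤ 1) (hK : ∀ i, 0 ≤ K i)
    (h0 : K 0 * |D 0| ≤ K 0 * S 0)
    (h : ∀ i, (K (i + 1) = 0 ∧ K i = 0) ∨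
      (K i = 0 ∧ |D (i + 1)| + σ i * D (i + 1) ≤ S (i + 1)) ∨
      ((D i = 0 ∨ K (i + 1) ≤ K i) ∧
        |D i - D (i + 1)| - σ i * (D i - D (i + 1)) ≤ S (i + 1))) :
    ∑ i ∈ Finset.range n, σ i * (K (i + 1) * D (i + 1) - K i * D i) ≤
      ∑ i ∈ Finset.range (n + 1), K i * S i := by
  have step : ∀ i, σ i * (K (i + 1) * D (i + 1) - K i * D i) ≤
      K i * |D i| - K (i + 1) * |D (i + 1)| + K (i + 1) * S (i + 1) := fun i => by
    rcases h i with ⟨h1, h2⟩ | ⟨h1, h2⟩ | ⟨h1, h2⟩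
    · simp [h1, h2]
    · have := mul_le_mul_of_nonneg_left h2 (hK (i + 1))
      rw [h1]
      nlinarith
    · have e1 := mul_le_mul_of_nonneg_left h2 (hK (i + 1))
      have e2 : σ i * (K (i + 1) - K i) * D i ≤ (K i - K (i + 1)) * |D i| := by
        rcases h1 with h1 | h1
        · simp [h1]
        · have a1 : -(σ i * D i) ≤ |D i| := by
            refine (neg_le_abs _).trans ?_
            rw [abs_mul]
            exact mul_le_of_le_one_left (abs_nonneg _) (hσ i)
          have := mul_le_mul_of_nonneg_left a1 (sub_nonneg.2 h1)
          linarith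
      have e3 : |D (i + 1)| ≤ |D i| + |D i - D (i + 1)| := by
        have := abs_sub (D i) (D i - D (i + 1))
        rwa [sub_sub_cancel] at this
      have e4 := mul_le_mul_of_nonneg_left e3 (hK (i + 1))
      nlinarith
  calc _ ≤ ∑ i ∈ Finset.range n,
        (K i * |D i| - K (i + 1) * |D (i + 1)| + K (i + 1) * S (i + 1)) :=
        Finset.sum_le_sum fun i _ => step i
    _ = K 0 * |D 0| - K n * |D n| + ∑ i ∈ Finset.range n, K (i + 1) * S (i + 1) := by
        rw [Finset.sum_add_distrib, Finset.sum_range_sub' (fun i => K i * |D i|)]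
    _ ≤ K 0 * S 0 + ∑ i ∈ Finset.range n, K (i + 1) * S (i + 1) := by
        have := mul_nonneg (hK n) (abs_nonneg (D n))
        linarith
    _ = _ := by rw [Finset.sum_range_succ' _ n, add_comm]

/-- `a` and `b` have the same sign and `|a| ≤ L |b|`, while `z ↦ |z| - σ z` is linear with a
nonnegative factor `1 ∓ σ` of `|z|` on each half-line. -/
theorem abs_sub_sign_mul_le {L σ a b : ℝ} (hσ : |σ| ≤ 1) (h1 : 0 ≤ b → 0 ≤ a ∧ a ≤ L * b)
    (h2 : b ≤ 0 → a ≤ 0 ∧ L * b ≤ a) : |a| - σ * a ≤ L * (|b| - σ * b) := by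
  have hσ' := abs_le.1 hσ
  rcases le_total 0 b with hb | hb
  · obtain ⟨h3, h4⟩ := h1 hb
    rw [abs_of_nonneg h3, abs_of_nonneg hb]
    nlinarith [hσ'.2]
  · obtain ⟨h3, h4⟩ := h2 hb
    rw [abs_of_nonpos h3, abs_of_nonpos hb]
    nlinarith [hσ'.1]

namespace IsParticleSystem

variable {m : Measure ℝ} {X v : ℝ → ℝ → ℝ} {k : ℝ → ℝ} {T C κ S : ℝ}

/-- Moving `x` to the right moves both arguments of the kernel to the left, where a convex function
has smaller slopes. The condition `hne` excludes the degenerate secant at `x`, which is `0` by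
convention. -/
theorem secantWeight_anti (h : IsParticleSystem m X v k T C κ S) (hk : ConvexOn ℝ (Iio 0) k)
    {s t : ℝ} (hs : s ∈ Icc 0 T) (ht : t ∈ Icc 0 T) {x x' y : ℝ} (hy : y < x) (hx : x ≤ x')
    (hne : (X t y - X s y) - (X t x - X s x) ≠ 0) :
    secantWeight X k s t x' y ≤ secantWeight X k s t x y := by
  have hy' : y < x' := hy.trans_le hx
  simp only [secantWeight]
  rw [indicator_of_mem (mem_Iio.2 hy), indicator_of_mem (mem_Iio.2 hy')]
  rcases eq_or_ne (X s y - X s x') (X t y - X t x') with he | he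
  · rw [he, secant_self]
    exact secant_nonneg h.mono (h.sub_neg hs hy) (h.sub_neg ht hy)
  · refine secant_le_secant hk (h.sub_neg hs hy') (h.sub_neg ht hy') (h.sub_neg hs hy)
      (h.sub_neg ht hy) (sub_le_sub_left ((h.strictMono s hs).monotone hx) _)
      (sub_le_sub_left ((h.strictMono t ht).monotone hx) _) he fun h' => hne ?_
    linarith

/-- The increments in time of the variation along a partition, with respect to signs `σ`. -/
theorem sum_sign_mul_potential_sub_le (h : IsParticleSystem m X v k T C κ S)
    (hk : ConvexOn ℝ (Iio 0) k) {s t : ℝ} (hs : s ∈ Icc 0 T) (ht : t ∈ Icc 0 T) {x : ℕ → ℝ}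
    (hx : Monotone x) (n : ℕ) {σ : ℕ → ℝ} (hσ : ∀ i, |σ i| ≤ 1) (hσ0 : σ 0 = 0) {E : ℝ}
    (hE : ∀ ζ : ℕ → ℝ, (∀ i, ζ i ≤ x i) → (∀ i, x i ≤ ζ (i + 1)) →
      ∑ i ∈ Finset.range (n + 1), (|(X t (x i) - X s (x i)) - (X t (ζ i) - X s (ζ i))| -
        σ i * ((X t (x i) - X s (x i)) - (X t (ζ i) - X s (ζ i)))) ≤ E) :
    ∑ i ∈ Finset.range n, σ (i + 1) * ((potential m X k t (x (i + 1)) - potential m X k t (x i)) -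
      (potential m X k s (x (i + 1)) - potential m X k s (x i))) ≤ κ * E := by
  set Y : ℝ → ℝ := fun z => X t z - X s z with hY
  -- The admissible positions of `ζ i` form the interval from `x (i - 1)` to `x i`, and the whole
  -- half-line below `x 0` for `i = 0`.
  set A : ℕ → Set ℝ := fun i => {z | z ≤ x i ∧ ∀ j, j + 1 = i → x j ≤ z} with hA
  set F : ℕ → ℝ → ℝ := fun i z => |Y (x i) - Y z| - σ i * (Y (x i) - Y z) with hF
  have hAne : ∀ i, (A i).Nonempty := fun i => ⟨x i, le_rfl, fun j hj => hx (by omega)⟩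
  have hF0 : ∀ i z, 0 ≤ F i z := fun i z => by
    have : σ i * (Y (x i) - Y z) ≤ |Y (x i) - Y z| := by
      refine (le_abs_self _).trans ?_
      rw [abs_mul]
      exact mul_le_of_le_one_left (abs_nonneg _) (hσ i)
    simp only [F]
    linarith
  have hbdd : ∀ i, BddAbove (F i '' A i) := fun i => by
    refine ⟨2 * (2 * C * |t - s|), ?_⟩
    rintro _ ⟨z, _, rfl⟩
    have h1 : |Y (x i) - Y z| ≤ 2 * C * |t - s| := h.displacement_sub_le hs ht z (x i)
    have h2 : -(σ i * (Y (x i) - Y z)) ≤ |Y (x i) - Y z| := by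
      refine (neg_le_abs _).trans ?_
      rw [abs_mul]
      exact mul_le_of_le_one_left (abs_nonneg _) (hσ i)
    simp only [F]
    linarith
  -- Taking suprema makes the bound independent of `y`, so that it leaves the integral over `y` and
  -- only the mass of each weight remains.
  set M : ℕ → ℝ := fun i => sSup (F i '' A i) with hM
  have hFM : ∀ i, ∀ z ∈ A i, F i z ≤ M i := fun i z hz => le_csSup (hbdd i) ⟨z, hz, rfl⟩
  have hM0 : ∀ i, 0 ≤ M i := fun i =>
    (hF0 i _).trans (hFM i _ (hAne i).choose_spec)
  have hME : ∑ i ∈ Finset.range (n + 1), M i ≤ E :=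
    sum_sSup_le hAne fun ζ hζ => hE ζ (fun i => (hζ i).1) fun i => (hζ (i + 1)).2 i rfl
  set K : ℕ → ℝ → ℝ := fun i => secantWeight X k s t (x i) with hKdef
  have hK0 : ∀ i y, 0 ≤ K i y := fun i y => h.secantWeight_nonneg hs ht _ _
  have hKz : ∀ i y, x i ≤ y → K i y = 0 := fun i y hy =>
    indicator_of_notMem (by simpa using hy) _
  -- For a fixed source `y` there are three kinds of cells. To the left of `y` both weights vanish;
  -- in the cell containing `y` only the right weight survives and `ζ = y` is used; to the right of
  -- `y` the weights decrease and `ζ = x i` is used.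
  have hpt : ∀ y, ∑ i ∈ Finset.range n, σ (i + 1) *
      (K (i + 1) y * (Y y - Y (x (i + 1))) - K i y * (Y y - Y (x i))) ≤
      ∑ i ∈ Finset.range (n + 1), K i y * M i := fun y => by
    refine sum_sign_mul_sub_le (σ := fun i => σ (i + 1)) (K := fun i => K i y)
      (D := fun i => Y y - Y (x i)) (fun i => hσ _) (fun i => hK0 i y) ?_ fun i => ?_
    · rcases lt_or_ge y (x 0) with hy | hy
      · refine mul_le_mul_of_nonneg_left ?_ (hK0 0 y)
        have := hFM 0 y ⟨hy.le, fun j hj => by omega⟩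
        simp only [F, hσ0, zero_mul, sub_zero] at this
        rwa [abs_sub_comm]
      · rw [hKz 0 y hy, zero_mul, zero_mul]
    · rcases lt_or_ge y (x i) with hy | hy
      · refine Or.inr (Or.inr ⟨?_, ?_⟩)
        · by_cases hD : Y y - Y (x i) = 0
          · exact Or.inl hD
          · exact Or.inr (h.secantWeight_anti hk hs ht hy (hx (by omega)) hD)
        · have := hFM (i + 1) (x i) ⟨hx (by omega), fun j hj => by
            obtain rfl : j = i := by omega
            exact le_rfl⟩
          simp only [F] at this
          simpa only [sub_sub_sub_cancel_left] using this
      · rcases lt_or_ge y (x (i + 1)) with hy' | hy'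
        · refine Or.inr (Or.inl ⟨hKz i y hy, ?_⟩)
          have := hFM (i + 1) y ⟨hy'.le, fun j hj => by
            obtain rfl : j = i := by omega
            exact hy⟩
          simp only [F] at this
          rw [abs_sub_comm] at this
          linarith
        · exact Or.inl ⟨hKz _ y hy', hKz _ y hy⟩
  have hint : ∀ i, Integrable (fun y => K i y * (Y y - Y (x i))) m := fun i =>
    h.integrable_secant_mul hs ht (x i)
  have hpot : ∀ i, potential m X k t (x i) - potential m X k s (x i) =
      ∫ y, K i y * (Y y - Y (x i)) ∂m := fun i => h.potential_sub hs ht (x i)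
  calc _ = ∑ i ∈ Finset.range n, ∫ y, σ (i + 1) *
        (K (i + 1) y * (Y y - Y (x (i + 1))) - K i y * (Y y - Y (x i))) ∂m := by
        refine Finset.sum_congr rfl fun i _ => ?_
        rw [integral_const_mul, integral_sub (hint _) (hint _), ← hpot, ← hpot]
        ring
    _ = ∫ y, ∑ i ∈ Finset.range n, σ (i + 1) *
        (K (i + 1) y * (Y y - Y (x (i + 1))) - K i y * (Y y - Y (x i))) ∂m :=
        (integral_finsetSum _ fun i _ => ((hint _).sub (hint _)).const_mul _).symm
    _ ≤ ∫ y, ∑ i ∈ Finset.range (n + 1), K i y * M i ∂m :=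
        integral_mono (integrable_finsetSum _ fun i _ => ((hint _).sub (hint _)).const_mul _)
          (integrable_finsetSum _ fun i _ => (h.integrable_secant s hs t ht _).mul_const _) hpt
    _ = ∑ i ∈ Finset.range (n + 1), (∫ y, K i y ∂m) * M i := by
        rw [integral_finsetSum _ fun i _ => (h.integrable_secant s hs t ht _).mul_const _]
        exact Finset.sum_congr rfl fun i _ => integral_mul_const _ _
    _ ≤ ∑ i ∈ Finset.range (n + 1), κ * M i := Finset.sum_le_sum fun i _ =>
        mul_le_mul_of_nonneg_right (h.integral_secant_le s hs t ht _) (hM0 i)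
    _ ≤ κ * E := by
        rw [← Finset.mul_sum]
        exact mul_le_mul_of_nonneg_left hME (h.mass_nonneg (hs.1.trans hs.2))

/-- A velocity that is increasing in a quantity close to the potential does not increase the
variation of the potential. -/
theorem varLe_potential (h : IsParticleSystem m X v k T C κ S) (hk : ConvexOn ℝ (Iio 0) k)
    {w : ℝ → ℝ → ℝ} {L θ V₀ : ℝ} (hL : 0 ≤ L) (hθ : 0 ≤ θ)
    (hv : ∀ r ∈ Icc 0 T, ∀ x y, w r x ≤ w r y →
      0 ≤ v r y - v r x ∧ v r y - v r x ≤ L * (w r y - w r x))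
    (hw : ∀ r ∈ Icc 0 T, ∀ N B, (∀ x, Monotone x → varSum (potential m X k r) x N ≤ B) →
      ∀ x, Monotone x → varSum (fun z => w r z - potential m X k r z) x N ≤ θ * B)
    (h0 : VarLe (potential m X k 0) V₀) {t : ℝ} (ht : t ∈ Icc 0 T) :
    VarLe (potential m X k t) (V₀ * Real.exp (κ * L * (2 * θ) * t)) := by
  have hT : 0 ≤ T := ht.1.trans ht.2
  have hκ := h.mass_nonneg hT
  have hC := h.speed_nonneg hT
  have hS : 0 ≤ S := (abs_nonneg _).trans (h.potential_le t ht 0)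
  have hV₀ := h0.nonneg
  set U := potential m X k
  set l := κ * L
  have hl : 0 ≤ l := mul_nonneg hκ hL
  set μ := 1 + 2 * θ
  have hμ1 : μ - 1 = 2 * θ := by simp only [μ]; ring
  have hμ0 : 0 ≤ μ - 1 := by rw [hμ1]; linarith
  have hμ0' : 0 ≤ μ := by linarith
  -- The bound for `n` increments relies on the one for `2n + 1` increments, hence the factor `n +
  -- 1`: it doubles `E`, the comparison lemma then divides by `4`, and `E / 2` remains.
  have step : ∀ E, 0 ≤ E → (∀ t ∈ Icc 0 T, ∀ x, Monotone x → ∀ n : ℕ, varSum (U t) x n ≤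
      V₀ * Real.exp (l * (μ - 1) * t) + (n + 1) * E * Real.exp (4 * l * μ * t)) →
      ∀ t ∈ Icc 0 T, ∀ x, Monotone x → ∀ n : ℕ, varSum (U t) x n ≤
      V₀ * Real.exp (l * (μ - 1) * t) + (n + 1) * (E / 2) * Real.exp (4 * l * μ * t) := by
    intro E hE hB t ht x hx n
    have hgoal : V₀ * Real.exp (l * (μ - 1) * t) + (n + 1) * (E / 2) * Real.exp (4 * l * μ * t) =
        V₀ * Real.exp (l * (μ - 1) * t) +
          2 * (n + 1) * E / 4 * Real.exp (4 * l * μ * t) := by ring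
    rw [hgoal]
    refine le_exp_add_exp_of_increment_le (f := fun t => varSum (U t) x n)
      (C := l * (2 * n * (2 * κ * C))) (T := T) hl (by linarith) hV₀ (by positivity)
      (by positivity) (h0 x hx n) ?_ ht
    intro s t hs0 hst htT
    have hs : s ∈ Icc 0 T := ⟨hs0, hst.trans htT⟩
    have ht : t ∈ Icc 0 T := ⟨hs0.trans hst, htT⟩
    set B := V₀ * Real.exp (l * (μ - 1) * t) + 2 * (n + 1) * E * Real.exp (4 * l * μ * t)
    have hBr : ∀ r ∈ Icc s t, ∀ z, Monotone z → varSum (U r) z (2 * n + 1) ≤ B :=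
      fun r hr z hz => by
      refine (hB r ⟨hs0.trans hr.1, hr.2.trans htT⟩ z hz _).trans ?_
      have := hr.2
      have e : (((2 * n + 1 : ℕ) : ℝ) + 1) * E = 2 * (n + 1) * E := by push_cast; ring
      rw [e]
      simp only [B]
      gcongr
    have hτ : 0 ≤ t - s := sub_nonneg.2 hst
    -- Signs of the increments at the later time `t`. They write the variation at `t` as a linear
    -- expression, whose value at `s` is at most the variation at `s`.
    set σ' : ℕ → ℝ := fun i => if U t (x i) ≤ U t (x (i + 1)) then 1 else -1 with hσ'
    have hσ'1 : ∀ i, |σ' i| ≤ 1 := fun i => by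
      simp only [σ']
      split_ifs <;> simp
    have hσ'2 : ∀ i, σ' i * (U t (x (i + 1)) - U t (x i)) = |U t (x (i + 1)) - U t (x i)| :=
      fun i => by
        simp only [σ']
        split_ifs with hi
        · rw [one_mul, abs_of_nonneg (sub_nonneg.2 hi)]
        · rw [neg_one_mul, abs_of_nonpos (sub_nonpos.2 (not_le.1 hi).le)]
    -- The index is shifted so that `σ i` belongs to the increment ending at `x i`. No increment
    -- ends at `x 0`, hence the value `0`.
    set σ : ℕ → ℝ := fun i => Nat.casesOn i 0 σ' with hσdef
    have hσs : ∀ i, σ (i + 1) = σ' i := fun i => rfl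
    have hσ0 : σ 0 = 0 := rfl
    have hσ1 : ∀ i, |σ i| ≤ 1 := fun i => by
      cases i with
      | zero => rw [hσ0, abs_zero]; exact zero_le_one
      | succ i => exact hσ'1 i
    set P := L * (μ * B - varSum (U t) x n + 2 * n * (2 * κ * C) * (t - s))
    have hE' : ∀ ζ : ℕ → ℝ, (∀ i, ζ i ≤ x i) → (∀ i, x i ≤ ζ (i + 1)) →
        ∑ i ∈ Finset.range (n + 1), (|(X t (x i) - X s (x i)) - (X t (ζ i) - X s (ζ i))| -
        σ i * ((X t (x i) - X s (x i)) - (X t (ζ i) - X s (ζ i)))) ≤ (t - s) * P := by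
      intro ζ hζ1 hζ2
      have hcv : ∀ i, Continuous fun r => v r (x i) - v r (ζ i) := fun i =>
        (h.cont _).sub (h.cont _)
      have hci : ∀ i, Continuous fun r => |v r (x i) - v r (ζ i)| -
          σ i * (v r (x i) - v r (ζ i)) := fun i => (hcv i).abs.sub (continuous_const.mul (hcv i))
      have hterm : ∀ i, |(X t (x i) - X s (x i)) - (X t (ζ i) - X s (ζ i))| -
          σ i * ((X t (x i) - X s (x i)) - (X t (ζ i) - X s (ζ i))) ≤
          ∫ r in s..t, (|v r (x i) - v r (ζ i)| - σ i * (v r (x i) - v r (ζ i))) := fun i => by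
        rw [h.displacement_sub_eq hs ht, intervalIntegral.integral_sub
          ((hcv i).abs.intervalIntegrable _ _)
          (((hcv i).intervalIntegrable _ _).const_mul _),
          intervalIntegral.integral_const_mul]
        exact sub_le_sub_right (intervalIntegral.abs_integral_le_integral_abs hst) _
      -- Inserting the `ζ i` gives a partition with `2n + 1` increments, along which the variation
      -- of `U r` is at most `B`. The signed terms return the variation of `U t` along `x`, up to
      -- the increments from `x i` to `ζ (i + 1)`, which also belong to the refined partition. What
      -- remains is `B` minus the current variation, plus errors.
      have hpt : ∀ r ∈ Icc s t, ∑ i ∈ Finset.range (n + 1), (|v r (x i) - v r (ζ i)| -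
          σ i * (v r (x i) - v r (ζ i))) ≤ P := fun r hr => by
        have hr' : r ∈ Icc 0 T := ⟨hs0.trans hr.1, hr.2.trans htT⟩
        have hmono := monotone_interleave hζ1 hζ2
        have hU := hBr r hr _ hmono
        have hd := hw r hr' (2 * n + 1) B (hBr r hr) _ hmono
        rw [varSum_interleave] at hU hd
        have hvw : ∀ i, |v r (x i) - v r (ζ i)| - σ i * (v r (x i) - v r (ζ i)) ≤
            L * (|w r (x i) - w r (ζ i)| - σ i * (w r (x i) - w r (ζ i))) := fun i => by
          refine abs_sub_sign_mul_le (hσ1 i) (fun hb => hv r hr' _ _ (sub_nonneg.1 hb))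
            fun hb => ?_
          have := hv r hr' _ _ (sub_nonpos.1 hb)
          exact ⟨by linarith, by linarith⟩
        have hwU : ∀ i, |w r (x i) - w r (ζ i)| - σ i * (w r (x i) - w r (ζ i)) ≤
            (|U r (x i) - U r (ζ i)| - σ i * (U r (x i) - U r (ζ i))) +
            2 * |(w r (x i) - U r (x i)) - (w r (ζ i) - U r (ζ i))| := fun i => by
          have e : w r (x i) - w r (ζ i) = (U r (x i) - U r (ζ i)) +
            ((w r (x i) - U r (x i)) - (w r (ζ i) - U r (ζ i))) := by ring
          have a1 := abs_add_le (U r (x i) - U r (ζ i))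
            ((w r (x i) - U r (x i)) - (w r (ζ i) - U r (ζ i)))
          rw [← e] at a1
          have a2 : -(σ i * ((w r (x i) - U r (x i)) - (w r (ζ i) - U r (ζ i)))) ≤
              |(w r (x i) - U r (x i)) - (w r (ζ i) - U r (ζ i))| := by
            refine (neg_le_abs _).trans ?_
            rw [abs_mul]
            exact mul_le_of_le_one_left (abs_nonneg _) (hσ1 i)
          nlinarith
        have hsum : ∑ i ∈ Finset.range (n + 1),
            (|U r (x i) - U r (ζ i)| - σ i * (U r (x i) - U r (ζ i))) ≤
            B - varSum (U t) x n + 2 * n * (2 * κ * C) * (t - s) := by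
          rw [Finset.sum_sub_distrib, Finset.sum_range_succ' (fun i => σ i * _), hσ0, zero_mul,
            add_zero]
          have hsi : ∀ i, |U t (x (i + 1)) - U t (x i)| - 2 * (2 * κ * C) * (t - s) -
              |U r (ζ (i + 1)) - U r (x i)| ≤
              σ (i + 1) * (U r (x (i + 1)) - U r (ζ (i + 1))) := fun i => by
            have d1 := abs_le.1 (h.abs_potential_sub_le hr' ht (x i))
            have d2 := abs_le.1 (h.abs_potential_sub_le hr' ht (x (i + 1)))
            have d3 : 2 * κ * C * |t - r| ≤ 2 * κ * C * (t - s) := by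
              rw [abs_of_nonneg (sub_nonneg.2 hr.2)]
              exact mul_le_mul_of_nonneg_left (by linarith [hr.1]) (by positivity)
            have d4 : σ' i * ((U t (x (i + 1)) - U t (x i)) - (U r (x (i + 1)) - U r (x i))) ≤
                2 * (2 * κ * C) * (t - s) := by
              refine (le_abs_self _).trans ?_
              rw [abs_mul]
              refine (mul_le_of_le_one_left (abs_nonneg _) (hσ'1 i)).trans ?_
              rw [abs_le]
              constructor <;> linarith [d1.1, d1.2, d2.1, d2.2]
            have d5 : σ' i * (U r (ζ (i + 1)) - U r (x i)) ≤ |U r (ζ (i + 1)) - U r (x i)| := by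
              refine (le_abs_self _).trans ?_
              rw [abs_mul]
              exact mul_le_of_le_one_left (abs_nonneg _) (hσ'1 i)
            rw [hσs, ← hσ'2]
            linarith
          have hsum' := Finset.sum_le_sum fun i (_ : i ∈ Finset.range n) => hsi i
          rw [Finset.sum_sub_distrib, Finset.sum_sub_distrib, Finset.sum_const,
            Finset.card_range, nsmul_eq_mul] at hsum'
          change varSum (U t) x n - _ - _ ≤ _ at hsum'
          linarith
        have hdsum : ∑ i ∈ Finset.range (n + 1),
            2 * |(w r (x i) - U r (x i)) - (w r (ζ i) - U r (ζ i))| ≤ 2 * (θ * B) := by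
          rw [← Finset.mul_sum]
          have : 0 ≤ ∑ i ∈ Finset.range n, |(w r (ζ (i + 1)) - U r (ζ (i + 1))) -
            (w r (x i) - U r (x i))| := Finset.sum_nonneg fun _ _ => abs_nonneg _
          linarith
        calc _ ≤ ∑ i ∈ Finset.range (n + 1), L * ((|U r (x i) - U r (ζ i)| -
              σ i * (U r (x i) - U r (ζ i))) +
              2 * |(w r (x i) - U r (x i)) - (w r (ζ i) - U r (ζ i))|) :=
              Finset.sum_le_sum fun i _ => (hvw i).trans (mul_le_mul_of_nonneg_left (hwU i) hL)
          _ ≤ P := by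
              rw [← Finset.mul_sum, Finset.sum_add_distrib]
              refine mul_le_mul_of_nonneg_left ?_ hL
              simp only [μ]
              linarith
      calc _ ≤ ∑ i ∈ Finset.range (n + 1),
            ∫ r in s..t, (|v r (x i) - v r (ζ i)| - σ i * (v r (x i) - v r (ζ i))) :=
            Finset.sum_le_sum fun i _ => hterm i
        _ = ∫ r in s..t, ∑ i ∈ Finset.range (n + 1),
            (|v r (x i) - v r (ζ i)| - σ i * (v r (x i) - v r (ζ i))) :=
            (intervalIntegral.integral_finsetSum fun i _ =>
              (hci i).intervalIntegrable _ _).symm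
        _ ≤ ∫ r in s..t, P := intervalIntegral.integral_mono_on hst
            ((continuous_finsetSum _ fun i _ => hci i).intervalIntegrable _ _) (by simp) hpt
        _ = (t - s) * P := by rw [intervalIntegral.integral_const, smul_eq_mul]
    have hmain := h.sum_sign_mul_potential_sub_le hk hs ht hx n hσ1 hσ0 hE'
    have hincr : varSum (U t) x n - varSum (U s) x n ≤ ∑ i ∈ Finset.range n, σ (i + 1) *
        ((U t (x (i + 1)) - U t (x i)) - (U s (x (i + 1)) - U s (x i))) := by
      rw [varSum, varSum, ← Finset.sum_sub_distrib]
      refine Finset.sum_le_sum fun i _ => ?_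
      rw [hσs, mul_sub, hσ'2]
      refine sub_le_sub_left ((le_abs_self _).trans ?_) _
      rw [abs_mul]
      exact mul_le_of_le_one_left (abs_nonneg _) (hσ'1 i)
    refine (hincr.trans hmain).trans (le_of_eq ?_)
    simp only [P, l]
    ring
  have iter : ∀ j : ℕ, ∀ t ∈ Icc 0 T, ∀ x, Monotone x → ∀ n : ℕ, varSum (U t) x n ≤
      V₀ * Real.exp (l * (μ - 1) * t) +
        (n + 1) * (2 * S / 2 ^ j) * Real.exp (4 * l * μ * t) := by
    intro j
    induction j with
    | zero =>
      intro t ht x hx n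
      have h1 : varSum (U t) x n ≤ n * (2 * S) := by
        refine (Finset.sum_le_sum (g := fun _ => 2 * S) fun i _ => ?_).trans (by simp)
        have a1 := h.potential_le t ht (x i)
        have a2 := h.potential_le t ht (x (i + 1))
        exact (abs_sub _ _).trans (by linarith)
      have h2 : 0 ≤ V₀ * Real.exp (l * (μ - 1) * t) := by positivity
      have h3 : 1 ≤ Real.exp (4 * l * μ * t) := Real.one_le_exp (by
        have := ht.1
        positivity)
      have h4 := mul_le_mul_of_nonneg_left h3 (show 0 ≤ ((n : ℝ) + 1) * (2 * S) by positivity)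
      simp only [pow_zero, div_one]
      linarith
    | succ j ih =>
      have := step _ (by positivity) ih
      simpa only [pow_succ, div_div] using this
  intro x hx n
  have hlim : Filter.Tendsto (fun j : ℕ => V₀ * Real.exp (l * (μ - 1) * t) +
      (n + 1) * (2 * S / 2 ^ j) * Real.exp (4 * l * μ * t)) Filter.atTop
      (𝓝 (V₀ * Real.exp (l * (μ - 1) * t) + (n + 1) * 0 * Real.exp (4 * l * μ * t))) := by
    refine tendsto_const_nhds.add (Filter.Tendsto.mul_const _ (Filter.Tendsto.const_mul _ ?_))
    have := (tendsto_pow_atTop_nhds_zero_of_lt_one (show (0 : ℝ) ≤ 1 / 2 by norm_num)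
      (by norm_num)).const_mul (2 * S)
    simpa only [mul_zero, div_pow, one_pow, mul_one_div] using this
  have := ge_of_tendsto' hlim fun j => iter j t ht x hx n
  rwa [mul_zero, zero_mul, add_zero, hμ1] at this

end IsParticleSystem

/-! ### Lagrangian solutions -/

/-- A density `ρ` that is transported from `|g|` by the flow `X` of the velocity `V(W)`, where
`W = conv κ ρ`. -/
structure IsLagrangianSolution (V κ g : ℝ → ℝ) (T M C : ℝ) (ρ X v : ℝ → ℝ → ℝ) : Prop where
  meas : ∀ t, Measurable (ρ t)
  nonneg : ∀ t x, 0 ≤ ρ t x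
  bdd : ∀ t, ∀ᵐ x, |ρ t x| ≤ M
  init : ∀ x, X 0 x = x
  strictMono : ∀ t ∈ Icc 0 T, StrictMono (X t)
  surjective : ∀ t ∈ Icc 0 T, Function.Surjective (X t)
  lower : ∃ l > 0, ∀ t ∈ Icc 0 T, ∀ x y, l * |x - y| ≤ |X t x - X t y|
  cont : ∀ x, Continuous fun t => v t x
  bound : ∀ t x, |v t x| ≤ C
  sub_eq : ∀ x, ∀ s ∈ Icc 0 T, ∀ t ∈ Icc 0 T, X t x - X s x = ∫ r in s..t, v r x
  velocity : ∀ t x, v t x = V (conv κ (ρ t) (X t x))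
  conv_eq : ∀ t ∈ Icc 0 T, ∀ k : ℝ → ℝ, Measurable k → ∀ x,
    conv k (ρ t) x = ∫ y, k (X t y - x) ∂absMeasure g
  integrable : ∀ t ∈ Icc 0 T, ∀ k : ℝ → ℝ, Measurable k → Integrable k → ∀ x,
    Integrable (fun y => k (X t y - x)) (absMeasure g)

theorem integrable_absMeasure {f g : ℝ → ℝ} (hf : Measurable f) {M : ℝ} (hM : ∀ᵐ x, |f x| ≤ M)
    (hg : Integrable g) : Integrable g (absMeasure f) := by
  rw [absMeasure, integrable_withDensity_iff_integrable_smul' hf.abs.ennreal_ofReal (by simp)]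
  have := hg.bdd_mul hf.abs.aestronglyMeasurable (hM.mono fun x hx => show ‖|f x|‖ ≤ M by
    rwa [Real.norm_eq_abs, abs_abs])
  refine this.congr (.of_forall fun x => ?_)
  simp only
  rw [ENNReal.toReal_ofReal (abs_nonneg _), smul_eq_mul]

theorem IsWeakSolution.exists_isLagrangianSolution {V γ q₀ g : ℝ → ℝ} {T Q c : ℝ} (hT : 0 < T)
    (hV : IsVelocity V) (hk : IsKernel ((Iio 0).indicator γ) c) (hg : Measurable g)
    (hQ : ∀ x, |g x| ≤ Q) (hgq : q₀ =ᵐ[volume] g) {q : C(Icc (0 : ℝ) T, L1Loc)}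
    (h : IsWeakSolution V γ q₀ T q) : ∃ M C X v,
      IsLagrangianSolution V ((Iio 0).indicator γ) g T M C
        (fun t y => |q (projIcc 0 T hT.le t) y|) X v := by
  obtain ⟨M, hM0, hM⟩ := h.exists_bound hT
  set κ := (Iio (0 : ℝ)).indicator γ
  set ρ : ℝ → ℝ → ℝ := fun t y => |q (projIcc 0 T hT.le t) y|
  have hM' : ∀ t, ∀ᵐ x, |ρ t x| ≤ M := fun t => (hM _).mono fun x hx => by
    simp only [ρ]
    rwa [abs_abs]
  set R := M * ∫ s, |κ s|
  have hconv : ∀ t x, conv κ (ρ t) x ∈ Icc 0 R := fun t x =>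
    ⟨conv_nonneg hk.nonneg (fun x => abs_nonneg _) x,
      (le_abs_self _).trans (abs_conv_le hk.integrable (hM' t) x)⟩
  obtain ⟨K, hK⟩ := hV.lipschitz R
  have hR0 : 0 ≤ R := (hconv 0 0).1.trans (hconv 0 0).2
  set b : ℝ → ℝ → ℝ := fun t x => V (conv κ (ρ t) x)
  have hbl : ∀ t, LipschitzWith (K * (M * c).toNNReal) (b t) := fun t => by
    refine LipschitzWith.of_dist_le_mul fun x y => ?_
    refine (hK.dist_le_mul _ (hconv t x) _ (hconv t y)).trans ?_
    rw [NNReal.coe_mul, mul_assoc, Real.dist_eq, Real.dist_eq]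
    refine mul_le_mul_of_nonneg_left ?_ K.2
    exact (abs_conv_sub_le hk (aestronglyMeasurable_abs _) (hM' t) x y).trans
      (mul_le_mul_of_nonneg_right (Real.le_coe_toNNReal _) (abs_nonneg _))
  have hbc : ∀ x, Continuous fun t => b t x := fun x => by
    have h1 : Continuous fun t => conv κ (ρ t) x :=
      (continuous_conv_abs hM hk x).comp continuous_projIcc
    exact (hK.continuousOn.comp_continuous h1 fun t => hconv t x)
  have hbb : ∀ t x, |b t x| ≤ |V 0| + K * R := fun t x => by
    have h1 := hK.dist_le_mul _ (hconv t x) 0 ⟨le_rfl, hR0⟩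
    rw [Real.dist_eq, Real.dist_eq, sub_zero, abs_of_nonneg (hconv t x).1] at h1
    have h2 : (K : ℝ) * conv κ (ρ t) x ≤ K * R := mul_le_mul_of_nonneg_left (hconv t x).2 K.2
    have h3 := abs_sub_abs_le_abs_sub (V (conv κ (ρ t) x)) (V 0)
    simp only [b]
    linarith
  obtain ⟨X, hX⟩ := exists_isFlow hT.le hbc hbl hbb
  have hw : IsWeakTransport b g q := fun φ h1 h2 h3 => by
    have := h.weak φ h1 h2 h3
    rw [integral_congr_ae (g := fun x => φ (0, x) * g x) (hgq.mono fun x hx => by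
      simp only
      rw [hx])] at this
    refine Eq.trans ?_ this
    congr 1
    refine integral_congr_ae (.of_forall fun t => integral_congr_ae (.of_forall fun x => ?_))
    simp only [b, ρ, projIcc_val]
    rw [nonlocalTerm_eq_conv]
  refine ⟨M, _, X, fun t x => b t (X t x), fun t => (q _).stronglyMeasurable.measurable.abs,
    fun t x => abs_nonneg _, hM', hX.init, fun t ht => hX.strictMono ht,
    fun t ht => hX.surjective ht,
    ⟨Real.exp (-((K * (M * c).toNNReal : ℝ≥0) * T)), Real.exp_pos _, fun t ht x y => ?_⟩,
    hX.continuous_field, fun t x => hbb t _, fun x s hs t ht => hX.sub_eq_integral x hs ht,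
    fun t x => rfl, fun t ht k hk x => ?_, fun t ht k hkm hki x => ?_⟩
  · have h1 := hX.le_dist x y ht
    have h2 : Real.exp ((K * (M * c).toNNReal : ℝ≥0) * t) ≤
        Real.exp ((K * (M * c).toNNReal : ℝ≥0) * T) :=
      Real.exp_le_exp.2 (mul_le_mul_of_nonneg_left ht.2 (NNReal.coe_nonneg _))
    have h3 := h1.trans (mul_le_mul_of_nonneg_left h2 (abs_nonneg _))
    rw [Real.exp_neg, inv_mul_le_iff₀ (Real.exp_pos _)]
    linarith
  · have := conv_abs_eq_integral_flow hT hX hM hM0 hg hQ hw ⟨t, ht⟩ hk x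
    simpa only [ρ, projIcc_of_mem hT.le ht] using this
  · have h1 := map_flow_absMeasure hT hX hM hM0 hg hQ hw ⟨t, ht⟩
    have h2 : Integrable (fun y => k (y - x)) (absMeasure (q ⟨t, ht⟩)) :=
      integrable_absMeasure (q ⟨t, ht⟩).stronglyMeasurable.measurable (hM _)
        (hki.comp_sub_right x)
    rw [← h1] at h2
    exact h2.comp_measurable (hX.strictMono ht).monotone.measurable

theorem integral_conv {k ρ : ℝ → ℝ} {M : ℝ} (hkm : Measurable k) (hk : Integrable k)
    (hρ : AEStronglyMeasurable ρ volume) (hM : ∀ᵐ x, |ρ x| ≤ M) {a b : ℝ} (hab : a ≤ b) :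
    ∫ x in a..b, conv k ρ x = ∫ y, (∫ x in a..b, k (y - x)) * ρ y := by
  have hm : AEStronglyMeasurable (fun p : ℝ × ℝ => k (p.2 - p.1) * ρ p.2)
      ((volume.restrict (Ioc a b)).prod volume) :=
    (hkm.comp (measurable_snd.sub measurable_fst)).aestronglyMeasurable.mul
      (hρ.comp_quasiMeasurePreserving Measure.quasiMeasurePreserving_snd)
  have hint : Integrable (fun p : ℝ × ℝ => k (p.2 - p.1) * ρ p.2)
      ((volume.restrict (Ioc a b)).prod volume) := by
    rw [integrable_prod_iff hm]
    refine ⟨.of_forall fun x => integrable_conv hk hρ hM x, ?_⟩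
    refine Integrable.of_bound hm.norm.integral_prod_right' (M * ∫ s, |k s|) (.of_forall fun x => ?_)
    have := abs_conv_le (k := fun s => |k s|) (ρ := fun y => |ρ y|) hk.abs
      (hM.mono fun x hx => by rwa [abs_abs]) x
    simpa only [conv, abs_abs, norm_mul, Real.norm_eq_abs] using this
  rw [intervalIntegral.integral_of_le hab]
  simp only [conv]
  rw [integral_integral_swap hint]
  congr 1
  ext y
  rw [integral_mul_const, intervalIntegral.integral_of_le hab]

namespace IsLagrangianSolution

variable {V κ g : ℝ → ℝ} {T M C : ℝ} {ρ X v : ℝ → ℝ → ℝ}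

theorem potential_eq (h : IsLagrangianSolution V κ g T M C ρ X v) {k : ℝ → ℝ} (hk : Measurable k)
    {t : ℝ} (ht : t ∈ Icc 0 T) (x : ℝ) :
    potential (absMeasure g) X k t x = conv k (ρ t) (X t x) := (h.conv_eq t ht k hk _).symm

theorem varLe_conv (h : IsLagrangianSolution V κ g T M C ρ X v) {f : ℝ → ℝ} {A t : ℝ}
    (ht : t ∈ Icc 0 T) (hA : VarLe (fun x => f (X t x)) A) : VarLe f A := by
  intro z hz n
  choose x hx using fun i => h.surjective t ht (z i)
  have hxm : Monotone x := fun i j hij => by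
    rw [← (h.strictMono t ht).le_iff_le, hx, hx]
    exact hz hij
  have := hA x hxm n
  simpa only [varSum, hx] using this

theorem conv_zero (h : IsLagrangianSolution V κ g T M C ρ X v) (hT : 0 ≤ T) (hg : Measurable g)
    {k : ℝ → ℝ} (hk : Measurable k) (x : ℝ) :
    conv k (ρ 0) x = conv k (fun y => |g y|) x := by
  rw [h.conv_eq 0 ⟨le_rfl, hT⟩ k hk]
  simp only [h.init]
  rw [integral_absMeasure hg]
  rfl

theorem conv_zero_le (h : IsLagrangianSolution V κ g T M C ρ X v) (hT : 0 ≤ T)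
    (hg : Measurable g) {Q : ℝ} (hQ : ∀ x, |g x| ≤ Q) {k : ℝ → ℝ} (hk : Measurable k)
    (hki : Integrable k) (hk0 : ∀ s, 0 ≤ k s) (x : ℝ) :
    conv k (ρ 0) x ≤ Q * ∫ s, k s := by
  rw [h.conv_zero hT hg hk]
  have := abs_conv_le (ρ := fun y => |g y|) hki (.of_forall fun y => by
    rw [abs_abs]; exact hQ y) x
  simp only [abs_of_nonneg (hk0 _)] at this
  exact (le_abs_self _).trans this

/-- The initial average is a superposition of translates of `|g|`, each of variation at most `A`,
with total weight `∫ k`. -/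
theorem varLe_conv_zero (h : IsLagrangianSolution V κ g T M C ρ X v) (hT : 0 ≤ T) {A Q : ℝ}
    (hA : VarLe g A) (hQ : ∀ x, |g x| ≤ Q) {k : ℝ → ℝ} (hk : Measurable k)
    (hki : Integrable k) (hk0 : ∀ s, 0 ≤ k s) : VarLe (conv k (ρ 0)) (A * ∫ s, k s) := by
  intro z hz n
  have hg := hA.measurable
  have hi : ∀ i, Integrable fun s => k s * |g (s + z i)| := fun i => by
    have h1 := hki.bdd_mul (f := fun s => |g (s + z i)|) (c := Q)
      (hg.comp (measurable_id.add_const _)).abs.aestronglyMeasurable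
      (.of_forall fun s => by rw [Real.norm_eq_abs, abs_abs]; exact hQ _)
    simpa only [mul_comm] using h1
  have e : ∀ i, conv k (ρ 0) (z i) = ∫ s, k s * |g (s + z i)| := fun i => by
    rw [h.conv_zero hT hg hk, conv_eq_integral_mul_add]
  calc varSum (conv k (ρ 0)) z n
      ≤ ∑ i ∈ Finset.range n, ∫ s, k s * |g (s + z (i + 1)) - g (s + z i)| := by
        refine Finset.sum_le_sum fun i _ => ?_
        rw [e, e, ← integral_sub (hi _) (hi _), ← Real.norm_eq_abs]
        have h1 : Integrable fun s => k s * |g (s + z (i + 1)) - g (s + z i)| := by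
          have h1 := hki.bdd_mul (f := fun s => |g (s + z (i + 1)) - g (s + z i)|) (c := Q + Q)
            ((hg.comp (measurable_id.add_const _)).sub
              (hg.comp (measurable_id.add_const _))).abs.aestronglyMeasurable
            (.of_forall fun s => by
              rw [Real.norm_eq_abs, abs_abs]
              exact (abs_sub _ _).trans (add_le_add (hQ _) (hQ _)))
          simpa only [mul_comm] using h1
        refine (norm_integral_le_integral_norm _).trans (integral_mono_of_nonneg
          (.of_forall fun _ => norm_nonneg _) h1 (.of_forall fun s => ?_))
        simp only
        rw [← mul_sub, norm_mul, Real.norm_of_nonneg (hk0 s)]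
        exact mul_le_mul_of_nonneg_left (abs_abs_sub_abs_le _ _) (hk0 s)
    _ = ∫ s, ∑ i ∈ Finset.range n, k s * |g (s + z (i + 1)) - g (s + z i)| := by
        refine (integral_finsetSum _ fun i _ => ?_).symm
        have h1 := hki.bdd_mul (f := fun s => |g (s + z (i + 1)) - g (s + z i)|) (c := Q + Q)
          ((hg.comp (measurable_id.add_const _)).sub
            (hg.comp (measurable_id.add_const _))).abs.aestronglyMeasurable
          (.of_forall fun s => by
            rw [Real.norm_eq_abs, abs_abs]
            exact (abs_sub _ _).trans (add_le_add (hQ _) (hQ _)))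
        simpa only [mul_comm] using h1
    _ ≤ ∫ s, A * k s := by
        refine integral_mono_of_nonneg (.of_forall fun s => Finset.sum_nonneg fun i _ =>
          mul_nonneg (hk0 s) (abs_nonneg _)) (hki.const_mul A) (.of_forall fun s => ?_)
        simp only
        rw [← Finset.mul_sum, mul_comm]
        exact mul_le_mul_of_nonneg_right
          (hA (fun i => s + z i) (fun i j hij => by simpa using hz hij) n) (hk0 s)
    _ = A * ∫ s, k s := integral_const_mul _ _

/-- The nonlocal term is Lipschitz continuous in time, in a weak norm. -/
theorem abs_integral_conv_sub_le (h : IsLagrangianSolution V κ g T M C ρ X v) {k : ℝ → ℝ}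
    (hkm : Measurable k) (hki : Integrable k) (hk0 : ∀ s, 0 ≤ k s) {S C' : ℝ}
    (hS : ∀ t ∈ Icc 0 T, ∀ x, conv k (ρ t) x ≤ S) (hC' : ∀ t ∈ Icc 0 T, ∀ x, |v t x| ≤ C')
    (hcont : ∀ t ∈ Icc 0 T, Continuous (conv k (ρ t)))
    {s t : ℝ} (hs : s ∈ Icc 0 T) (ht : t ∈ Icc 0 T) {a b : ℝ} (hab : a ≤ b) :
    |∫ x in a..b, (conv k (ρ t) x - conv k (ρ s) x)| ≤ 4 * C' * S * |t - s| := by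
  have hC0 : 0 ≤ C' := (abs_nonneg _).trans (hC' s hs 0)
  -- With a primitive of the kernel, the integral of the average over `[a, b]` becomes an integral
  -- over particles of `P (X - a) - P (X - b)`. Time dependence enters only through positions, and
  -- `P` is monotone.
  set P : ℝ → ℝ := fun z => ∫ x in (0 : ℝ)..z, k x
  have hii : ∀ a b, IntervalIntegrable k volume a b := fun a b => hki.intervalIntegrable
  have hPc : Continuous P := intervalIntegral.continuous_primitive hii 0
  have hPm : Monotone P := fun y z hyz => by
    have h1 := intervalIntegral.integral_interval_sub_left (hii 0 z) (hii 0 y)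
    have h2 : 0 ≤ ∫ x in y..z, k x := intervalIntegral.integral_nonneg hyz fun x _ => hk0 x
    simp only [P]
    linarith
  have hP : ∀ a b z, ∫ x in a..b, k (z - x) = P (z - a) - P (z - b) := fun a b z => by
    rw [intervalIntegral.integral_comp_sub_left (fun x => k x)]
    exact (intervalIntegral.integral_interval_sub_left (hii _ _) (hii _ _)).symm
  have hKm : ∀ a b, Measurable fun z => P (z - a) - P (z - b) := fun a b =>
    ((hPc.comp (continuous_id.sub continuous_const)).sub
      (hPc.comp (continuous_id.sub continuous_const))).measurable
  have hKi : ∀ a b, a ≤ b → Integrable fun z => P (z - a) - P (z - b) := fun a b hab => by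
    have hm : AEStronglyMeasurable (fun p : ℝ × ℝ => k (p.2 - p.1))
        ((volume.restrict (Ioc a b)).prod volume) :=
      (hkm.comp (measurable_snd.sub measurable_fst)).aestronglyMeasurable
    have hint : Integrable (fun p : ℝ × ℝ => k (p.2 - p.1))
        ((volume.restrict (Ioc a b)).prod volume) := by
      rw [integrable_prod_iff hm]
      refine ⟨.of_forall fun x => hki.comp_sub_right x, ?_⟩
      refine (integrable_const (∫ s, ‖k s‖)).congr (.of_forall fun x => ?_)
      simp only
      rw [integral_sub_right_eq_self (fun s => ‖k s‖) x]
    refine hint.integral_prod_right.congr (.of_forall fun z => ?_)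
    simp only
    rw [← hP, intervalIntegral.integral_of_le hab]
  have hW : ∀ r ∈ Icc 0 T, ∀ a b, a ≤ b → ∫ x in a..b, conv k (ρ r) x =
      ∫ y, (P (X r y - a) - P (X r y - b)) ∂absMeasure g := fun r hr a b hab => by
    rw [integral_conv hkm hki (h.meas r).aestronglyMeasurable (h.bdd r) hab]
    have := h.conv_eq r hr _ (hKm a b) 0
    simp only [conv, sub_zero] at this
    rw [← this]
    simp only [hP]
  have hI : ∀ r ∈ Icc 0 T, ∀ a b, a ≤ b →
      Integrable (fun y => P (X r y - a) - P (X r y - b)) (absMeasure g) := fun r hr a b hab => by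
    simpa only [sub_zero] using h.integrable r hr _ (hKm a b) (hKi a b hab) 0
  set δ := C' * |t - s|
  have hδ : 0 ≤ δ := mul_nonneg hC0 (abs_nonneg _)
  have hdisp : ∀ y, |X t y - X s y| ≤ δ := fun y => by
    rw [h.sub_eq y s hs t ht, ← Real.norm_eq_abs]
    refine intervalIntegral.norm_integral_le_of_norm_le_const fun r hr => ?_
    exact hC' r ((ordConnected_Icc.uIcc_subset hs ht) (uIoc_subset_uIcc hr)) y
  have hside : ∀ c, ∫ y, (P (X s y - (c - δ)) - P (X s y - (c + δ))) ∂absMeasure g ≤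
      2 * δ * S := fun c => by
    rw [← hW s hs _ _ (by linarith)]
    calc _ ≤ ∫ x in (c - δ)..(c + δ), S := intervalIntegral.integral_mono_on (by linarith)
          ((hcont s hs).intervalIntegrable _ _) (by simp) fun x _ => hS s hs x
      _ = 2 * δ * S := by rw [intervalIntegral.integral_const, smul_eq_mul]; ring
  rw [intervalIntegral.integral_sub ((hcont t ht).intervalIntegrable _ _)
    ((hcont s hs).intervalIntegrable _ _), hW t ht a b hab, hW s hs a b hab,
    ← integral_sub (hI t ht a b hab) (hI s hs a b hab), ← Real.norm_eq_abs]
  calc _ ≤ ∫ y, ((P (X s y - (a - δ)) - P (X s y - (a + δ))) +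
        (P (X s y - (b - δ)) - P (X s y - (b + δ)))) ∂absMeasure g := by
        refine (norm_integral_le_integral_norm _).trans (integral_mono_of_nonneg
          (.of_forall fun _ => norm_nonneg _) ((hI s hs _ _ (by linarith)).add
            (hI s hs _ _ (by linarith))) (.of_forall fun y => ?_))
        have hd := abs_le.1 (hdisp y)
        -- A displacement by at most `δ` is dominated by shifting the endpoint `c` by `δ` both ways.
        -- Integrated over particles this is the average at time `s` over an interval of length
        -- `2δ`, hence at most `2δS`; the regularity of the kernel does not enter the constant.
        have hc : ∀ c, |P (X t y - c) - P (X s y - c)| ≤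
            P (X s y - (c - δ)) - P (X s y - (c + δ)) := fun c => by
          have m1 : P (X t y - c) ≤ P (X s y - (c - δ)) := hPm (by linarith [hd.2])
          have m2 : P (X s y - (c + δ)) ≤ P (X t y - c) := hPm (by linarith [hd.1])
          have m3 : P (X s y - c) ≤ P (X s y - (c - δ)) := hPm (by linarith)
          have m4 : P (X s y - (c + δ)) ≤ P (X s y - c) := hPm (by linarith)
          rw [abs_le]
          constructor <;> linarith
        have e : P (X t y - a) - P (X t y - b) - (P (X s y - a) - P (X s y - b)) =
          (P (X t y - a) - P (X s y - a)) - (P (X t y - b) - P (X s y - b)) := by ring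
        simp only
        rw [e]
        exact (abs_sub _ _).trans (add_le_add (hc a) (hc b))
    _ ≤ 2 * δ * S + 2 * δ * S := by
        rw [integral_add (hI s hs _ _ (by linarith)) (hI s hs _ _ (by linarith))]
        exact add_le_add (hside a) (hside b)
    _ = _ := by simp only [δ]; ring

end IsLagrangianSolution

/-! ### Translates of functions of bounded variation -/

/-- Over a bounded interval the integral telescopes to two boundary pieces of length `h`, where `N`
lies between `0` and `A`. Nonnegativity of the integrand then allows the interval to exhaust `ℝ`. -/
theorem integrable_translate_sub {N : ℝ → ℝ} {A h : ℝ} (hN : Monotone N)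
    (hA : ∀ x, N x ∈ Icc 0 A) (hh : 0 ≤ h) :
    Integrable (fun s => N (s + h) - N s) ∧ ∫ s, (N (s + h) - N s) ≤ A * h := by
  have hi : ∀ a b, IntervalIntegrable N volume a b := fun a b => hN.intervalIntegrable
  have hNh : Monotone fun s => N (s + h) := fun x y hxy => hN (by linarith)
  have hd0 : ∀ s, 0 ≤ N (s + h) - N s := fun s => sub_nonneg.2 (hN (by linarith))
  have hint : ∀ n : ℕ, ∫ s in (-(n : ℝ))..n, (N (s + h) - N s) ≤ A * h := fun n => by
    rw [intervalIntegral.integral_sub hNh.intervalIntegrable (hi _ _),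
      intervalIntegral.integral_comp_add_right (fun s => N s),
      intervalIntegral.integral_interval_sub_interval_comm' (hi _ _) (hi _ _) (hi _ _)]
    have h1 : ∫ s in (n : ℝ)..(n + h), N s ≤ ∫ s in (n : ℝ)..(n + h), A :=
      intervalIntegral.integral_mono_on (by linarith) (hi _ _) (by simp) fun x _ => (hA x).2
    have h2 : 0 ≤ ∫ s in (-(n : ℝ))..(-n + h), N s :=
      intervalIntegral.integral_nonneg (by linarith) fun x _ => (hA x).1
    rw [intervalIntegral.integral_const, smul_eq_mul] at h1
    linarith
  have hn1 : Filter.Tendsto (fun n : ℕ => -(n : ℝ)) Filter.atTop Filter.atBot :=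
    Filter.tendsto_neg_atTop_atBot.comp tendsto_natCast_atTop_atTop
  have hn2 : Filter.Tendsto (fun n : ℕ => (n : ℝ)) Filter.atTop Filter.atTop :=
    tendsto_natCast_atTop_atTop
  have hI : Integrable fun s => N (s + h) - N s := by
    refine integrable_of_intervalIntegral_norm_bounded (A * h) (fun n => ?_) hn1 hn2
      (.of_forall fun n => ?_)
    · exact (hNh.intervalIntegrable (a := -(n : ℝ)) (b := n)).1.sub (hi _ _).1
    · simp only [Real.norm_of_nonneg (hd0 _)]
      exact hint n
  exact ⟨hI, le_of_tendsto' (intervalIntegral_tendsto_integral hI hn1 hn2) hint⟩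

theorem varLe_of_le_sub {f N : ℝ → ℝ} {A : ℝ} (hA : ∀ x, N x ∈ Icc 0 A)
    (h : ∀ x y, x ≤ y → |f y - f x| ≤ N y - N x) : VarLe f A := by
  intro x hx n
  refine (Finset.sum_le_sum fun i _ => h _ _ (hx (Nat.le_succ i))).trans ?_
  rw [Finset.sum_range_sub (fun i => N (x i))]
  linarith [(hA (x n)).2, (hA (x 0)).1]

theorem VarLe.integral_translate_le {f : ℝ → ℝ} {A : ℝ} (h : VarLe f A) (s : ℝ) :
    Integrable (fun x => |f (x + s) - f x|) ∧ ∫ x, |f (x + s) - f x| ≤ A * |s| := by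
  obtain ⟨N, hN, hA, hf⟩ := h.exists_monotone
  have hm := h.measurable
  have key : ∀ s, 0 ≤ s → Integrable (fun x => |f (x + s) - f x|) ∧
      ∫ x, |f (x + s) - f x| ≤ A * s := fun s hs => by
    obtain ⟨h1, h2⟩ := integrable_translate_sub hN hA hs
    have h3 : ∀ x, |f (x + s) - f x| ≤ N (x + s) - N x := fun x => hf _ _ (by linarith)
    have h4 : Integrable (fun x => |f (x + s) - f x|) :=
      h1.mono' ((hm.comp (measurable_id.add_const s)).sub hm).abs.aestronglyMeasurable
        (.of_forall fun x => by rw [Real.norm_eq_abs, abs_abs]; exact h3 x)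
    exact ⟨h4, (integral_mono h4 h1 h3).trans h2⟩
  rcases le_total 0 s with hs | hs
  · rw [abs_of_nonneg hs]
    exact key s hs
  · have e : (fun x => |f (x + s) - f x|) = fun x => |f (x + s + -s) - f (x + s)| := by
      ext x
      rw [abs_sub_comm]
      congr 3
      ring
    obtain ⟨h1, h2⟩ := key (-s) (by linarith)
    rw [e, abs_of_nonpos hs]
    exact ⟨h1.comp_add_right s, by
      rwa [integral_add_right_eq_self (fun x => |f (x + -s) - f x|) s]⟩

theorem VarLe.isKernel {k : ℝ → ℝ} {A : ℝ} (h : VarLe k A) (h0 : ∀ s, 0 ≤ k s)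
    (hz : ∀ s, 0 ≤ s → k s = 0) (hi : Integrable k) : IsKernel k A :=
  ⟨h.measurable, h0, hz, hi, fun s => (h.integral_translate_le s).2⟩

/-- A kernel that is monotone on `(-∞, 0)`, supported there, and bounded. -/
theorem varLe_of_monotoneOn {k : ℝ → ℝ} {B : ℝ} (hmono : MonotoneOn k (Iio 0))
    (h0 : ∀ s, 0 ≤ k s) (hz : ∀ s, 0 ≤ s → k s = 0) (hB : ∀ s, k s ≤ B) :
    VarLe k (2 * B) := by
  have hB0 : 0 ≤ B := (h0 0).trans (hB 0)
  refine varLe_of_le_sub (N := fun s => if s < 0 then k s else 2 * B) (fun s => ?_)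
    fun x y hxy => ?_
  · split_ifs
    · exact ⟨h0 s, by linarith [hB s]⟩
    · exact ⟨by linarith, le_rfl⟩
  · split_ifs with h1 h2 h2
    · rw [abs_of_nonneg (sub_nonneg.2 (hmono h2 h1 hxy))]
    · exact absurd (hxy.trans_lt h1) h2
    · rw [hz y (not_lt.1 h1), zero_sub, abs_neg, abs_of_nonneg (h0 x)]
      linarith [hB x]
    · rw [hz y (not_lt.1 h1), hz x (not_lt.1 h2)]
      simp

/-! ### Solutions for convex kernels -/

namespace IsLagrangianSolution

variable {V κ g : ℝ → ℝ} {T M C : ℝ} {ρ X v : ℝ → ℝ → ℝ}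

theorem measurable_secantWeight (h : IsLagrangianSolution V κ g T M C ρ X v) {k : ℝ → ℝ}
    (hk : Measurable k) {s t : ℝ} (hs : s ∈ Icc 0 T) (ht : t ∈ Icc 0 T) (x : ℝ) :
    Measurable (secantWeight X k s t x) := by
  have hX : ∀ r ∈ Icc 0 T, Measurable fun y => X r y - X r x := fun r hr =>
    (h.strictMono r hr).monotone.measurable.sub_const _
  exact (((hk.comp (hX t ht)).sub (hk.comp (hX s hs))).div
    ((hX t ht).sub (hX s hs))).indicator measurableSet_Iio

theorem sub_le_mul (h : IsLagrangianSolution V κ g T M C ρ X v) : ∃ l > 0, ∀ t ∈ Icc 0 T,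
    ∀ x y, y < x → X t y - X t x ≤ l * (y - x) := by
  obtain ⟨l, hl, hX⟩ := h.lower
  refine ⟨l, hl, fun t ht x y hy => ?_⟩
  have h1 := hX t ht x y
  rw [abs_of_pos (sub_pos.2 hy), abs_of_pos (sub_pos.2 (h.strictMono t ht hy))] at h1
  linarith

/-- The flow satisfies `X r y - X r x ≤ l (y - x)` for `y < x`, so by convexity a secant slope at
these positions is at most a slope of `k` immediately to the right of `l (y - x)`. Difference
quotients of a bounded monotone function have mass at most its bound, and Fatou's lemma concludes.
The constant may depend on the solution: with zero comparison error it disappears from the growth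
factors. -/
theorem exists_secant_mass (h : IsLagrangianSolution V κ g T M C ρ X v) (hg : Measurable g)
    {Q : ℝ} (hQ : ∀ x, |g x| ≤ Q) {k : ℝ → ℝ} {B : ℝ} (hkm : Measurable k)
    (hmono : MonotoneOn k (Iio 0)) (hconv : ConvexOn ℝ (Iio 0) k)
    (h0 : ∀ s, 0 ≤ k s) (hB : ∀ s, k s ≤ B) : ∃ K, ∀ s ∈ Icc 0 T, ∀ t ∈ Icc 0 T, ∀ x,
      Integrable (secantWeight X k s t x) (absMeasure g) ∧
      ∫ y, secantWeight X k s t x y ∂absMeasure g ≤ K := by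
  obtain ⟨l, hl, hX⟩ := h.sub_le_mul
  have hB0 : 0 ≤ B := (h0 0).trans (hB 0)
  have hQ0 : 0 ≤ Q := (abs_nonneg _).trans (hQ 0)
  -- Continuing `k` by its upper bound keeps it monotone across `0`, where `k` itself jumps down to
  -- `0`.
  set N : ℝ → ℝ := fun s => if s < 0 then k s else B
  have hN : Monotone N := fun x y hxy => by
    simp only [N]
    split_ifs with h1 h2 h2
    · exact hmono h1 h2 hxy
    · exact hB x
    · exact absurd (hxy.trans_lt h2) h1
    · exact le_rfl
  have hNA : ∀ x, N x ∈ Icc 0 B := fun x => by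
    simp only [N]
    split_ifs
    · exact ⟨h0 x, hB x⟩
    · exact ⟨hB0, le_rfl⟩
  set D : ℝ → ℝ → ℝ := fun η s => (N (s + η) - N s) / η
  have hD0 : ∀ η, 0 < η → ∀ s, 0 ≤ D η s := fun η hη s =>
    div_nonneg (sub_nonneg.2 (hN (by linarith))) hη.le
  have hDi : ∀ η, 0 < η → Integrable (D η) ∧ ∫ s, D η s ≤ B := fun η hη => by
    obtain ⟨h1, h2⟩ := integrable_translate_sub hN hNA hη.le
    refine ⟨h1.div_const η, ?_⟩
    simp only [D]
    rw [integral_div, div_le_iff₀ hη]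
    exact h2
  have hDx : ∀ η, 0 < η → ∀ x, ∫⁻ y, ENNReal.ofReal (D η (l * (y - x))) ∂absMeasure g ≤
      ENNReal.ofReal (Q * (B / l)) := fun η hη x => by
    obtain ⟨h1, h2⟩ := hDi η hη
    have h3 : Integrable fun y => D η (l * (y - x)) :=
      (h1.comp_mul_left' hl.ne').comp_sub_right x
    have h4 := integrable_absMeasure hg (.of_forall hQ) h3
    rw [← ofReal_integral_eq_lintegral_ofReal h4 (.of_forall fun y => hD0 η hη _)]
    refine ENNReal.ofReal_le_ofReal ?_
    rw [integral_absMeasure hg]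
    calc _ ≤ ∫ y, Q * D η (l * (y - x)) := by
          refine integral_mono_of_nonneg (.of_forall fun y => mul_nonneg (hD0 η hη _)
            (abs_nonneg _)) (h3.const_mul Q) (.of_forall fun y => ?_)
          simp only
          rw [mul_comm]
          exact mul_le_mul_of_nonneg_right (hQ y) (hD0 η hη _)
      _ = Q * (l⁻¹ * ∫ s, D η s) := by
          rw [integral_const_mul, integral_sub_right_eq_self (fun y => D η (l * y)) x,
            Measure.integral_comp_mul_left, smul_eq_mul, abs_of_pos (inv_pos.2 hl)]
      _ ≤ Q * (B / l) := by
          rw [div_eq_inv_mul]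
          gcongr
  refine ⟨Q * (B / l), fun s hs t ht x => ?_⟩
  have hS0 : ∀ y, 0 ≤ secantWeight X k s t x y := fun y => by
    refine indicator_nonneg (fun y hy => secant_nonneg hmono ?_ ?_) y
    · exact sub_neg.2 (h.strictMono s hs hy)
    · exact sub_neg.2 (h.strictMono t ht hy)
  have hSm := h.measurable_secantWeight hkm hs ht x
  set η : ℕ → ℝ := fun n => 1 / ((n : ℝ) + 1)
  have hη : ∀ n, 0 < η n := fun n => by simp only [η]; positivity
  have hSD : ∀ y, ENNReal.ofReal (secantWeight X k s t x y) ≤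
      Filter.liminf (fun n => ENNReal.ofReal (D (η n) (l * (y - x)))) Filter.atTop := fun y => by
    refine Filter.le_liminf_of_le (by isBoundedDefault) ?_
    rcases lt_or_ge y x with hy | hy
    · set z := l * (y - x)
      have hz : z < 0 := mul_neg_of_pos_of_neg hl (sub_neg.2 hy)
      have hev : ∀ᶠ n in Filter.atTop, η n < -z :=
        (tendsto_one_div_add_atTop_nhds_zero_nat (𝕜 := ℝ)).eventually_lt_const (by linarith)
      filter_upwards [hev] with n hn
      refine ENNReal.ofReal_le_ofReal ?_
      rw [secantWeight, indicator_of_mem (mem_Iio.2 hy)]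
      have hzn : z + η n < 0 := by linarith
      have e : D (η n) z = secant k z (z + η n) := by
        simp only [D, N, secant]
        rw [if_pos hzn, if_pos hz, add_sub_cancel_left]
      rw [e]
      have ha := hX s hs x y hy
      have hb := hX t ht x y hy
      have ha' : X s y - X s x < 0 := sub_neg.2 (h.strictMono s hs hy)
      have hb' : X t y - X t x < 0 := sub_neg.2 (h.strictMono t ht hy)
      rcases eq_or_ne (X s y - X s x) (X t y - X t x) with he | he
      · rw [he, secant_self]
        exact secant_nonneg hmono hz hzn
      · exact secant_le_secant hconv ha' hb' hz hzn ha (by linarith [hη n]) he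
          (by linarith [hη n])
    · refine .of_forall fun n => ?_
      rw [secantWeight, indicator_of_notMem (by simpa using hy), ENNReal.ofReal_zero]
      exact zero_le
  have hDm : ∀ n, Measurable fun y => ENNReal.ofReal (D (η n) (l * (y - x))) := fun n => by
    have hNm := hN.measurable
    have : Measurable (D (η n)) := ((hNm.comp (measurable_id.add_const _)).sub hNm).div_const _
    exact (this.comp ((measurable_id.sub_const x).const_mul l)).ennreal_ofReal
  have hlint : ∫⁻ y, ENNReal.ofReal (secantWeight X k s t x y) ∂absMeasure g ≤
      ENNReal.ofReal (Q * (B / l)) := by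
    refine (lintegral_mono hSD).trans ((lintegral_liminf_le hDm).trans ?_)
    refine Filter.liminf_le_of_frequently_le' (Filter.Frequently.of_forall fun n => ?_)
    exact hDx _ (hη n) x
  have hSi : Integrable (secantWeight X k s t x) (absMeasure g) := by
    refine ⟨hSm.aestronglyMeasurable, ?_⟩
    rw [hasFiniteIntegral_iff_ofReal (.of_forall hS0)]
    exact hlint.trans_lt ENNReal.ofReal_lt_top
  refine ⟨hSi, ?_⟩
  rw [integral_eq_lintegral_of_nonneg_ae (.of_forall hS0) hSm.aestronglyMeasurable]
  exact ENNReal.toReal_le_of_le_ofReal (by positivity) hlint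

/-- The velocity is an increasing Lipschitz function of the nonlocal term. -/
theorem velocity_sub (h : IsLagrangianSolution V κ g T M C ρ X v) (hV : IsVelocity V) {R : ℝ}
    {K : ℝ≥0} (hK : LipschitzOnWith K V (Icc 0 R)) {r : ℝ}
    (hR : ∀ x, conv κ (ρ r) x ∈ Icc 0 R) (x y : ℝ)
    (hxy : conv κ (ρ r) (X r x) ≤ conv κ (ρ r) (X r y)) :
    0 ≤ v r y - v r x ∧ v r y - v r x ≤ K * (conv κ (ρ r) (X r y) - conv κ (ρ r) (X r x)) := by
  rw [h.velocity, h.velocity]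
  have h1 := hV.monotone (hR (X r x)).1 (hR (X r y)).1 hxy
  refine ⟨sub_nonneg.2 h1, ?_⟩
  have h2 := hK.dist_le_mul _ (hR (X r y)) _ (hR (X r x))
  rwa [Real.dist_eq, Real.dist_eq, abs_of_nonneg (sub_nonneg.2 h1),
    abs_of_nonneg (sub_nonneg.2 hxy)] at h2

theorem conv_mem_Icc (h : IsLagrangianSolution V κ g T M C ρ X v) {k : ℝ → ℝ}
    (hki : Integrable k) (hk0 : ∀ s, 0 ≤ k s) (t x : ℝ) :
    conv k (ρ t) x ∈ Icc 0 (M * ∫ s, k s) := by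
  refine ⟨conv_nonneg hk0 (h.nonneg t) x, (le_abs_self _).trans ?_⟩
  have := abs_conv_le hki (h.bdd t) x
  simpa only [abs_of_nonneg (hk0 _)] using this

/-- The particle system that belongs to a monotone kernel. -/
theorem isParticleSystem (h : IsLagrangianSolution V κ g T M C ρ X v) {k : ℝ → ℝ} {K : ℝ}
    (hkm : Measurable k) (hki : Integrable k) (hk0 : ∀ s, 0 ≤ k s)
    (hz : ∀ s, 0 ≤ s → k s = 0) (hmono : MonotoneOn k (Iio 0))
    (hK : ∀ s ∈ Icc 0 T, ∀ t ∈ Icc 0 T, ∀ x, Integrable (secantWeight X k s t x) (absMeasure g) ∧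
      ∫ y, secantWeight X k s t x y ∂absMeasure g ≤ K) :
    IsParticleSystem (absMeasure g) X v k T C K (M * ∫ s, k s) where
  strictMono := h.strictMono
  cont := h.cont
  bound t _ x := h.bound t x
  sub_eq := h.sub_eq
  zero := hz
  mono := hmono
  integrable t ht x := h.integrable t ht k hkm hki _
  integrable_secant s hs t ht x := (hK s hs t ht x).1
  integral_secant_le s hs t ht x := (hK s hs t ht x).2
  potential_le t ht x := by
    rw [h.potential_eq hkm ht]
    have := h.conv_mem_Icc hki hk0 t (X t x)
    rw [abs_of_nonneg this.1]
    exact this.2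

/-- The potential of the kernel is the nonlocal term itself, so the comparison error `θ` is `0`, the
exponentials equal `1`, and the initial bounds persist. -/
theorem bounds_of_convexOn (h : IsLagrangianSolution V κ g T M C ρ X v) (hV : IsVelocity V)
    (hT : 0 ≤ T) {Q A B : ℝ} (hQ : ∀ x, |g x| ≤ Q) (hA : VarLe g A)
    (hκm : Measurable κ) (hκi : Integrable κ) (hκ0 : ∀ s, 0 ≤ κ s) (hz : ∀ s, 0 ≤ s → κ s = 0)
    (hmono : MonotoneOn κ (Iio 0)) (hconv : ConvexOn ℝ (Iio 0) κ) (hB : ∀ s, κ s ≤ B)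
    (hmass : ∫ s, κ s = 1) {t : ℝ} (ht : t ∈ Icc 0 T) :
    (∀ x, conv κ (ρ t) x ≤ Q) ∧ VarLe (conv κ (ρ t)) A := by
  have hg := hA.measurable
  obtain ⟨K, hK⟩ := h.exists_secant_mass hg hQ hκm hmono hconv hκ0 hB
  have hP := h.isParticleSystem hκm hκi hκ0 hz hmono hK
  obtain ⟨L, hL⟩ := hV.lipschitz (M * ∫ s, κ s)
  have h0 : (0 : ℝ) ∈ Icc 0 T := ⟨le_rfl, hT⟩
  have hv := fun r (_ : r ∈ Icc 0 T) x y hxy =>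
    h.velocity_sub hV hL (h.conv_mem_Icc hκi hκ0 r) x y hxy
  have hQ0 : 0 ≤ Q := (abs_nonneg _).trans (hQ 0)
  constructor
  · intro z
    obtain ⟨x, rfl⟩ := h.surjective t ht z
    have := hP.potential_le_exp (w := fun r x => conv κ (ρ r) (X r x)) (L := L) (θ := 0) (Q := Q)
      L.2 le_rfl hQ0 hv (fun r hr B _ x => by rw [h.potential_eq hκm hr]; simp) (fun x => by
        rw [h.potential_eq hκm h0]
        simpa only [hmass, mul_one] using h.conv_zero_le hT hg hQ hκm hκi hκ0 (X 0 x)) ht x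
    rw [h.potential_eq hκm ht] at this
    simpa using this
  · refine h.varLe_conv ht ?_
    have := hP.varLe_potential hconv (w := fun r x => conv κ (ρ r) (X r x)) (L := L) (θ := 0)
      (V₀ := A) L.2 le_rfl hv (fun r hr N B _ x _ => by
        simp [varSum, h.potential_eq hκm hr]) (by
        have h1 := h.varLe_conv_zero hT hA hQ hκm hκi hκ0
        rw [hmass, mul_one] at h1
        intro x hx n
        simpa only [varSum, h.potential_eq hκm h0, h.init] using h1 x hx n) ht
    intro x hx n
    have := this x hx n
    simpa only [varSum, h.potential_eq hκm ht, mul_zero, zero_mul, Real.exp_zero,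
      mul_one] using this

end IsLagrangianSolution

/-! ### From uniform bounds to compactness -/

theorem IsBoundedTV.exists_varLe {q₀ : ℝ → ℝ} (h : IsBoundedTV q₀) :
    ∃ g A Q, q₀ =ᵐ[volume] g ∧ VarLe g A ∧ ∀ x, |g x| ≤ Q := by
  obtain ⟨g, hg, hbv⟩ := h.tv
  have hA := varLe_of_boundedVariationOn hbv
  refine ⟨g, _, |g 0| + (eVariationOn g univ).toReal, hg, hA, fun x => ?_⟩
  obtain ⟨N, hN, hNA, hf⟩ := hA.exists_monotone
  have key : |g x - g 0| ≤ (eVariationOn g univ).toReal := by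
    rcases le_total 0 x with hx | hx
    · exact (hf 0 x hx).trans (by linarith [(hNA x).2, (hNA 0).1])
    · rw [abs_sub_comm]
      exact (hf x 0 hx).trans (by linarith [(hNA 0).2, (hNA x).1])
  have := abs_sub_abs_le_abs_sub (g x) (g 0)
  linarith

/-- Uniform bounds on the nonlocal terms of all Lagrangian solutions imply relative compactness. -/
theorem isCompact_closure_nonlocalTerms {V q₀ g : ℝ → ℝ} {Γ : ℝ → ℝ → ℝ} {T ε Q S A : ℝ}
    (hT : 0 < T) (hV : IsVelocity V) (hg : Measurable g) (hQ : ∀ x, |g x| ≤ Q)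
    (hgq : q₀ =ᵐ[volume] g)
    (hk : ∀ η ∈ Ioo 0 ε, ∃ c, IsKernel ((Iio 0).indicator (Γ η)) c)
    (hbd : ∀ η ∈ Ioo 0 ε, ∀ M C ρ X v,
      IsLagrangianSolution V ((Iio 0).indicator (Γ η)) g T M C ρ X v → ∀ t ∈ Icc 0 T,
      (∀ x, conv ((Iio 0).indicator (Γ η)) (ρ t) x ≤ S) ∧
        VarLe (conv ((Iio 0).indicator (Γ η)) (ρ t)) A) :
    (∀ η ∈ Ioo 0 ε, ∀ q : C(Icc (0 : ℝ) T, L1Loc), IsWeakSolution V (Γ η) q₀ T q →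
      ∃ w : C(Icc (0 : ℝ) T, L1Loc), IsNonlocalTerm (Γ η) q w) ∧
    IsCompact (closure (nonlocalTerms V Γ q₀ T ε)) := by
  obtain ⟨K, hK⟩ := hV.lipschitz S
  refine ⟨fun η hη q hq => ?_, ?_⟩
  · obtain ⟨c, hc⟩ := hk η hη
    obtain ⟨M, -, hM⟩ := hq.exists_bound hT
    exact exists_isNonlocalTerm hM hc
  have hW : ∀ w ∈ nonlocalTerms V Γ q₀ T ε, ∃ W : ℝ → ℝ → ℝ,
      (∀ t : Icc (0 : ℝ) T, (fun x => w t x) =ᵐ[volume] W t) ∧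
      (∀ t ∈ Icc 0 T, ∀ x, |W t x| ≤ S) ∧ (∀ t ∈ Icc 0 T, VarLe (W t) A) ∧
      ∀ s ∈ Icc 0 T, ∀ t ∈ Icc 0 T, ∀ a b, a ≤ b →
        |∫ x in a..b, (W t x - W s x)| ≤ 4 * (|V 0| + K * S) * S * |t - s| := by
    rintro w ⟨η, hη, q, hq, hw⟩
    obtain ⟨c, hc⟩ := hk η hη
    obtain ⟨M, C, X, v, h⟩ := hq.exists_isLagrangianSolution hT hV hc hg hQ hgq
    have hb := hbd η hη _ _ _ _ _ h
    set κ := (Iio (0 : ℝ)).indicator (Γ η)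
    set ρ : ℝ → ℝ → ℝ := fun t y => |q (projIcc 0 T hT.le t) y|
    have h0 : ∀ t x, 0 ≤ conv κ (ρ t) x := fun t x => conv_nonneg hc.nonneg (h.nonneg t) x
    refine ⟨fun t => conv κ (ρ t), fun t => ?_, fun t ht x => ?_, fun t ht => (hb t ht).2,
      fun s hs t ht a b hab => ?_⟩
    · filter_upwards [hw t] with x hx
      rw [hx, nonlocalTerm_eq_conv]
      simp only [ρ, projIcc_val]
      rfl
    · rw [abs_of_nonneg (h0 t x)]
      exact (hb t ht).1 x
    · refine h.abs_integral_conv_sub_le hc.measurable hc.integrable hc.nonneg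
        (fun t ht x => (hb t ht).1 x) (fun t ht x => ?_)
        (fun t ht => continuous_conv hc (h.meas t).aestronglyMeasurable (h.bdd t)) hs ht hab
      rw [h.velocity]
      set z := conv κ (ρ t) (X t x)
      have hz : z ∈ Icc 0 S := ⟨h0 _ _, (hb t ht).1 _⟩
      have h1 := hK.dist_le_mul _ hz 0 ⟨le_rfl, hz.1.trans hz.2⟩
      rw [Real.dist_eq, Real.dist_eq, sub_zero, abs_of_nonneg hz.1] at h1
      have h2 : (K : ℝ) * z ≤ K * S := mul_le_mul_of_nonneg_left hz.2 K.2
      have h3 := abs_sub_abs_le_abs_sub (V z) (V 0)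
      linarith
  refine isCompact_closure_of_varLe (M := S) (A := A) (C := 4 * (|V 0| + K * S) * S) _
    (fun w hw t => ?_) fun w hw s t a b hab => ?_
  · obtain ⟨W, h1, h2, h3, -⟩ := hW w hw
    exact ⟨W t, h1 t, h2 t t.2, h3 t t.2⟩
  · obtain ⟨W, h1, -, -, h4⟩ := hW w hw
    have e : ∫ x in a..b, (w t x - w s x) = ∫ x in a..b, (W t x - W s x) := by
      refine intervalIntegral.integral_congr_ae ?_
      filter_upwards [h1 t, h1 s] with x hx1 hx2 _
      rw [hx1, hx2]
    rw [e]
    exact h4 s s.2 t t.2 a b hab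

/-! ### Rescaled convex kernels -/

theorem indicator_rescale {γ : ℝ → ℝ} {η : ℝ} (hη : 0 < η) (x : ℝ) :
    (Iio 0).indicator (rescale γ η) x = (Iio 0).indicator γ (x / η) / η := by
  by_cases hx : x < 0
  · rw [indicator_of_mem (mem_Iio.2 hx), indicator_of_mem (mem_Iio.2 (div_neg_of_neg_of_pos hx hη)),
      rescale]
  · rw [indicator_of_notMem (by simpa using hx), indicator_of_notMem, zero_div]
    rw [mem_Iio, not_lt]
    exact div_nonneg (not_lt.1 hx) hη.le

theorem IsConvexKernel.bounds {V γ g : ℝ → ℝ} (hγ : IsConvexKernel γ) (hV : IsVelocity V)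
    {T Q A η : ℝ} (hT : 0 ≤ T) (hη : 0 < η) (hQ : ∀ x, |g x| ≤ Q) (hA : VarLe g A) :
    (∃ c, IsKernel ((Iio 0).indicator (rescale γ η)) c) ∧
    ∀ M C ρ X v, IsLagrangianSolution V ((Iio 0).indicator (rescale γ η)) g T M C ρ X v →
      ∀ t ∈ Icc 0 T, (∀ x, conv ((Iio 0).indicator (rescale γ η)) (ρ t) x ≤ Q) ∧
        VarLe (conv ((Iio 0).indicator (rescale γ η)) (ρ t)) A := by
  set κ := (Iio (0 : ℝ)).indicator (rescale γ η) with hκ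
  have hdiv : ∀ {x : ℝ}, x < 0 → x / η < 0 := fun hx => div_neg_of_neg_of_pos hx hη
  have hval : ∀ {x : ℝ}, x < 0 → κ x = γ (x / η) / η := fun hx =>
    indicator_of_mem (mem_Iio.2 hx) _
  have hz : ∀ s, 0 ≤ s → κ s = 0 := fun s hs => indicator_of_notMem (by simpa using hs) _
  have h0 : ∀ s, 0 ≤ κ s := fun s => by
    rcases lt_or_ge s 0 with hs | hs
    · rw [hval hs]
      exact div_nonneg (hγ.nonneg _ (hdiv hs).le) hη.le
    · rw [hz s hs]
  have hmono : MonotoneOn κ (Iio 0) := fun x hx y hy hxy => by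
    rw [hval hx, hval hy]
    exact div_le_div_of_nonneg_right (hγ.monotone (hdiv hx).le (hdiv hy).le
      (div_le_div_of_nonneg_right hxy hη.le)) hη.le
  have hB : ∀ s, κ s ≤ γ 0 / η := fun s => by
    rcases lt_or_ge s 0 with hs | hs
    · rw [hval hs]
      exact div_le_div_of_nonneg_right (hγ.monotone (hdiv hs).le (mem_Iic.2 le_rfl) (hdiv hs).le)
        hη.le
    · rw [hz s hs]
      exact div_nonneg (hγ.nonneg 0 le_rfl) hη.le
  have hconv : ConvexOn ℝ (Iio 0) κ := by
    refine ⟨convex_Iio 0, fun x hx y hy a b ha hb hab => ?_⟩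
    have hxy : a • x + b • y ∈ Iio (0 : ℝ) := convex_Iio 0 hx hy ha hb hab
    rw [hval hx, hval hy, hval hxy]
    have := hγ.convex.2 (hdiv hx).le (hdiv hy).le ha hb hab
    simp only [smul_eq_mul] at this ⊢
    rw [mul_div_assoc', mul_div_assoc', ← add_div]
    refine div_le_div_of_nonneg_right ?_ hη.le
    convert this using 2
    ring
  have hγi : Integrable ((Iio (0 : ℝ)).indicator γ) :=
    (integrable_indicator_iff measurableSet_Iio).2 (hγ.integrable.mono_set Iio_subset_Iic_self)
  have hκe : κ = fun x => (Iio (0 : ℝ)).indicator γ (x / η) / η := funext (indicator_rescale hη)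
  have hki : Integrable κ := by
    rw [hκe]
    exact (hγi.comp_div hη.ne').div_const η
  have hmass : ∫ s, κ s = 1 := by
    rw [hκe, integral_div, Measure.integral_comp_div (fun x => (Iio (0 : ℝ)).indicator γ x),
      integral_indicator measurableSet_Iio, ← integral_Iic_eq_integral_Iio, hγ.mass,
      abs_of_pos hη, smul_eq_mul, mul_one, div_self hη.ne']
  have hk := (varLe_of_monotoneOn hmono h0 hz hB).isKernel h0 hz hki
  exact ⟨⟨_, hk⟩, fun M C ρ X v h t ht =>
    h.bounds_of_convexOn hV hT hQ hA hk.measurable hki h0 hz hmono hconv hB hmass ht⟩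

/-! ### The exponential kernel -/

/-- The kernel `α exp(α s)` on `(-∞, 0)`. -/
def expKernel (α : ℝ) : ℝ → ℝ := (Iio 0).indicator fun s => α * Real.exp (α * s)

section expKernel

variable {α : ℝ}

theorem expKernel_of_neg {s : ℝ} (hs : s < 0) : expKernel α s = α * Real.exp (α * s) :=
  indicator_of_mem (mem_Iio.2 hs) _

theorem expKernel_of_nonneg {s : ℝ} (hs : 0 ≤ s) : expKernel α s = 0 :=
  indicator_of_notMem (by simpa using hs) _

theorem expKernel_nonneg (hα : 0 ≤ α) (s : ℝ) : 0 ≤ expKernel α s :=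
  indicator_nonneg (fun _ _ => by positivity) _

theorem expKernel_le (hα : 0 ≤ α) (s : ℝ) : expKernel α s ≤ α := by
  rcases lt_or_ge s 0 with hs | hs
  · rw [expKernel_of_neg hs]
    exact mul_le_of_le_one_right hα (Real.exp_le_one_iff.2 (mul_nonpos_of_nonneg_of_nonpos hα hs.le))
  · rw [expKernel_of_nonneg hs]
    exact hα

theorem monotoneOn_expKernel (hα : 0 ≤ α) : MonotoneOn (expKernel α) (Iio 0) :=
  fun x hx y hy hxy => by
    rw [expKernel_of_neg hx, expKernel_of_neg hy]
    gcongr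

theorem convexOn_expKernel (hα : 0 ≤ α) : ConvexOn ℝ (Iio 0) (expKernel α) := by
  have h1 : ConvexOn ℝ (Iio 0) fun s : ℝ => α * Real.exp (α * s) := by
    have h2 : ConvexOn ℝ univ fun s : ℝ => Real.exp (α * s) := by
      have := convexOn_exp.comp_linearMap (LinearMap.lsmul ℝ ℝ α)
      simpa [Function.comp_def] using! this
    exact (h2.smul hα).subset (subset_univ _) (convex_Iio 0)
  exact h1.congr fun s hs => (expKernel_of_neg hs).symm

theorem integrable_expKernel (hα : 0 < α) : Integrable (expKernel α) := by
  refine (integrable_indicator_iff measurableSet_Iio).2 ?_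
  exact ((integrableOn_exp_mul_Iic hα 0).mono_set Iio_subset_Iic_self).const_mul α

theorem integral_expKernel (hα : 0 < α) : ∫ s, expKernel α s = 1 := by
  rw [expKernel, integral_indicator measurableSet_Iio, ← integral_Iic_eq_integral_Iio,
    integral_const_mul, integral_exp_mul_Iic hα]
  simp [hα.ne']

theorem isKernel_expKernel (hα : 0 < α) : IsKernel (expKernel α) (2 * α) :=
  (varLe_of_monotoneOn (monotoneOn_expKernel hα.le) (expKernel_nonneg hα.le)
    (fun _ => expKernel_of_nonneg) (expKernel_le hα.le)).isKernel (expKernel_nonneg hα.le)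
    (fun _ => expKernel_of_nonneg) (integrable_expKernel hα)

theorem integral_expKernel_primitive (hα : 0 < α) (z : ℝ) :
    ∫ s in (0 : ℝ)..z, expKernel α s = expKernel α z / α - (Iio 0).indicator 1 z := by
  rcases lt_or_ge z 0 with hz | hz
  · rw [expKernel_of_neg hz, indicator_of_mem (mem_Iio.2 hz), Pi.one_apply,
      mul_div_cancel_left₀ _ hα.ne']
    have e : ∫ s in (0 : ℝ)..z, expKernel α s = ∫ s in (0 : ℝ)..z, α * Real.exp (α * s) := by
      refine intervalIntegral.integral_congr_ae ?_
      have : ∀ᵐ s : ℝ, s ≠ 0 := by simp [ae_iff, measure_singleton]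
      filter_upwards [this] with s hs0 hs
      rw [uIoc_of_ge hz.le] at hs
      exact expKernel_of_neg (lt_of_le_of_ne hs.2 hs0)
    rw [e, intervalIntegral.integral_eq_sub_of_hasDerivAt (f := fun s => Real.exp (α * s))]
    · simp
    · intro s _
      have := ((hasDerivAt_id s).const_mul α).exp
      simpa [mul_comm] using this
    · exact (by fun_prop : Continuous fun s => α * Real.exp (α * s)).intervalIntegrable _ _
  · rw [expKernel_of_nonneg hz, indicator_of_notMem (by simpa using hz), zero_div, sub_zero]
    rw [intervalIntegral.integral_congr (g := fun _ => 0), intervalIntegral.integral_zero]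
    intro s hs
    rw [uIcc_of_le hz] at hs
    exact expKernel_of_nonneg hs.1

/-- The density is recovered from its exponential average: `ρ = W + W' / α`. -/
theorem integral_eq_integral_conv_expKernel (hα : 0 < α) {ρ : ℝ → ℝ} {M : ℝ} (hρ : Measurable ρ)
    (hM : ∀ᵐ x, |ρ x| ≤ M) {a b : ℝ} (hab : a ≤ b) :
    ∫ x in a..b, ρ x = (∫ x in a..b, conv (expKernel α) ρ x) +
      (conv (expKernel α) ρ b - conv (expKernel α) ρ a) / α := by
  have hk := isKernel_expKernel hα
  have hii : ∀ a b, IntervalIntegrable (expKernel α) volume a b := fun a b =>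
    hk.integrable.intervalIntegrable
  have hin : ∀ y, ∫ x in a..b, expKernel α (y - x) = (Ico a b).indicator 1 y +
      (expKernel α (y - a) / α - expKernel α (y - b) / α) := fun y => by
    rw [intervalIntegral.integral_comp_sub_left (fun x => expKernel α x),
      ← intervalIntegral.integral_interval_sub_left (hii 0 _) (hii 0 _),
      integral_expKernel_primitive hα, integral_expKernel_primitive hα]
    have : (Ico a b).indicator (1 : ℝ → ℝ) y =
        (Iio 0).indicator 1 (y - b) - (Iio 0).indicator 1 (y - a) := by
      by_cases h1 : a ≤ y <;> by_cases h2 : y < b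
      · rw [indicator_of_mem (show y ∈ Ico a b from ⟨h1, h2⟩),
          indicator_of_mem (by simpa using h2), indicator_of_notMem (by simpa using h1)]
        simp
      · rw [indicator_of_notMem (fun h => h2 h.2), indicator_of_notMem (by simpa using h2),
          indicator_of_notMem (by simpa using h1)]
        simp
      · rw [indicator_of_notMem (fun h => h1 h.1), indicator_of_mem (by simpa using h2),
          indicator_of_mem (by simpa using h1)]
        simp
      · exact absurd ((not_le.1 h1).trans_le hab) h2
    rw [this]
    ring
  have hi : ∀ c, Integrable fun y => expKernel α (y - c) / α * ρ y := fun c => by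
    have := (integrable_conv hk.integrable hρ.aestronglyMeasurable hM c).div_const α
    refine this.congr (.of_forall fun y => ?_)
    simp only
    ring
  have hi0 : Integrable fun y => (Ico a b).indicator 1 y * ρ y := by
    have h1 : Integrable ((Ico a b).indicator (1 : ℝ → ℝ)) :=
      (integrable_indicator_iff measurableSet_Ico).2 (integrableOn_const (by simp))
    simpa only [mul_comm] using h1.bdd_mul hρ.aestronglyMeasurable hM
  have hc : ∀ c, ∫ y, expKernel α (y - c) / α * ρ y = conv (expKernel α) ρ c / α := fun c => by
    rw [conv, ← integral_div]
    congr 1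
    ext y
    ring
  rw [integral_conv hk.measurable hk.integrable hρ.aestronglyMeasurable hM hab]
  simp only [hin, add_mul, sub_mul]
  have hi' : Integrable fun y => expKernel α (y - a) / α * ρ y - expKernel α (y - b) / α * ρ y :=
    (hi a).sub (hi b)
  rw [integral_add hi0 hi', integral_sub (hi a) (hi b), hc, hc]
  have e : ∫ y, (Ico a b).indicator 1 y * ρ y = ∫ x in a..b, ρ x := by
    rw [intervalIntegral.integral_of_le hab, ← integral_Ico_eq_integral_Ioc,
      ← integral_indicator measurableSet_Ico]
    congr 1
    ext y
    by_cases hy : y ∈ Ico a b <;> simp [hy]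
  rw [e]
  ring

end expKernel

/-! ### Averages controlled by exponential averages -/

theorem integral_conv' {F ρ : ℝ → ℝ} {M : ℝ} (hFm : Measurable F) (hF : Integrable F)
    (hρ : Measurable ρ) (hM : ∀ᵐ x, |ρ x| ≤ M) {a b : ℝ} (hab : a ≤ b) :
    ∫ x in a..b, conv F ρ x = ∫ s, F s * ∫ x in a..b, ρ (s + x) := by
  have hm : AEStronglyMeasurable (fun p : ℝ × ℝ => F p.2 * ρ (p.2 + p.1))
      ((volume.restrict (Ioc a b)).prod volume) :=
    ((hFm.comp measurable_snd).mul
      (hρ.comp (measurable_snd.add measurable_fst))).aestronglyMeasurable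
  have hMx : ∀ x, ∀ᵐ s, |ρ (s + x)| ≤ M := fun x =>
    (measurePreserving_add_right volume x).quasiMeasurePreserving.ae hM
  have hFi : ∀ x, Integrable fun s => F s * ρ (s + x) := fun x => by
    simpa only [mul_comm] using hF.bdd_mul (f := fun s => ρ (s + x))
      (hρ.comp (measurable_id.add_const x)).aestronglyMeasurable (hMx x)
  have hint : Integrable (fun p : ℝ × ℝ => F p.2 * ρ (p.2 + p.1))
      ((volume.restrict (Ioc a b)).prod volume) := by
    rw [integrable_prod_iff hm]
    refine ⟨.of_forall hFi, ?_⟩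
    refine Integrable.of_bound hm.norm.integral_prod_right' (M * ∫ s, |F s|) (.of_forall fun x => ?_)
    rw [Real.norm_of_nonneg (integral_nonneg fun _ => norm_nonneg _), ← integral_const_mul]
    refine integral_mono_ae (hFi x).norm (hF.abs.const_mul M) ?_
    filter_upwards [hMx x] with s hs
    rw [norm_mul, mul_comm]
    exact mul_le_mul_of_nonneg_right hs (norm_nonneg _)
  rw [intervalIntegral.integral_of_le hab]
  simp only [conv_eq_integral_mul_add]
  rw [integral_integral_swap hint]
  congr 1
  ext s
  rw [integral_const_mul, intervalIntegral.integral_of_le hab]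

/-- `D z` is the limit of the means of `D` over `[z - h, z]`. This lets pointwise bounds be proved
in integrated form, where the density need not be differentiated or evaluated. -/
theorem abs_le_of_abs_integral_le {D : ℝ → ℝ} (hD : Continuous D) {R h₀ z : ℝ} (hh₀ : 0 < h₀)
    (h : ∀ h, 0 < h → h < h₀ → |∫ x in (z - h)..z, D x| ≤ R * h) : |D z| ≤ R := by
  have hd : HasDerivAt (fun y => ∫ x in z..y, D x) (D z) z :=
    (hD.integral_hasStrictDerivAt z z).hasDerivAt
  have ht := (hasDerivAt_iff_tendsto_slope_zero.1 hd).mono_left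
    (nhdsWithin_mono 0 (fun x (hx : x < 0) => ne_of_lt hx) : 𝓝[<] (0 : ℝ) ≤ 𝓝[≠] 0)
  refine le_of_tendsto ht.abs ?_
  filter_upwards [Ioo_mem_nhdsLT (show -h₀ < 0 by linarith)] with y hy
  have h1 := h (-y) (by linarith [hy.2]) (by linarith [hy.1])
  rw [sub_neg_eq_add, intervalIntegral.integral_symm, abs_neg] at h1
  rw [intervalIntegral.integral_same, sub_zero, smul_eq_mul, abs_mul, abs_inv,
    abs_of_neg hy.2, inv_mul_le_iff₀ (by linarith [hy.2])]
  linarith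

/-- An average against a kernel of small mass and small variation is controlled by the exponential
averages. -/
theorem abs_conv_le_expKernel {α : ℝ} (hα : 0 < α) {F ρ : ℝ → ℝ} {M c B h₀ : ℝ}
    (hFm : Measurable F) (hF : Integrable F) (hρ : Measurable ρ) (hM : ∀ᵐ x, |ρ x| ≤ M)
    (hcont : Continuous (conv F ρ)) (hh₀ : 0 < h₀)
    (hc : ∀ h, 0 < h → h < h₀ → ∫ s, |F (s + h) - F s| ≤ c * h)
    (hB : ∀ x, |conv (expKernel α) ρ x| ≤ B) (z : ℝ) :
    |conv F ρ z| ≤ ((∫ s, |F s|) + c / α) * B := by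
  have hB0 : 0 ≤ B := (abs_nonneg _).trans (hB 0)
  set W := conv (expKernel α) ρ
  have hWc : Continuous W := continuous_conv (isKernel_expKernel hα) hρ.aestronglyMeasurable hM
  have hWi : ∀ {G : ℝ → ℝ}, Integrable G → ∀ y, Integrable fun s => G s * W (s + y) :=
    fun hG y => by
      simpa only [mul_comm] using hG.bdd_mul (f := fun s => W (s + y))
        (hWc.comp (continuous_id.add continuous_const)).aestronglyMeasurable
        (.of_forall fun s => hB _)
  refine abs_le_of_abs_integral_le hcont hh₀ fun h hh hh' => ?_
  set I : ℝ → ℝ := fun s => ∫ x in (z - h)..z, W (s + x)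
  have hIb : ∀ s, ‖I s‖ ≤ B * h := fun s => by
    have := intervalIntegral.norm_integral_le_of_norm_le_const (a := z - h) (b := z)
      (f := fun x => W (s + x)) (C := B) fun x _ => hB _
    rwa [sub_sub_cancel, abs_of_pos hh] at this
  have hIc : Continuous I := by
    have hii : ∀ a b, IntervalIntegrable W volume a b := fun a b => hWc.intervalIntegrable _ _
    have hP := intervalIntegral.continuous_primitive hii 0
    have : I = fun s => (∫ x in (0 : ℝ)..(s + z), W x) - ∫ x in (0 : ℝ)..(s + (z - h)), W x := by
      ext s
      simp only [I]
      rw [intervalIntegral.integral_comp_add_left (fun x => W x),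
        intervalIntegral.integral_interval_sub_left (hii _ _) (hii _ _)]
    rw [this]
    exact (hP.comp (continuous_id.add continuous_const)).sub
      (hP.comp (continuous_id.add continuous_const))
  have hFI : Integrable fun s => F s * I s := by
    simpa only [mul_comm] using hF.bdd_mul hIc.aestronglyMeasurable (.of_forall hIb)
  have hFh : Integrable fun s => F (s + h) := hF.comp_add_right h
  -- A discrete integration by parts for `F ∗ ρ = F ∗ W + (F ∗ W') / α`: substituting `ρ = W + W' /
  -- α` in integrated form gives a difference of `W`, and a translation of the variable moves this
  -- difference onto `F`.
  have e1 : ∫ x in (z - h)..z, conv F ρ x = (∫ s, F s * I s) +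
      (∫ s, (F s - F (s + h)) * W (s + z)) / α := by
    rw [integral_conv' hFm hF hρ hM (by linarith)]
    have hin : ∀ s, ∫ x in (z - h)..z, ρ (s + x) = I s + (W (s + z) - W (s + (z - h))) / α :=
      fun s => by
        simp only [I]
        rw [intervalIntegral.integral_comp_add_left (fun x => ρ x),
          intervalIntegral.integral_comp_add_left (fun x => W x)]
        exact integral_eq_integral_conv_expKernel hα hρ hM (by linarith)
    have e2 : ∫ s, F s * W (s + (z - h)) = ∫ s, F (s + h) * W (s + z) := by
      rw [← integral_add_right_eq_self (fun s => F s * W (s + (z - h))) h]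
      congr 1
      ext s
      congr 2
      ring
    simp only [hin, mul_add]
    have e3 : ∀ s, F s * ((W (s + z) - W (s + (z - h))) / α) =
        (F s * W (s + z) - F s * W (s + (z - h))) / α := fun s => by ring
    simp only [e3]
    have hi : Integrable fun s => (F s * W (s + z) - F s * W (s + (z - h))) / α :=
      ((hWi hF z).sub (hWi hF (z - h))).div_const α
    rw [integral_add hFI hi, integral_div,
      integral_sub (hWi hF z) (hWi hF (z - h)), e2, ← integral_sub (hWi hF z) (hWi hFh z)]
    simp only [sub_mul]
  rw [e1]
  have b1 : |∫ s, F s * I s| ≤ (∫ s, |F s|) * (B * h) := by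
    rw [← integral_mul_const, ← Real.norm_eq_abs]
    refine (norm_integral_le_integral_norm _).trans (integral_mono hFI.norm
      (hF.abs.mul_const _) fun s => ?_)
    simp only [norm_mul]
    exact mul_le_mul_of_nonneg_left (hIb s) (norm_nonneg _)
  have b2 : |∫ s, (F s - F (s + h)) * W (s + z)| ≤ c * h * B := by
    refine le_trans ?_ (mul_le_mul_of_nonneg_right (hc h hh hh') hB0)
    rw [← integral_mul_const, ← Real.norm_eq_abs]
    refine (norm_integral_le_integral_norm _).trans (integral_mono (hWi (hF.sub hFh) z).norm
      ((hFh.sub hF).abs.mul_const _) fun s => ?_)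
    simp only [norm_mul]
    rw [abs_sub_comm]
    exact mul_le_mul_of_nonneg_left (hB _) (norm_nonneg _)
  calc _ ≤ |∫ s, F s * I s| + |(∫ s, (F s - F (s + h)) * W (s + z)) / α| := abs_add_le _ _
    _ ≤ (∫ s, |F s|) * (B * h) + c * h * B / α := by
        rw [abs_div, abs_of_pos hα]
        gcongr
    _ = _ := by ring

/-! ### Kernels close to the exponential kernel -/

/-- The difference of the kernels `κ` and `k` has small mass and, relative to `α`, small
variation. -/
def IsNear (κ k : ℝ → ℝ) (α θ : ℝ) : Prop :=
  ∃ h₀ > 0, ∃ c, (∀ h, 0 < h → h < h₀ →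
    ∫ s, |(κ (s + h) - k (s + h)) - (κ s - k s)| ≤ c * h) ∧ (∫ s, |κ s - k s|) + c / α ≤ θ

theorem IsNear.abs_conv_sub_le {κ k : ℝ → ℝ} {α θ c c' : ℝ} (h : IsNear κ k α θ) (hα : 0 < α)
    (hκ : IsKernel κ c) (hk : IsKernel k c') {ρ : ℝ → ℝ} {M B : ℝ} (hρ : Measurable ρ)
    (hM : ∀ᵐ x, |ρ x| ≤ M) (hB : ∀ x, |conv (expKernel α) ρ x| ≤ B) (z : ℝ) :
    |conv κ ρ z - conv k ρ z| ≤ θ * B := by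
  obtain ⟨h₀, hh₀, c₀, h1, h2⟩ := h
  have hB0 : 0 ≤ B := (abs_nonneg _).trans (hB 0)
  have e : conv (fun s => κ s - k s) ρ = fun z => conv κ ρ z - conv k ρ z := by
    ext z
    rw [conv, conv, conv, ← integral_sub (integrable_conv hκ.integrable hρ.aestronglyMeasurable hM z)
      (integrable_conv hk.integrable hρ.aestronglyMeasurable hM z)]
    simp only [sub_mul]
  have := abs_conv_le_expKernel hα (F := fun s => κ s - k s) (hκ.measurable.sub hk.measurable)
    (hκ.integrable.sub hk.integrable) hρ hM (by
      rw [e]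
      exact (continuous_conv hκ hρ.aestronglyMeasurable hM).sub
        (continuous_conv hk hρ.aestronglyMeasurable hM)) hh₀ h1 hB z
  rw [e] at this
  exact this.trans (mul_le_mul_of_nonneg_right h2 hB0)

theorem conv_sum_translate {k ρ : ℝ → ℝ} {M : ℝ} (hk : Integrable k) (hρ : Measurable ρ)
    (hM : ∀ᵐ x, |ρ x| ≤ M) (σ z z' : ℕ → ℝ) (N : ℕ) (x : ℝ) :
    conv k (fun y => ∑ i ∈ Finset.range N, σ i * (ρ (y + z' i) - ρ (y + z i))) x =
      ∑ i ∈ Finset.range N, σ i * (conv k ρ (z' i + x) - conv k ρ (z i + x)) := by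
  have hi : ∀ w, Integrable fun s => k s * ρ (s + w) := fun w => by
    simpa only [mul_comm] using hk.bdd_mul (f := fun s => ρ (s + w))
      (hρ.comp (measurable_id.add_const w)).aestronglyMeasurable
      ((measurePreserving_add_right volume w).quasiMeasurePreserving.ae hM)
  simp only [conv_eq_integral_mul_add]
  have e : ∀ s, k s * ∑ i ∈ Finset.range N, σ i * (ρ (s + x + z' i) - ρ (s + x + z i)) =
      ∑ i ∈ Finset.range N, σ i * (k s * ρ (s + (z' i + x)) - k s * ρ (s + (z i + x))) := by
    intro s
    rw [Finset.mul_sum]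
    refine Finset.sum_congr rfl fun i _ => ?_
    rw [show s + x + z' i = s + (z' i + x) by ring, show s + x + z i = s + (z i + x) by ring]
    ring
  simp only [e]
  have hi' : ∀ i ∈ Finset.range N, Integrable fun s =>
      σ i * (k s * ρ (s + (z' i + x)) - k s * ρ (s + (z i + x))) := fun i _ =>
    ((hi _).sub (hi _)).const_mul _
  rw [integral_finsetSum _ hi']
  refine Finset.sum_congr rfl fun i _ => ?_
  rw [integral_const_mul, integral_sub (hi _) (hi _)]

/-- By duality with signs, the variation of the difference is the value at `0` of the same
difference of averages for the density `∑ σ i (ρ(· + z (i+1)) - ρ(· + z i))`. The exponential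
average of that density is bounded by the variation of the exponential average of `ρ` along
translated partitions, so the sup estimate applies. -/
theorem IsNear.varSum_sub_le {κ k : ℝ → ℝ} {α θ c c' : ℝ} (h : IsNear κ k α θ) (hα : 0 < α)
    (hκ : IsKernel κ c) (hk : IsKernel k c') {ρ : ℝ → ℝ} {M B : ℝ} (hρ : Measurable ρ)
    (hM : ∀ᵐ x, |ρ x| ≤ M) {N : ℕ}
    (hB : ∀ z, Monotone z → varSum (conv (expKernel α) ρ) z N ≤ B) {z : ℕ → ℝ} (hz : Monotone z) :
    varSum (fun x => conv κ ρ x - conv k ρ x) z N ≤ θ * B := by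
  set d : ℝ → ℝ := fun x => conv κ ρ x - conv k ρ x
  set σ : ℕ → ℝ := fun i => if d (z i) ≤ d (z (i + 1)) then 1 else -1
  have hσ1 : ∀ i, |σ i| ≤ 1 := fun i => by
    simp only [σ]
    split_ifs <;> simp
  have hσ2 : ∀ i, σ i * (d (z (i + 1)) - d (z i)) = |d (z (i + 1)) - d (z i)| := fun i => by
    simp only [σ]
    split_ifs with hi
    · rw [one_mul, abs_of_nonneg (sub_nonneg.2 hi)]
    · rw [neg_one_mul, abs_of_nonpos (sub_nonpos.2 (not_le.1 hi).le)]
  set ρ' : ℝ → ℝ := fun y => ∑ i ∈ Finset.range N, σ i * (ρ (y + z (i + 1)) - ρ (y + z i))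
  have hρ'm : Measurable ρ' := Finset.measurable_fun_sum _ fun i _ =>
    ((hρ.comp (measurable_id.add_const _)).sub (hρ.comp (measurable_id.add_const _))).const_mul _
  have hMx : ∀ w, ∀ᵐ s, |ρ (s + w)| ≤ M := fun w =>
    (measurePreserving_add_right volume w).quasiMeasurePreserving.ae hM
  have hall : ∀ᵐ y, ∀ i, |ρ (y + z i)| ≤ M := ae_all_iff.2 fun i => hMx (z i)
  have hρ'M : ∀ᵐ y, |ρ' y| ≤ N * (2 * M) := by
    filter_upwards [hall] with y hy
    refine (Finset.abs_sum_le_sum_abs _ _).trans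
      ((Finset.sum_le_sum (g := fun _ => 2 * M) fun i _ => ?_).trans (by simp))
    rw [abs_mul]
    refine (mul_le_of_le_one_left (abs_nonneg _) (hσ1 i)).trans ((abs_sub _ _).trans ?_)
    linarith [hy i, hy (i + 1)]
  have hW : ∀ x, |conv (expKernel α) ρ' x| ≤ B := fun x => by
    rw [conv_sum_translate (integrable_expKernel hα) hρ hM]
    refine le_trans ?_ (hB (fun i => z i + x) fun i j hij => by simpa using hz hij)
    refine (Finset.abs_sum_le_sum_abs _ _).trans (Finset.sum_le_sum fun i _ => ?_)
    rw [abs_mul]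
    exact mul_le_of_le_one_left (abs_nonneg _) (hσ1 i)
  have := h.abs_conv_sub_le hα hκ hk hρ'm hρ'M hW 0
  rw [conv_sum_translate hκ.integrable hρ hM, conv_sum_translate hk.integrable hρ hM,
    ← Finset.sum_sub_distrib] at this
  refine le_trans (le_of_eq ?_) ((le_abs_self _).trans this)
  refine Finset.sum_congr rfl fun i _ => ?_
  rw [← hσ2]
  simp only [add_zero, d]
  ring

/-- A kernel of unit mass that is close to the exponential kernel, and very close to a monotone
kernel with controlled secant slopes. -/
structure IsNearExponential (κ : ℝ → ℝ) (α θ Λ θ' : ℝ) : Prop where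
  pos : 0 < α
  kernel : ∃ c, IsKernel κ c
  mass : ∫ s, κ s = 1
  near : IsNear κ (expKernel α) α θ
  small : θ ≤ 1 / 2
  approx : ∃ k c, IsKernel k c ∧ (∀ s, k s ≤ κ s) ∧ MonotoneOn k (Iio 0) ∧
    (∀ a < 0, ∀ b < 0, secant k a b ≤ Λ * (κ a + κ b)) ∧ IsNear κ k α θ'
  small' : θ' ≤ 1 / 8

theorem IsNear.nonneg {κ k : ℝ → ℝ} {α θ : ℝ} (h : IsNear κ k α θ) (hα : 0 < α) : 0 ≤ θ := by
  obtain ⟨h₀, hh₀, c, h1, h2⟩ := h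
  have hc : 0 ≤ c := by
    have := (integral_nonneg fun s => abs_nonneg _).trans (h1 (h₀ / 2) (by linarith) (by linarith))
    exact nonneg_of_mul_nonneg_left this (by linarith)
  exact le_trans (add_nonneg (integral_nonneg fun _ => abs_nonneg _) (div_nonneg hc hα.le)) h2

/-- A bounded nonnegative function that satisfies `f ≤ B + r sup f` with `r < 1`. -/
theorem le_of_le_add_mul_sup {f : ℝ → ℝ} {B r R : ℝ} (hr1 : r ≤ 1 / 2)
    (hR : ∀ x, f x ≤ R) (h : ∀ S, (∀ x, f x ≤ S) → ∀ x, f x ≤ B + r * S) (x : ℝ) :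
    f x ≤ B / (1 - r) := by
  set S := sSup (range f)
  have hb : BddAbove (range f) := ⟨R, by rintro _ ⟨x, rfl⟩; exact hR x⟩
  have hS : ∀ x, f x ≤ S := fun x => le_csSup hb ⟨x, rfl⟩
  have h1 : S ≤ B + r * S := csSup_le (range_nonempty f) (by rintro _ ⟨x, rfl⟩; exact h S hS x)
  refine (hS x).trans ?_
  rw [le_div_iff₀ (by linarith)]
  linarith

/-- The slope is at most the derivative at the right endpoint, which is `α` times the kernel there;
adding both endpoints makes the bound symmetric. -/
theorem secant_expKernel_le {α : ℝ} (hα : 0 ≤ α) {a b : ℝ} (ha : a < 0) (hb : b < 0) :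
    secant (expKernel α) a b ≤ α * (expKernel α a + expKernel α b) := by
  have key : ∀ {a b : ℝ}, a < 0 → b < 0 → a < b →
      secant (expKernel α) a b ≤ α * (expKernel α a + expKernel α b) := by
    intro a b ha hb hab
    rw [secant, div_le_iff₀ (sub_pos.2 hab), expKernel_of_neg ha, expKernel_of_neg hb]
    have h1 : Real.exp (α * b) - Real.exp (α * a) ≤ Real.exp (α * b) * (α * (b - a)) := by
      have h2 := Real.add_one_le_exp (-(α * (b - a)))
      have h3 : Real.exp (α * a) = Real.exp (α * b) * Real.exp (-(α * (b - a))) := by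
        rw [← Real.exp_add]; congr 1; ring
      rw [h3]
      nlinarith [Real.exp_pos (α * b)]
    have h4 : 0 ≤ α * (α * Real.exp (α * a)) * (b - a) := by
      have := sub_pos.2 hab
      positivity
    nlinarith
  rcases lt_trichotomy a b with h | h | h
  · exact key ha hb h
  · rw [h, secant_self]
    have := expKernel_nonneg hα b
    positivity
  · rw [secant_comm, add_comm]
    exact key hb ha h

/-! ### A priori bounds for nearly exponential kernels -/

namespace IsLagrangianSolution

variable {V κ g : ℝ → ℝ} {T M C : ℝ} {ρ X v : ℝ → ℝ → ℝ}

theorem mono (h : IsLagrangianSolution V κ g T M C ρ X v) {T' : ℝ} (hT' : T' ≤ T) :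
    IsLagrangianSolution V κ g T' M C ρ X v := by
  have hs : Icc 0 T' ⊆ Icc 0 T := Icc_subset_Icc_right hT'
  obtain ⟨l, hl, hX⟩ := h.lower
  exact ⟨h.meas, h.nonneg, h.bdd, h.init, fun t ht => h.strictMono t (hs ht),
    fun t ht => h.surjective t (hs ht), ⟨l, hl, fun t ht => hX t (hs ht)⟩, h.cont, h.bound,
    fun x s hs' t ht => h.sub_eq x s (hs hs') t (hs ht), h.velocity,
    fun t ht => h.conv_eq t (hs ht), fun t ht => h.integrable t (hs ht)⟩

/-- Secant slopes dominated by a kernel `K` have a mass dominated by the averages against `K`. -/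
theorem secant_mass_le (h : IsLagrangianSolution V κ g T M C ρ X v) {k K : ℝ → ℝ} {c c' Λ S : ℝ}
    (hk : IsKernel k c) (hmono : MonotoneOn k (Iio 0)) (hK : IsKernel K c') (hΛ : 0 ≤ Λ)
    (hsec : ∀ a < 0, ∀ b < 0, secant k a b ≤ Λ * (K a + K b))
    (hS : ∀ t ∈ Icc 0 T, ∀ x, conv K (ρ t) x ≤ S) {s t : ℝ} (hs : s ∈ Icc 0 T)
    (ht : t ∈ Icc 0 T) (x : ℝ) : Integrable (secantWeight X k s t x) (absMeasure g) ∧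
      ∫ y, secantWeight X k s t x y ∂absMeasure g ≤ 2 * Λ * S := by
  have hneg : ∀ r ∈ Icc 0 T, ∀ {y}, y < x → X r y - X r x < 0 := fun r hr y hy =>
    sub_neg.2 (h.strictMono r hr hy)
  have hi : ∀ r ∈ Icc 0 T, Integrable (fun y => K (X r y - X r x)) (absMeasure g) := fun r hr =>
    h.integrable r hr K hK.measurable hK.integrable _
  have h0 : ∀ y, 0 ≤ secantWeight X k s t x y := fun y =>
    indicator_nonneg (fun y hy => secant_nonneg hmono (hneg s hs hy) (hneg t ht hy)) y
  have hle : ∀ y, secantWeight X k s t x y ≤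
      Λ * (K (X s y - X s x) + K (X t y - X t x)) := fun y => by
    rcases lt_or_ge y x with hy | hy
    · rw [secantWeight, indicator_of_mem (mem_Iio.2 hy)]
      exact hsec _ (hneg s hs hy) _ (hneg t ht hy)
    · rw [secantWeight, indicator_of_notMem (by simpa using hy)]
      exact mul_nonneg hΛ (add_nonneg (hK.nonneg _) (hK.nonneg _))
  have hI : Integrable (secantWeight X k s t x) (absMeasure g) :=
    (((hi s hs).add (hi t ht)).const_mul Λ).mono'
      (h.measurable_secantWeight hk.measurable hs ht x).aestronglyMeasurable
      (.of_forall fun y => by rw [Real.norm_of_nonneg (h0 y)]; exact hle y)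
  refine ⟨hI, ?_⟩
  calc _ ≤ ∫ y, Λ * (K (X s y - X s x) + K (X t y - X t x)) ∂absMeasure g :=
        integral_mono hI (((hi s hs).add (hi t ht)).const_mul Λ) hle
    _ = Λ * (conv K (ρ s) (X s x) + conv K (ρ t) (X t x)) := by
        rw [integral_const_mul, integral_add (hi s hs) (hi t ht), h.conv_eq s hs K hK.measurable,
          h.conv_eq t ht K hK.measurable]
    _ ≤ Λ * (S + S) := by
        gcongr
        · exact hS s hs _
        · exact hS t ht _
    _ = _ := by ring

/-- Absorption: the exponential average exceeds the average against `κ` by at most `θ` times its own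
supremum, with `θ ≤ 1/2`. Boundedness is known beforehand, though not uniformly, so the supremum is
finite. -/
theorem conv_expKernel_le (h : IsLagrangianSolution V κ g T M C ρ X v) {α θ Λ θ' : ℝ}
    (hκ : IsNearExponential κ α θ Λ θ') {t B : ℝ} (hB : ∀ x, conv κ (ρ t) x ≤ B) (x : ℝ) :
    conv (expKernel α) (ρ t) x ≤ 2 * B := by
  obtain ⟨c, hc⟩ := hκ.kernel
  have hα := hκ.pos
  have he := isKernel_expKernel hα
  have hB0 : 0 ≤ B := (conv_nonneg hc.nonneg (h.nonneg t) 0).trans (hB 0)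
  have h0 : ∀ x, 0 ≤ conv (expKernel α) (ρ t) x := conv_nonneg he.nonneg (h.nonneg t)
  have := le_of_le_add_mul_sup (f := conv (expKernel α) (ρ t)) (B := B) (r := θ)
    hκ.small (fun x => (h.conv_mem_Icc he.integrable he.nonneg t x).2)
    (fun S hS x => by
      have h1 := abs_le.1 (hκ.near.abs_conv_sub_le hα hc he (h.meas t) (h.bdd t) (B := S)
        (fun x => by rw [abs_of_nonneg (h0 x)]; exact hS x) x)
      linarith [h1.1, hB x]) x
  refine this.trans ?_
  rw [div_le_iff₀ (by linarith [hκ.small])]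
  nlinarith [hκ.small]

/-- Solutions for nearly exponential kernels: the sup bound. -/
theorem conv_le_of_isNearExponential (h : IsLagrangianSolution V κ g T M C ρ X v)
    (hV : IsVelocity V) (hT : 0 ≤ T) {Q : ℝ} (hQ0 : 0 < Q) (hQ : ∀ x, |g x| ≤ Q)
    (hg : Measurable g) {L : ℝ≥0} (hL : LipschitzOnWith L V (Icc 0 (4 * Q))) {α θ Λ θ' : ℝ}
    (hΛ : 0 ≤ Λ) (hκ : IsNearExponential κ α θ Λ θ')
    (hsmall : 64 * (Λ * θ') * Q * L * T ≤ 1 / 3) {t : ℝ} (ht : t ∈ Icc 0 T) (x : ℝ) :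
    conv κ (ρ t) x ≤ 4 * Q := by
  obtain ⟨c, hc⟩ := hκ.kernel
  obtain ⟨k, c', hk, hkκ, hmono, hsec, hnear⟩ := hκ.approx
  have hα := hκ.pos
  have he := isKernel_expKernel hα
  have hθ' := hnear.nonneg hα
  have hW0 : ∀ t x, 0 ≤ conv κ (ρ t) x := fun t x => conv_nonneg hc.nonneg (h.nonneg t) x
  have hE0 : ∀ t x, 0 ≤ conv (expKernel α) (ρ t) x := fun t x =>
    conv_nonneg he.nonneg (h.nonneg t) x
  -- the difference in terms of a bound for the full average
  have hdiff : ∀ t S, (∀ x, conv κ (ρ t) x ≤ S) → ∀ x,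
      |conv κ (ρ t) x - conv k (ρ t) x| ≤ θ' * (2 * S) := fun t S hS x =>
    hnear.abs_conv_sub_le hα hc hk (h.meas t) (h.bdd t) (fun x => by
      rw [abs_of_nonneg (hE0 t x)]
      exact h.conv_expKernel_le hκ hS x) x
  have hWU : ∀ t B, (∀ x, conv k (ρ t) x ≤ B) → ∀ x, conv κ (ρ t) x ≤ 2 * B := fun t B hB x => by
    have hB0 : 0 ≤ B := (conv_nonneg hk.nonneg (h.nonneg t) 0).trans (hB 0)
    have := le_of_le_add_mul_sup (f := conv κ (ρ t)) (B := B) (r := 2 * θ')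
      (by linarith [hκ.small']) (fun x => (h.conv_mem_Icc hc.integrable hc.nonneg t x).2)
      (fun S hS x => by
        have h1 := abs_le.1 (hdiff t S hS x)
        linarith [h1.2, hB x]) x
    refine this.trans ?_
    rw [div_le_iff₀ (by linarith [hκ.small'])]
    nlinarith [hκ.small']
  have hsys : ∀ T' ≤ T, ∀ S, (∀ t ∈ Icc 0 T', ∀ x, conv κ (ρ t) x ≤ S) →
      IsParticleSystem (absMeasure g) X v k T' C (2 * Λ * S) (M * ∫ s, k s) := fun T' hT' S hS =>
    (h.mono hT').isParticleSystem hk.measurable hk.integrable hk.nonneg hk.zero hmono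
      fun s hs t ht x => (h.mono hT').secant_mass_le hk hmono hc hΛ hsec hS hs ht x
  have hk1 : ∫ s, k s ≤ 1 := by
    rw [← hκ.mass]
    exact integral_mono hk.integrable hc.integrable hkκ
  have hU0 : ∀ x, conv k (ρ 0) x ≤ Q := fun x =>
    (h.conv_zero_le hT hg hQ hk.measurable hk.integrable hk.nonneg x).trans
      (mul_le_of_le_one_right hQ0.le hk1)
  -- the maximum principle on a time interval where the bound is known
  have hmax : ∀ T', 0 ≤ T' → T' ≤ T → (∀ t ∈ Icc 0 T', ∀ x, conv k (ρ t) x ≤ 2 * Q) →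
      ∀ t ∈ Icc 0 T', ∀ x, conv k (ρ t) x ≤ 3 / 2 * Q := by
    intro T' hT'0 hT' hb t ht z
    have hW : ∀ t ∈ Icc 0 T', ∀ x, conv κ (ρ t) x ≤ 4 * Q := fun t ht x => by
      have := hWU t _ (hb t ht) x
      linarith
    have hP := hsys T' hT' _ hW
    obtain ⟨x, rfl⟩ := (h.mono hT').surjective t ht z
    -- If the potential is at most `B`, absorption bounds the full average by `2B` and the
    -- exponential average by `4B`; the error is therefore at most `θ' · 4B`, which explains the
    -- comparison constant `4θ'`.
    have := hP.potential_le_exp (w := fun r x => conv κ (ρ r) (X r x)) (L := L) (θ := 4 * θ')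
      (Q := Q) L.2 (by linarith) hQ0.le
      (fun r hr x y hxy => h.velocity_sub hV hL (fun x => ⟨hW0 r x, hW r hr x⟩) x y hxy)
      (fun r hr B hB x => by
        rw [(h.mono hT').potential_eq hk.measurable hr]
        have hB' : ∀ z, conv k (ρ r) z ≤ B := fun z => by
          obtain ⟨y, rfl⟩ := (h.mono hT').surjective r hr z
          rw [← (h.mono hT').potential_eq hk.measurable hr]
          exact hB y
        refine (hdiff r _ (hWU r B hB') _).trans (le_of_eq ?_)
        ring) (fun x => by
        rw [h.potential_eq hk.measurable ⟨le_rfl, hT⟩]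
        exact hU0 _) ht x
    rw [(h.mono hT').potential_eq hk.measurable ht] at this
    refine this.trans ?_
    rw [mul_comm (3 / 2) Q]
    refine mul_le_mul_of_nonneg_left ?_ hQ0.le
    -- The factor `2Λ · 4Q` is the secant mass under the assumed bound `4Q` on the full average. The
    -- number `1/3` is chosen so that `exp (1/3) ≤ 3/2`, strictly below the factor `2` of the
    -- continuation hypothesis.
    have hexp : 2 * Λ * (4 * Q) * L * (2 * (4 * θ')) * t ≤ 1 / 3 := by
      refine le_trans ?_ hsmall
      have h1 : 0 ≤ 64 * (Λ * θ') * Q * L := by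
        have := L.2
        positivity
      have h2 := mul_le_mul_of_nonneg_left (ht.2.trans hT') h1
      linarith
    refine (Real.exp_le_exp.2 hexp).trans ?_
    have h3 := Real.add_one_le_exp (-(1 / 3 : ℝ))
    have h4 : Real.exp (-(1 / 3 : ℝ)) * Real.exp (1 / 3) = 1 := by rw [← Real.exp_add]; simp
    nlinarith [Real.exp_pos (1 / 3 : ℝ)]
  -- time steps of fixed length
  have hC : 0 ≤ C := (abs_nonneg _).trans (h.bound 0 0)
  set R := M * ∫ s, κ s
  have hR : ∀ t x, conv κ (ρ t) x ∈ Icc 0 R := h.conv_mem_Icc hc.integrable hc.nonneg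
  have hR0 : 0 ≤ R := (hR 0 0).1.trans (hR 0 0).2
  have hPT := hsys T le_rfl R fun t _ x => (hR t x).2
  -- A Lipschitz constant in time from the non-uniform bound `R`. It only fixes a positive step `δ`
  -- over which the potential cannot climb from `3Q/2` above `2Q`, and it is absent from the final
  -- bound.
  set ℓ := 2 * (2 * Λ * R) * C
  have hℓ : 0 ≤ ℓ := by positivity
  set δ := Q / 2 / (ℓ + 1)
  have hδ : 0 < δ := by positivity
  have hℓδ : ℓ * δ ≤ Q / 2 := by
    simp only [δ]
    rw [mul_div_assoc', div_le_iff₀ (by linarith)]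
    nlinarith
  have hstep : ∀ n : ℕ, ∀ t ∈ Icc 0 (min (n * δ) T), ∀ x, conv k (ρ t) x ≤ 2 * Q := by
    intro n
    induction n with
    | zero =>
      intro t ht x
      have ht0 : t = 0 := le_antisymm (by simpa using ht.2.trans (min_le_left _ _)) ht.1
      rw [ht0]
      linarith [hU0 x]
    | succ n ih =>
      intro t ht z
      have htT : t ∈ Icc 0 T := ⟨ht.1, ht.2.trans (min_le_right _ _)⟩
      have hT'0 : 0 ≤ min (n * δ) T := le_min (by positivity) hT
      have h32 := hmax _ hT'0 (min_le_right _ _) ih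
      rcases le_total t (n * δ) with hn | hn
      · have := h32 t ⟨ht.1, le_min hn htT.2⟩ z
        linarith
      · have hs : (n * δ : ℝ) ∈ Icc 0 T := ⟨by positivity, hn.trans htT.2⟩
        obtain ⟨x, rfl⟩ := h.surjective t htT z
        have h1 := (abs_le.1 (hPT.abs_potential_sub_le hs htT x)).2
        rw [h.potential_eq hk.measurable htT, h.potential_eq hk.measurable hs,
          abs_of_nonneg (sub_nonneg.2 hn)] at h1
        have h2 := h32 (n * δ) ⟨hs.1, le_min le_rfl hs.2⟩ (X (n * δ) x)
        have h3 : t - n * δ ≤ δ := by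
          have := ht.2.trans (min_le_left _ _)
          push_cast at this
          linarith
        have h4 := mul_le_mul_of_nonneg_left h3 hℓ
        linarith
  obtain ⟨n, hn⟩ := exists_nat_ge (T / δ)
  have hnT : T ≤ n * δ := by rwa [div_le_iff₀ hδ] at hn
  have := hWU t _ (hstep n t ⟨ht.1, le_min (ht.2.trans hnT) ht.2⟩) x
  linarith

/-- Solutions for nearly exponential kernels: the variation. -/
theorem varLe_of_isNearExponential (h : IsLagrangianSolution V κ g T M C ρ X v)
    (hV : IsVelocity V) (hT : 0 ≤ T) {Q A : ℝ} (hQ : ∀ x, |g x| ≤ Q) (hA : VarLe g A)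
    {L : ℝ≥0} (hL : LipschitzOnWith L V (Icc 0 (4 * Q))) {α θ Λ θ' : ℝ}
    (hκ : IsNearExponential κ α θ Λ θ') (hW : ∀ t ∈ Icc 0 T, ∀ x, conv κ (ρ t) x ≤ 4 * Q)
    {t : ℝ} (ht : t ∈ Icc 0 T) :
    VarLe (conv κ (ρ t)) (2 * (A * Real.exp (32 * (α * θ) * Q * L * T))) := by
  obtain ⟨c, hc⟩ := hκ.kernel
  have hα := hκ.pos
  have he := isKernel_expKernel hα
  have hg := hA.measurable
  have hθ := hκ.near.nonneg hα
  have hQ0 : 0 ≤ Q := (abs_nonneg _).trans (hQ 0)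
  have hA0 := hA.nonneg
  have hP := h.isParticleSystem he.measurable he.integrable he.nonneg he.zero
    (monotoneOn_expKernel hα.le) fun s hs t ht x => h.secant_mass_le he
      (monotoneOn_expKernel hα.le) he hα.le (fun a ha b hb => secant_expKernel_le hα.le ha hb)
      (fun t ht x => h.conv_expKernel_le hκ (hW t ht) x) hs ht x
  have hWd : ∀ r ∈ Icc 0 T, ∀ N B, (∀ x, Monotone x →
      varSum (fun y => conv (expKernel α) (ρ r) (X r y)) x N ≤ B) → ∀ z, Monotone z →
      varSum (fun y => conv κ (ρ r) y - conv (expKernel α) (ρ r) y) z N ≤ θ * B := by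
    intro r hr N B hB z hz
    refine hκ.near.varSum_sub_le hα hc he (h.meas r) (h.bdd r) (fun z hz => ?_) hz
    choose x hx using fun i => h.surjective r hr (z i)
    have hxm : Monotone x := fun i j hij => by
      rw [← (h.strictMono r hr).le_iff_le, hx, hx]
      exact hz hij
    have := hB x hxm
    simpa only [varSum, hx] using this
  -- The reference kernel has to be convex here, hence the exponential. Its secant mass is at most
  -- `2α · 8Q`, so the growth exponent is `2α · 8Q · L · 2θ · t = 32 αθQLt`, which stays bounded
  -- although `α` is large.
  have hmain := hP.varLe_potential (convexOn_expKernel hα.le)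
    (w := fun r x => conv κ (ρ r) (X r x)) (L := L) (θ := θ) (V₀ := A) L.2 hθ
    (fun r hr x y hxy => h.velocity_sub hV hL
      (fun x => ⟨conv_nonneg hc.nonneg (h.nonneg r) x, hW r hr x⟩) x y hxy)
    (fun r hr N B hB x hx => by
      have := hWd r hr N B (fun x hx => by
        have := hB x hx
        simpa only [varSum, h.potential_eq he.measurable hr] using this) (fun i => X r (x i))
        (fun i j hij => (h.strictMono r hr).monotone (hx hij))
      simpa only [varSum, h.potential_eq he.measurable hr] using this) (by
      have h1 := h.varLe_conv_zero hT hA hQ he.measurable he.integrable he.nonneg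
      rw [integral_expKernel hα, mul_one] at h1
      intro x hx n
      simpa only [varSum, h.potential_eq he.measurable ⟨le_rfl, hT⟩, h.init] using h1 x hx n) ht
  set B := A * Real.exp (32 * (α * θ) * Q * L * T)
  have hB : VarLe (fun y => conv (expKernel α) (ρ t) (X t y)) B := by
    intro x hx n
    have h1 := hmain x hx n
    have e : varSum (potential (absMeasure g) X (expKernel α) t) x n =
        varSum (fun y => conv (expKernel α) (ρ t) (X t y)) x n := by
      simp only [varSum, h.potential_eq he.measurable ht]
    rw [e] at h1
    refine h1.trans (mul_le_mul_of_nonneg_left (Real.exp_le_exp.2 ?_) hA0)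
    have h2 : 0 ≤ 32 * (α * θ) * Q * L := by
      have := L.2
      positivity
    have h3 := mul_le_mul_of_nonneg_left ht.2 h2
    linarith
  have hB' := h.varLe_conv ht hB
  intro z hz n
  have h1 := hB' z hz n
  have h2 := hWd t ht n B (fun x hx => hB x hx n) z hz
  have h3 : varSum (conv κ (ρ t)) z n ≤ varSum (conv (expKernel α) (ρ t)) z n +
      varSum (fun y => conv κ (ρ t) y - conv (expKernel α) (ρ t) y) z n := by
    rw [varSum, varSum, varSum, ← Finset.sum_add_distrib]
    refine Finset.sum_le_sum fun i _ => ?_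
    refine le_trans (le_of_eq ?_) (abs_add_le _ _)
    congr 1
    ring
  have hB0 : 0 ≤ B := hB'.nonneg
  nlinarith [hκ.small]

end IsLagrangianSolution

/-! ### Kernels scaled in the exponent -/

theorem isNear_of_varLe {κ k : ℝ → ℝ} {α θ B : ℝ} (h : VarLe (fun s => κ s - k s) B)
    (hθ : (∫ s, |κ s - k s|) + B / α ≤ θ) : IsNear κ k α θ := by
  refine ⟨1, one_pos, B, fun r hr _ => ?_, hθ⟩
  have := (h.integral_translate_le r).2
  rwa [abs_of_pos hr] at this

/-- The variation of a function supported in `(-∞, 0)`. -/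
theorem varLe_of_le_sub_of_neg {f N : ℝ → ℝ} {A S : ℝ} (hA : ∀ x < 0, N x ∈ Icc 0 A)
    (hS : ∀ x, |f x| ≤ S) (hz : ∀ x, 0 ≤ x → f x = 0)
    (h : ∀ x y, x ≤ y → y < 0 → |f y - f x| ≤ N y - N x) : VarLe f (A + S) := by
  have hS0 : 0 ≤ S := (abs_nonneg _).trans (hS 0)
  have hA0 : 0 ≤ A := (hA (-1) (by norm_num)).1.trans (hA (-1) (by norm_num)).2
  refine varLe_of_le_sub (N := fun s => if s < 0 then N s else A + S) (fun s => ?_)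
    fun x y hxy => ?_
  · split_ifs with hs
    · exact ⟨(hA s hs).1, by linarith [(hA s hs).2]⟩
    · exact ⟨by linarith, le_rfl⟩
  · split_ifs with h1 h2 h2
    · exact h x y hxy h1
    · exact absurd (hxy.trans_lt h1) h2
    · rw [hz y (not_lt.1 h1), zero_sub, abs_neg]
      linarith [hS x, (hA x h2).2]
    · rw [hz y (not_lt.1 h1), hz x (not_lt.1 h2)]
      simp

theorem abs_sub_le_of_split {f N : ℝ → ℝ} {b B : ℝ}
    (h₁ : ∀ x y, x ≤ y → y ≤ b → |f y - f x| ≤ N y - N x)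
    (h₂ : ∀ x y, b ≤ x → x ≤ y → y ≤ B → |f y - f x| ≤ N y - N x) {x y : ℝ} (hxy : x ≤ y)
    (hy : y ≤ B) : |f y - f x| ≤ N y - N x := by
  rcases le_total y b with hb | hb
  · exact h₁ x y hxy hb
  rcases le_total b x with hb' | hb'
  · exact h₂ x y hb' hxy hy
  have := abs_add_le (f y - f b) (f b - f x)
  rw [sub_add_sub_cancel] at this
  linarith [h₁ x b hb' le_rfl, h₂ b y le_rfl hb hy]

/-- Bernoulli's inequality for `u / v = 1 + (u / v - 1)`, multiplied by `v ^ p`; the case `u = 0` is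
treated separately. -/
theorem rpow_sub_rpow_le {u v p : ℝ} (hu : 0 ≤ u) (huv : u ≤ v) (hp : 1 ≤ p) :
    v ^ p - u ^ p ≤ p * v ^ (p - 1) * (v - u) := by
  rcases hu.eq_or_lt with rfl | hu'
  · rcases huv.eq_or_lt with rfl | hv
    · simp
    · rw [Real.zero_rpow (by linarith), sub_zero, sub_zero, mul_assoc,
        ← Real.rpow_add_one hv.ne', sub_add_cancel]
      have := Real.rpow_nonneg hv.le p
      nlinarith
  have hv : 0 < v := hu'.trans_le huv
  have h1 := one_add_mul_self_le_rpow_one_add (s := u / v - 1)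
    (by linarith [div_nonneg hu hv.le]) hp
  rw [add_sub_cancel, Real.div_rpow hu hv.le, le_div_iff₀ (Real.rpow_pos_of_pos hv p)] at h1
  have h2 : v ^ p = v ^ (p - 1) * v := by
    rw [← Real.rpow_add_one hv.ne', sub_add_cancel]
  have h3 : (1 + p * (u / v - 1)) * v ^ p = v ^ p - p * v ^ (p - 1) * (v - u) := by
    rw [h2]
    field_simp
    ring
  linarith

theorem abs_rpow_sub_le {u v c p : ℝ} (hu : 0 ≤ u) (hv : 0 ≤ v) (huc : u ≤ c) (hvc : v ≤ c)
    (hp : 1 ≤ p) : |u ^ p - v ^ p| ≤ p * c ^ (p - 1) * |u - v| := by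
  have key : ∀ {u v : ℝ}, 0 ≤ v → v ≤ u → u ≤ c →
      |u ^ p - v ^ p| ≤ p * c ^ (p - 1) * |u - v| := by
    intro u v hv hvu huc
    rw [abs_of_nonneg (sub_nonneg.2 (Real.rpow_le_rpow hv hvu (by linarith))),
      abs_of_nonneg (sub_nonneg.2 hvu)]
    refine (rpow_sub_rpow_le hv hvu hp).trans
      (mul_le_mul_of_nonneg_right (mul_le_mul_of_nonneg_left ?_ (by linarith)) (by linarith))
    exact Real.rpow_le_rpow (hv.trans hvu) huc (by linarith)
  rcases le_total v u with h | h
  · exact key hv h huc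
  · rw [abs_sub_comm, abs_sub_comm u]
    exact key hu h hvc

theorem abs_exp_sub_exp_le {u v m : ℝ} (hu : u ≤ m) (hv : v ≤ m) :
    |Real.exp u - Real.exp v| ≤ |u - v| * Real.exp m := by
  have key : ∀ {u v : ℝ}, u ≤ m → v ≤ u →
      |Real.exp u - Real.exp v| ≤ |u - v| * Real.exp m := by
    intro u v hu hvu
    rw [abs_of_nonneg (sub_nonneg.2 (Real.exp_le_exp.2 hvu)), abs_of_nonneg (sub_nonneg.2 hvu)]
    have h1 := Real.add_one_le_exp (v - u)
    have h2 : Real.exp v = Real.exp u * Real.exp (v - u) := by rw [← Real.exp_add]; congr 1; ring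
    have h3 := mul_le_mul_of_nonneg_left (Real.exp_le_exp.2 hu) (sub_nonneg.2 hvu)
    have := mul_le_mul_of_nonneg_left h1 (Real.exp_pos u).le
    linarith
  rcases le_total v u with h | h
  · exact key hu h
  · rw [abs_sub_comm, abs_sub_comm u]
    exact key hv h

/-- Normalised base kernels for the scaling in the exponent, with `N` a majorant for the
variation. -/
structure IsNormalPower (γ N : ℝ → ℝ) (a C δ c A : ℝ) : Prop where
  a_pos : 0 < a
  C_nonneg : 0 ≤ C
  δ_pos : 0 < δ
  c_pos : 0 < c
  c_lt : c < 1
  zero : γ 0 = 1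
  nonneg : ∀ x ≤ 0, 0 ≤ γ x
  le_one : ∀ x ≤ 0, γ x ≤ 1
  le_c : ∀ x ≤ -δ, γ x ≤ c
  integrable : IntegrableOn γ (Iio 0)
  majorant : ∀ x, N x ∈ Icc 0 A
  abs_sub_le : ∀ x y, x ≤ y → y ≤ 0 → |γ y - γ x| ≤ N y - N x
  half_le : ∀ x, -δ ≤ x → x ≤ 0 → 1 / 2 ≤ γ x
  mono : ∀ x y, -δ ≤ x → x ≤ y → y ≤ 0 → γ x ≤ γ y
  sub_le : ∀ x y, -δ ≤ x → x ≤ y → y ≤ 0 → γ y - γ x ≤ 2 * a * (y - x)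
  log_sub : ∀ x y, -δ ≤ x → x ≤ y → y ≤ 0 →
    |Real.log (γ y) - Real.log (γ x) - a * (y - x)| ≤ C * (-x) * (y - x)
  C_mul : C * δ ≤ a / 4

namespace IsNormalPower

variable {γ N : ℝ → ℝ} {a C δ c A p : ℝ}

/-- A difference of squares. Half of the decay rate stays in the increment and serves as a monotone
majorant; the other half is left to absorb polynomial factors. -/
theorem exp_sub_exp_le (α x y : ℝ) (hα : 0 ≤ α) (hxy : x ≤ y) :
    Real.exp (α * y) - Real.exp (α * x) ≤
      2 * Real.exp (α / 2 * y) * (Real.exp (α / 2 * y) - Real.exp (α / 2 * x)) := by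
  have e : ∀ z, Real.exp (α * z) = Real.exp (α / 2 * z) * Real.exp (α / 2 * z) := fun z => by
    rw [← Real.exp_add]; congr 1; ring
  have h1 : Real.exp (α / 2 * x) ≤ Real.exp (α / 2 * y) := Real.exp_le_exp.2 (by gcongr)
  rw [e, e]
  nlinarith

/-- The remainder of `log γ`. -/
theorem abs_log_sub_le (h : IsNormalPower γ N a C δ c A) {x : ℝ} (hx : -δ ≤ x) (hx0 : x ≤ 0) :
    |Real.log (γ x) - a * x| ≤ C * x ^ 2 ∧ |Real.log (γ x) - a * x| ≤ a / 4 * (-x) := by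
  have h1 := h.log_sub x 0 hx hx0 le_rfl
  rw [h.zero, Real.log_one, show 0 - Real.log (γ x) - a * (0 - x) = -(Real.log (γ x) - a * x) by
    ring, abs_neg] at h1
  have h2 : C * (-x) ≤ a / 4 :=
    (mul_le_mul_of_nonneg_left (by linarith) h.C_nonneg).trans h.C_mul
  refine ⟨h1.trans (le_of_eq (by ring)), h1.trans ?_⟩
  rw [zero_sub]
  exact mul_le_mul_of_nonneg_right h2 (by linarith)

theorem rpow_eq (h : IsNormalPower γ N a C δ c A) {x : ℝ} (hx : -δ ≤ x) (hx0 : x ≤ 0) :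
    γ x ^ p = Real.exp (a * p * x) * Real.exp (p * (Real.log (γ x) - a * x)) := by
  rw [Real.rpow_def_of_pos (by linarith [h.half_le x hx hx0]), ← Real.exp_add]
  congr 1
  ring

theorem sq_mul_exp_le {α x : ℝ} (hα : 0 < α) (hx : x ≤ 0) :
    x ^ 2 * Real.exp (α / 4 * x) ≤ 32 / α ^ 2 := by
  have h1 := Real.quadratic_le_exp_of_nonneg (x := -(α / 4 * x)) (by nlinarith)
  have h2 : Real.exp (-(α / 4 * x)) * Real.exp (α / 4 * x) = 1 := by rw [← Real.exp_add]; simp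
  rw [le_div_iff₀ (by positivity)]
  have h3 : x ^ 2 * α ^ 2 ≤ 32 * Real.exp (-(α / 4 * x)) := by nlinarith
  have h4 := mul_le_mul_of_nonneg_right h3 (Real.exp_pos (α / 4 * x)).le
  rw [mul_assoc (32 : ℝ), h2] at h4
  linarith

theorem neg_mul_exp_le {α x : ℝ} (hα : 0 < α) : -x * Real.exp (α / 4 * x) ≤ 4 / α := by
  have h1 := Real.add_one_le_exp (-(α / 4 * x))
  have h2 : Real.exp (-(α / 4 * x)) * Real.exp (α / 4 * x) = 1 := by rw [← Real.exp_add]; simp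
  rw [le_div_iff₀ hα]
  have h3 : -x * α ≤ 4 * Real.exp (-(α / 4 * x)) := by linarith
  have h4 := mul_le_mul_of_nonneg_right h3 (Real.exp_pos (α / 4 * x)).le
  rw [mul_assoc (4 : ℝ), h2] at h4
  linarith

/-- The remainder of `log γ` is at most `C x²`, which gives the size, and at most a quarter of the
linear term, which limits the exponential loss to a quarter of the rate. -/
theorem abs_remainder_le (h : IsNormalPower γ N a C δ c A) (hp : 0 < p) {x : ℝ} (hx : -δ ≤ x)
    (hx0 : x ≤ 0) : |Real.exp (p * (Real.log (γ x) - a * x)) - 1| ≤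
      p * C * x ^ 2 * Real.exp (-(a * p / 4 * x)) := by
  obtain ⟨h1, h2⟩ := h.abs_log_sub_le hx hx0
  have hm : p * (Real.log (γ x) - a * x) ≤ -(a * p / 4 * x) := by
    have := mul_le_mul_of_nonneg_left ((le_abs_self _).trans h2) hp.le
    linarith
  have := abs_exp_sub_exp_le hm (v := 0) (by have := h.a_pos; have := mul_pos this hp; nlinarith)
  rw [Real.exp_zero, sub_zero] at this
  refine this.trans (mul_le_mul_of_nonneg_right ?_ (Real.exp_pos _).le)
  rw [abs_mul, abs_of_pos hp, mul_assoc]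
  exact mul_le_mul_of_nonneg_left h1 hp.le

/-- Near `0` the powers are exponentials, up to an error of order `1 / p`. -/
theorem abs_rpow_sub_exp_le_of_ge (h : IsNormalPower γ N a C δ c A) (hp : 0 < p) {x : ℝ}
    (hx : -δ ≤ x) (hx0 : x ≤ 0) :
    |γ x ^ p - Real.exp (a * p * x)| ≤ 72 * C / a ^ 2 / p * Real.exp (a * p / 2 * x) := by
  have ha := h.a_pos
  have hC := h.C_nonneg
  have hα : 0 < a * p := mul_pos ha hp
  rw [h.rpow_eq hx hx0, show ∀ E R : ℝ, E * R - E = E * (R - 1) by intros; ring, abs_mul,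
    abs_of_pos (Real.exp_pos _)]
  have h1 := mul_le_mul_of_nonneg_left (h.abs_remainder_le hp hx hx0)
    (Real.exp_pos (a * p * x)).le
  refine h1.trans ?_
  have e : Real.exp (a * p * x) * Real.exp (-(a * p / 4 * x)) =
      Real.exp (a * p / 4 * x) * Real.exp (a * p / 2 * x) := by
    rw [← Real.exp_add, ← Real.exp_add]; congr 1; ring
  have h2 : p * C * (x ^ 2 * Real.exp (a * p / 4 * x)) ≤ p * C * (32 / (a * p) ^ 2) :=
    mul_le_mul_of_nonneg_left (sq_mul_exp_le hα hx0) (by positivity)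
  have h3 : p * C * (32 / (a * p) ^ 2) ≤ 72 * C / a ^ 2 / p := by
    have : p * C * (32 / (a * p) ^ 2) = 32 * C / a ^ 2 / p := by field_simp
    rw [this]
    gcongr
    norm_num
  calc _ = p * C * (x ^ 2 * Real.exp (a * p / 4 * x)) * Real.exp (a * p / 2 * x) := by
        linear_combination (p * C * x ^ 2) * e
    _ ≤ _ := mul_le_mul_of_nonneg_right (h2.trans h3) (Real.exp_pos _).le

/-- Writing the error as `E (R - 1)` with `E` the exponential, its increment splits into `(E y - E
x)(R y - 1)` and `E x (R y - R x)`. The quadratic factor in the first costs `64`, the linear factor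
in the second costs `8`, and both keep the increment of the exponential with half the rate. -/
theorem abs_sub_sub_le_of_ge (h : IsNormalPower γ N a C δ c A) (hp : 0 < p) {x y : ℝ}
    (hx : -δ ≤ x) (hxy : x ≤ y) (hy : y ≤ 0) :
    |(γ y ^ p - Real.exp (a * p * y)) - (γ x ^ p - Real.exp (a * p * x))| ≤
      72 * C / a ^ 2 / p * (Real.exp (a * p / 2 * y) - Real.exp (a * p / 2 * x)) := by
  have ha := h.a_pos
  have hC := h.C_nonneg
  have hα : 0 < a * p := mul_pos ha hp
  have hR := h.abs_remainder_le hp (hx.trans hxy) hy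
  have hx0 := hxy.trans hy
  rw [h.rpow_eq hx hx0, h.rpow_eq (hx.trans hxy) hy]
  set Ry := Real.exp (p * (Real.log (γ y) - a * y)) with hRy
  set Rx := Real.exp (p * (Real.log (γ x) - a * x)) with hRx
  set dH := Real.exp (a * p / 2 * y) - Real.exp (a * p / 2 * x) with hdH
  have hdH0 : 0 ≤ dH := sub_nonneg.2 (Real.exp_le_exp.2 (by gcongr))
  have hdE : Real.exp (a * p * x) ≤ Real.exp (a * p * y) := Real.exp_le_exp.2 (by gcongr)
  -- the increment of the remainder
  have hm : ∀ z, x ≤ z → z ≤ 0 → p * (Real.log (γ z) - a * z) ≤ -(a * p / 4 * x) := by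
    intro z hz hz0
    have h2 := (le_abs_self _).trans (h.abs_log_sub_le (hx.trans hz) hz0).2
    have h3 : a / 4 * (-z) ≤ a / 4 * (-x) := by gcongr
    have := mul_le_mul_of_nonneg_left (h2.trans h3) hp.le
    linarith
  have hdR : |Ry - Rx| ≤ p * (C * (-x) * (y - x)) * Real.exp (-(a * p / 4 * x)) := by
    refine (abs_exp_sub_exp_le (hm y hxy hy) (hm x le_rfl hx0)).trans
      (mul_le_mul_of_nonneg_right ?_ (Real.exp_pos _).le)
    rw [← mul_sub, abs_mul, abs_of_pos hp]
    refine mul_le_mul_of_nonneg_left (le_trans (le_of_eq ?_) (h.log_sub x y hx hxy hy)) hp.le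
    congr 1
    ring
  have e : ∀ Ey Ex : ℝ, (Ey * Ry - Ey) - (Ex * Rx - Ex) = (Ey - Ex) * (Ry - 1) + Ex * (Ry - Rx) :=
    fun _ _ => by ring
  rw [e]
  have h1 : |(Real.exp (a * p * y) - Real.exp (a * p * x)) * (Ry - 1)| ≤
      64 * C / a ^ 2 / p * dH := by
    rw [abs_mul, abs_of_nonneg (sub_nonneg.2 hdE)]
    have e1 : Real.exp (a * p / 2 * y) * Real.exp (-(a * p / 4 * y)) =
        Real.exp (a * p / 4 * y) := by
      rw [← Real.exp_add]; congr 1; ring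
    calc _ ≤ (2 * Real.exp (a * p / 2 * y) * dH) *
          (p * C * y ^ 2 * Real.exp (-(a * p / 4 * y))) :=
          mul_le_mul (exp_sub_exp_le _ x y hα.le hxy) hR (abs_nonneg _) (by positivity)
      _ = 2 * p * C * dH * (y ^ 2 * Real.exp (a * p / 4 * y)) := by
          linear_combination (2 * p * C * dH * y ^ 2) * e1
      _ ≤ 2 * p * C * dH * (32 / (a * p) ^ 2) :=
          mul_le_mul_of_nonneg_left (sq_mul_exp_le hα hy) (by positivity)
      _ = _ := by field_simp; ring
  have h2 : |Real.exp (a * p * x) * (Ry - Rx)| ≤ 8 * C / a ^ 2 / p * dH := by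
    rw [abs_mul, abs_of_pos (Real.exp_pos _)]
    have e1 : Real.exp (a * p * x) * Real.exp (-(a * p / 4 * x)) =
        Real.exp (a * p / 4 * x) * Real.exp (a * p / 2 * x) := by
      rw [← Real.exp_add, ← Real.exp_add]; congr 1; ring
    have h3 : a * p / 2 * (y - x) * Real.exp (a * p / 2 * x) ≤ dH := by
      have h4 := Real.add_one_le_exp (a * p / 2 * (y - x))
      have h5 : Real.exp (a * p / 2 * y) =
          Real.exp (a * p / 2 * (y - x)) * Real.exp (a * p / 2 * x) := by
        rw [← Real.exp_add]; congr 1; ring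
      rw [hdH, h5]
      nlinarith [Real.exp_pos (a * p / 2 * x)]
    have hyx : 0 ≤ y - x := sub_nonneg.2 hxy
    calc _ ≤ Real.exp (a * p * x) *
          (p * (C * (-x) * (y - x)) * Real.exp (-(a * p / 4 * x))) :=
          mul_le_mul_of_nonneg_left hdR (Real.exp_pos _).le
      _ = (-x * Real.exp (a * p / 4 * x)) * (p * C * ((y - x) * Real.exp (a * p / 2 * x))) := by
          linear_combination (p * C * (-x) * (y - x)) * e1
      _ ≤ 4 / (a * p) * (p * C * ((y - x) * Real.exp (a * p / 2 * x))) :=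
          mul_le_mul_of_nonneg_right (neg_mul_exp_le hα) (by positivity)
      _ = 8 * C / a ^ 2 / p * (a * p / 2 * (y - x) * Real.exp (a * p / 2 * x)) := by
          field_simp; ring
      _ ≤ _ := mul_le_mul_of_nonneg_left h3 (by positivity)
  refine (abs_add_le _ _).trans ((add_le_add h1 h2).trans (le_of_eq ?_))
  field_simp
  ring

theorem exp_neg_le (h : IsNormalPower γ N a C δ c A) (hp : 0 < p) {x : ℝ} (hx : x ≤ -δ) :
    Real.exp (a * p / 2 * x) ≤ 2 / (a * δ) / p := by
  have ha := h.a_pos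
  have hδ := h.δ_pos
  have hα : 0 < a * p / 2 := by positivity
  have h1 := Real.add_one_le_exp (a * p / 2 * δ)
  have h2 : Real.exp (a * p / 2 * δ) * Real.exp (-(a * p / 2 * δ)) = 1 := by
    rw [← Real.exp_add]; simp
  have h3 : Real.exp (a * p / 2 * x) ≤ Real.exp (-(a * p / 2 * δ)) :=
    Real.exp_le_exp.2 (by nlinarith)
  refine h3.trans ?_
  rw [div_div, le_div_iff₀ (by positivity)]
  nlinarith [Real.exp_pos (-(a * p / 2 * δ))]

/-- The constant in the comparison of `γ ^ p` with an exponential. -/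
def errConst (a C δ : ℝ) : ℝ := 72 * C / a ^ 2 + 4 / (a * δ) + 1

theorem errConst_bounds (h : IsNormalPower γ N a C δ c A) : 72 * C / a ^ 2 ≤ errConst a C δ ∧
    4 / (a * δ) ≤ errConst a C δ ∧ 1 ≤ errConst a C δ := by
  have ha := h.a_pos
  have hδ := h.δ_pos
  have hC := h.C_nonneg
  have h1 : 0 ≤ 72 * C / a ^ 2 := by positivity
  have h2 : 0 ≤ 4 / (a * δ) := by positivity
  rw [errConst]
  exact ⟨by linarith, by linarith, by linarith⟩

/-- One factor `γ x` is retained to keep the bound integrable over the half-line; the other `p - 1`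
factors give exponential smallness. -/
theorem rpow_le (h : IsNormalPower γ N a C δ c A) (hp : 1 ≤ p) {x : ℝ} (hx : x ≤ -δ) :
    γ x ^ p ≤ c ^ (p - 1) * γ x := by
  have hx0 : x ≤ 0 := by linarith [h.δ_pos]
  rcases (h.nonneg x hx0).eq_or_lt with h0 | h0
  · rw [← h0, Real.zero_rpow (by linarith), mul_zero]
  · have : γ x ^ p = γ x ^ (p - 1) * γ x := by
      rw [← Real.rpow_add_one h0.ne', sub_add_cancel]
    rw [this]
    exact mul_le_mul_of_nonneg_right (Real.rpow_le_rpow h0.le (h.le_c x hx) (by linarith)) h0.le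

/-- On `[-δ, 0]` this is the local comparison. Further left both terms are small separately: the
exponential retains half its rate, and the power retains a factor `γ`. Both majorants have mass of
order `1/p`, so the total mass of the error is `O(1/p²)`. -/
theorem abs_rpow_sub_exp_le (h : IsNormalPower γ N a C δ c A) (hp : 1 ≤ p)
    (hc : p ^ 2 * c ^ (p - 1) ≤ 1) {x : ℝ} (hx0 : x ≤ 0) :
    |γ x ^ p - Real.exp (a * p * x)| ≤
      errConst a C δ / p * (Real.exp (a * p / 2 * x) + γ x / p) := by
  obtain ⟨k1, k2, k3⟩ := h.errConst_bounds
  have hp0 : 0 < p := by linarith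
  have hγ := h.nonneg x hx0
  have hH := Real.exp_pos (a * p / 2 * x)
  have hK0 : 0 ≤ errConst a C δ / p := by positivity
  rcases le_total (-δ) x with hx | hx
  · refine (h.abs_rpow_sub_exp_le_of_ge hp0 hx hx0).trans ?_
    calc _ ≤ errConst a C δ / p * Real.exp (a * p / 2 * x) := by gcongr
      _ ≤ _ := by
        refine mul_le_mul_of_nonneg_left ?_ hK0
        have : 0 ≤ γ x / p := by positivity
        linarith
  · have h1 : Real.exp (a * p * x) ≤ errConst a C δ / p * Real.exp (a * p / 2 * x) := by
      have e : Real.exp (a * p * x) = Real.exp (a * p / 2 * x) * Real.exp (a * p / 2 * x) := by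
        rw [← Real.exp_add]; congr 1; ring
      rw [e]
      refine mul_le_mul_of_nonneg_right ((h.exp_neg_le hp0 hx).trans ?_) hH.le
      have ha := h.a_pos
      have hδ := h.δ_pos
      refine div_le_div_of_nonneg_right (le_trans ?_ k2) hp0.le
      gcongr
      norm_num
    have h2 : γ x ^ p ≤ errConst a C δ / p * (γ x / p) := by
      refine (h.rpow_le hp hx).trans ?_
      have h3 : c ^ (p - 1) ≤ 1 / p ^ 2 := by rw [le_div_iff₀ (by positivity)]; linarith
      calc _ ≤ 1 / p ^ 2 * γ x := mul_le_mul_of_nonneg_right h3 hγ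
        _ = 1 / p * (γ x / p) := by field_simp
        _ ≤ _ := by gcongr
    have h4 := Real.rpow_nonneg hγ p
    have h5 := Real.exp_pos (a * p * x)
    rw [mul_add, abs_le]
    constructor <;> nlinarith

/-- The variation of the error is `O(1/p)`. Left of `-δ` the increments of the power are dominated
by those of `N`, with the exponentially small factor `p c ^ (p - 1)`; right of `-δ` the expansion at
`0` is used. -/
theorem abs_sub_sub_le (h : IsNormalPower γ N a C δ c A) (hp : 1 ≤ p)
    (hc : p ^ 2 * c ^ (p - 1) ≤ 1) {x y : ℝ} (hxy : x ≤ y) (hy : y ≤ 0) :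
    |(γ y ^ p - Real.exp (a * p * y)) - (γ x ^ p - Real.exp (a * p * x))| ≤
      errConst a C δ / p * (Real.exp (a * p / 2 * y) + N y) -
        errConst a C δ / p * (Real.exp (a * p / 2 * x) + N x) := by
  obtain ⟨k1, k2, k3⟩ := h.errConst_bounds
  have hp0 : 0 < p := by linarith
  have ha := h.a_pos
  have hδ := h.δ_pos
  have hK0 : 0 ≤ errConst a C δ / p := by positivity
  have hN : ∀ {x y}, x ≤ y → y ≤ 0 → 0 ≤ N y - N x := fun hxy hy =>
    (abs_nonneg _).trans (h.abs_sub_le _ _ hxy hy)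
  have hH : ∀ {x y : ℝ}, x ≤ y → 0 ≤ Real.exp (a * p / 2 * y) - Real.exp (a * p / 2 * x) :=
    fun hxy => sub_nonneg.2 (Real.exp_le_exp.2 (by gcongr))
  refine abs_sub_le_of_split (f := fun x => γ x ^ p - Real.exp (a * p * x))
    (N := fun x => errConst a C δ / p * (Real.exp (a * p / 2 * x) + N x)) (b := -δ) (B := 0)
    (fun x y hxy hy => ?_) (fun x y hx hxy hy => ?_) hxy hy
  · have hy0 : y ≤ 0 := by linarith
    have h1 : |γ y ^ p - γ x ^ p| ≤ errConst a C δ / p * (N y - N x) := by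
      refine (abs_rpow_sub_le (h.nonneg y hy0) (h.nonneg x (hxy.trans hy0)) (h.le_c y hy)
        (h.le_c x (hxy.trans hy)) hp).trans ?_
      have h3 : p * c ^ (p - 1) ≤ errConst a C δ / p := by
        rw [le_div_iff₀ hp0]
        linarith
      exact mul_le_mul h3 (h.abs_sub_le x y hxy hy0) (abs_nonneg _) hK0
    have h2 : |Real.exp (a * p * y) - Real.exp (a * p * x)| ≤
        errConst a C δ / p * (Real.exp (a * p / 2 * y) - Real.exp (a * p / 2 * x)) := by
      rw [abs_of_nonneg (sub_nonneg.2 (Real.exp_le_exp.2 (by gcongr)))]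
      refine (exp_sub_exp_le _ x y (by positivity) hxy).trans
        (mul_le_mul_of_nonneg_right ?_ (hH hxy))
      have h4 := h.exp_neg_le hp0 hy
      have h5 : 2 * (2 / (a * δ) / p) = 4 / (a * δ) / p := by ring
      have h6 : 4 / (a * δ) / p ≤ errConst a C δ / p := by gcongr
      linarith
    have := abs_sub (γ y ^ p - γ x ^ p) (Real.exp (a * p * y) - Real.exp (a * p * x))
    rw [show γ y ^ p - Real.exp (a * p * y) - (γ x ^ p - Real.exp (a * p * x)) =
      (γ y ^ p - γ x ^ p) - (Real.exp (a * p * y) - Real.exp (a * p * x)) by ring]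
    linarith
  · refine (h.abs_sub_sub_le_of_ge hp0 hx hxy hy).trans ?_
    have h1 : 72 * C / a ^ 2 / p * (Real.exp (a * p / 2 * y) - Real.exp (a * p / 2 * x)) ≤
        errConst a C δ / p * (Real.exp (a * p / 2 * y) - Real.exp (a * p / 2 * x)) :=
      mul_le_mul_of_nonneg_right (by gcongr) (hH hxy)
    have := mul_nonneg hK0 (hN hxy hy)
    linarith

end IsNormalPower

theorem indicator_Iio_of_nonneg (f : ℝ → ℝ) {x : ℝ} (hx : 0 ≤ x) : (Iio 0).indicator f x = 0 :=
  indicator_of_notMem (by simpa using hx) _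

theorem indicator_Iio_of_neg (f : ℝ → ℝ) {x : ℝ} (hx : x < 0) : (Iio 0).indicator f x = f x :=
  indicator_of_mem (mem_Iio.2 hx) _

namespace IsNormalPower

variable {γ N : ℝ → ℝ} {a C δ c A p : ℝ}

theorem majorant_nonneg (h : IsNormalPower γ N a C δ c A) : 0 ≤ A :=
  (h.majorant 0).1.trans (h.majorant 0).2

/-- A qualitative bound that grows with `p`; it serves only to make the power a kernel and does not
enter the uniform estimates. -/
theorem varLe_rpow (h : IsNormalPower γ N a C δ c A) (hp : 1 ≤ p) :
    VarLe ((Iio 0).indicator fun x => γ x ^ p) (p * A + 1) := by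
  have hp0 : 0 ≤ p := by linarith
  refine varLe_of_le_sub_of_neg (N := fun x => p * N x) (fun x _ => ?_) (fun x => ?_)
    (fun x hx => indicator_Iio_of_nonneg _ hx) fun x y hxy hy => ?_
  · exact ⟨mul_nonneg hp0 (h.majorant x).1, mul_le_mul_of_nonneg_left (h.majorant x).2 hp0⟩
  · rcases lt_or_ge x 0 with hx | hx
    · rw [indicator_Iio_of_neg _ hx, abs_of_nonneg (Real.rpow_nonneg (h.nonneg x hx.le) p)]
      exact Real.rpow_le_one (h.nonneg x hx.le) (h.le_one x hx.le) hp0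
    · rw [indicator_Iio_of_nonneg _ hx]
      simp
  · rw [indicator_Iio_of_neg _ hy, indicator_Iio_of_neg _ (hxy.trans_lt hy), ← mul_sub]
    have hx := (hxy.trans_lt hy).le
    have := abs_rpow_sub_le (h.nonneg y hy.le) (h.nonneg x hx) (h.le_one y hy.le)
      (h.le_one x hx) hp
    rw [Real.one_rpow, mul_one] at this
    exact this.trans (mul_le_mul_of_nonneg_left (h.abs_sub_le x y hxy hy.le) hp0)

theorem integrable_indicator (h : IsNormalPower γ N a C δ c A) :
    Integrable ((Iio 0).indicator γ) :=
  (integrable_indicator_iff measurableSet_Iio).2 h.integrable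

theorem integrable_rpow (h : IsNormalPower γ N a C δ c A) (hp : 1 ≤ p) :
    Integrable ((Iio 0).indicator fun x => γ x ^ p) := by
  refine h.integrable_indicator.mono' (h.varLe_rpow hp).measurable.aestronglyMeasurable
    (.of_forall fun x => ?_)
  rcases lt_or_ge x 0 with hx | hx
  · have h0 := h.nonneg x hx.le
    rw [indicator_Iio_of_neg _ hx, indicator_Iio_of_neg _ hx,
      Real.norm_of_nonneg (Real.rpow_nonneg h0 p)]
    exact Real.rpow_le_self_of_le_one h0 (h.le_one x hx.le) hp
  · rw [indicator_Iio_of_nonneg _ hx, indicator_Iio_of_nonneg _ hx, norm_zero]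

theorem integral_indicator_nonneg (h : IsNormalPower γ N a C δ c A) :
    0 ≤ ∫ x, (Iio 0).indicator γ x :=
  integral_nonneg fun x => indicator_nonneg (fun x hx => h.nonneg x (le_of_lt hx)) x

/-- The mass of the difference of `γ ^ p` and an exponential. -/
theorem integral_abs_rpow_sub_exp_le (h : IsNormalPower γ N a C δ c A) (hp : 1 ≤ p)
    (hc : p ^ 2 * c ^ (p - 1) ≤ 1) :
    Integrable ((Iio 0).indicator fun x => γ x ^ p - Real.exp (a * p * x)) ∧
    ∫ x, |(Iio 0).indicator (fun x => γ x ^ p - Real.exp (a * p * x)) x| ≤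
      errConst a C δ * (2 / a + ∫ x, (Iio 0).indicator γ x) / p ^ 2 := by
  have ha := h.a_pos
  have hp0 : 0 < p := by linarith
  have hα : 0 < a * p := mul_pos ha hp0
  have hE : ∀ β : ℝ, β ≠ 0 → ∀ x < 0,
      Real.exp (β * x) = β⁻¹ * expKernel β x := fun β hβ x hx => by
    rw [expKernel_of_neg hx, inv_mul_cancel_left₀ hβ]
  have e : ((Iio 0).indicator fun x => γ x ^ p - Real.exp (a * p * x)) = fun x =>
      (Iio 0).indicator (fun x => γ x ^ p) x - (a * p)⁻¹ * expKernel (a * p) x := by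
    ext x
    rcases lt_or_ge x 0 with hx | hx
    · rw [indicator_Iio_of_neg _ hx, indicator_Iio_of_neg _ hx, hE _ hα.ne' x hx]
    · rw [indicator_Iio_of_nonneg _ hx, indicator_Iio_of_nonneg _ hx, expKernel_of_nonneg hx]
      simp
  have hi : Integrable ((Iio 0).indicator fun x => γ x ^ p - Real.exp (a * p * x)) := by
    rw [e]
    exact (h.integrable_rpow hp).sub ((integrable_expKernel hα).const_mul _)
  refine ⟨hi, ?_⟩
  have hβ : 0 < a * p / 2 := by positivity
  have hi1 : Integrable fun x => (a * p / 2)⁻¹ * expKernel (a * p / 2) x :=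
    (integrable_expKernel hβ).const_mul _
  have hi2 : Integrable fun x => (Iio 0).indicator γ x / p := h.integrable_indicator.div_const _
  calc _ ≤ ∫ x, errConst a C δ / p *
        ((a * p / 2)⁻¹ * expKernel (a * p / 2) x + (Iio 0).indicator γ x / p) := by
        refine integral_mono hi.abs ((hi1.add hi2).const_mul _) fun x => ?_
        simp only
        rcases lt_or_ge x 0 with hx | hx
        · rw [indicator_Iio_of_neg _ hx, indicator_Iio_of_neg _ hx, ← hE _ hβ.ne' x hx]
          exact h.abs_rpow_sub_exp_le hp hc hx.le
        · rw [indicator_Iio_of_nonneg _ hx, indicator_Iio_of_nonneg _ hx, expKernel_of_nonneg hx]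
          simp
    _ = _ := by
        rw [integral_const_mul, integral_add hi1 hi2, integral_const_mul, integral_expKernel hβ,
          integral_div]
        field_simp

theorem abs_mass_sub_le (h : IsNormalPower γ N a C δ c A) (hp : 1 ≤ p)
    (hc : p ^ 2 * c ^ (p - 1) ≤ 1) :
    |(∫ x, (Iio 0).indicator (fun x => γ x ^ p) x) - 1 / (a * p)| ≤
      errConst a C δ * (2 / a + ∫ x, (Iio 0).indicator γ x) / p ^ 2 := by
  have hα : 0 < a * p := mul_pos h.a_pos (by linarith)
  refine le_trans ?_ (h.integral_abs_rpow_sub_exp_le hp hc).2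
  have e : ∫ x, (Iio 0).indicator (fun x => γ x ^ p - Real.exp (a * p * x)) x =
      (∫ x, (Iio 0).indicator (fun x => γ x ^ p) x) - 1 / (a * p) := by
    have : ∀ x, (Iio 0).indicator (fun x => γ x ^ p - Real.exp (a * p * x)) x =
        (Iio 0).indicator (fun x => γ x ^ p) x - (a * p)⁻¹ * expKernel (a * p) x := fun x => by
      rcases lt_or_ge x 0 with hx | hx
      · rw [indicator_Iio_of_neg _ hx, indicator_Iio_of_neg _ hx, expKernel_of_neg hx,
          inv_mul_cancel_left₀ hα.ne']
      · rw [indicator_Iio_of_nonneg _ hx, indicator_Iio_of_nonneg _ hx, expKernel_of_nonneg hx]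
        simp
    simp only [this]
    rw [integral_sub (h.integrable_rpow hp) ((integrable_expKernel hα).const_mul _),
      integral_const_mul, integral_expKernel hα]
    simp
  rw [← e]
  exact abs_integral_le_integral_abs

/-- The kernel `γ ^ p`, normalised, is close to the exponential kernel. -/
theorem isNear_expKernel (h : IsNormalPower γ N a C δ c A) : ∃ K > 0, ∀ p, 1 ≤ p → K ≤ p →
    p ^ 2 * c ^ (p - 1) ≤ 1 → ∀ Z, Z = ∫ x, (Iio 0).indicator (fun x => γ x ^ p) x →
      0 < Z ∧ 1 / Z ≤ 2 * a * p ∧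
      IsNear ((Iio 0).indicator fun x => γ x ^ p / Z) (expKernel (a * p)) (a * p) (K / p) := by
  have ha := h.a_pos
  have hA := h.majorant_nonneg
  set E := errConst a C δ
  have hE : 1 ≤ E := h.errConst_bounds.2.2
  set K5 := E * (2 / a + ∫ x, (Iio 0).indicator γ x) with hK5
  have hK50 : 0 < K5 := by
    have := h.integral_indicator_nonneg
    have : 0 < 2 / a := by positivity
    positivity
  set B := 2 * a * E * (3 + A) + 4 * a ^ 2 * K5 with hB
  have hB0 : 0 ≤ B := by positivity
  refine ⟨4 * a * K5 + B / a, by positivity, fun p hp hKp hc Z hZ => ?_⟩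
  have hp0 : 0 < p := by linarith
  have hα : 0 < a * p := mul_pos ha hp0
  have hZ1 := h.abs_mass_sub_le hp hc
  rw [← hZ, ← hK5] at hZ1
  -- For such `p` the error in the mass is at most half of the main term `1 / (a p)`, so `Z` is at
  -- least `1 / (2 a p)`.
  have hKp' : 4 * a * K5 ≤ p := le_trans (by have : 0 ≤ B / a := by positivity
                                             linarith) hKp
  have hZ2 : K5 / p ^ 2 ≤ 1 / (2 * (a * p)) := by
    rw [div_le_div_iff₀ (by positivity) (by positivity)]
    nlinarith
  have hZ3 : 1 / (2 * (a * p)) ≤ Z := by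
    have h1 := (abs_le.1 hZ1).1
    have h2 : 1 / (a * p) = 2 * (1 / (2 * (a * p))) := by field_simp
    linarith
  have hZ0 : 0 < Z := lt_of_lt_of_le (by positivity) hZ3
  have hZi : 1 / Z ≤ 2 * a * p := by
    rw [div_le_iff₀ hZ0]
    rw [div_le_iff₀ (by positivity)] at hZ3
    linarith
  have hZi0 : 0 < 1 / Z := by positivity
  -- The normalising factor differs from the rate by a bounded amount, since the mass is of order
  -- `1/p` with error `O(1/p²)`.
  have hd : |1 / Z - a * p| ≤ 2 * a ^ 2 * K5 := by
    have e : 1 / Z - a * p = -(1 / Z * (a * p) * (Z - 1 / (a * p))) := by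
      field_simp
      ring
    rw [e, abs_neg, abs_mul, abs_of_pos (by positivity)]
    calc _ ≤ 2 * a * p * (a * p) * (K5 / p ^ 2) := by gcongr
      _ = _ := by field_simp
  set D : ℝ → ℝ := fun x => γ x ^ p - Real.exp (a * p * x)
  set F : ℝ → ℝ := fun s => (Iio 0).indicator (fun x => γ x ^ p / Z) s - expKernel (a * p) s
  have hF : ∀ x < 0, F x = 1 / Z * D x + (1 / Z - a * p) * Real.exp (a * p * x) := fun x hx => by
    simp only [F, D]
    rw [indicator_Iio_of_neg _ hx, expKernel_of_neg hx]
    ring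
  have hF0 : ∀ x, 0 ≤ x → F x = 0 := fun x hx => by
    simp only [F]
    rw [indicator_Iio_of_nonneg _ hx, expKernel_of_nonneg hx, sub_zero]
  have hFle : ∀ x < 0, |F x| ≤
      2 * a * p * |D x| + 2 * a ^ 2 * K5 * Real.exp (a * p * x) := fun x hx => by
    rw [hF x hx]
    refine (abs_add_le _ _).trans ?_
    rw [abs_mul, abs_mul, abs_of_pos hZi0, abs_of_pos (Real.exp_pos _)]
    gcongr
  have hexp : ∀ {β x : ℝ}, 0 < β → x ≤ 0 → Real.exp (β * x) ≤ 1 := fun hβ hx => by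
    rw [Real.exp_le_one_iff]
    nlinarith
  -- The variation of the error stays bounded in `p`; only after division by the rate `a p` does it
  -- become `O(1/p)`. `B` adds the variation on `(-∞, 0)` and the jump at `0`.
  have hvar : VarLe F B := by
    have := varLe_of_le_sub_of_neg (f := F) (A := 2 * a * E * (1 + A) + 2 * a ^ 2 * K5)
      (S := 4 * a * E + 2 * a ^ 2 * K5)
      (N := fun x => 2 * a * E * (Real.exp (a * p / 2 * x) + N x) +
        2 * a ^ 2 * K5 * Real.exp (a * p * x)) (fun x hx => ?_) (fun x => ?_) hF0
      fun x y hxy hy => ?_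
    · convert this using 1
      rw [hB]
      ring
    · have h1 := hexp (β := a * p / 2) (by positivity) hx.le
      have h2 := hexp hα hx.le
      have h3 := (h.majorant x).1
      have h4 := (h.majorant x).2
      refine ⟨by positivity, ?_⟩
      have h5 : 2 * a * E * (Real.exp (a * p / 2 * x) + N x) ≤ 2 * a * E * (1 + A) := by gcongr
      have h6 : 2 * a ^ 2 * K5 * Real.exp (a * p * x) ≤ 2 * a ^ 2 * K5 * 1 := by gcongr
      linarith
    · rcases lt_or_ge x 0 with hx | hx
      · refine (hFle x hx).trans ?_
        have h1 := hexp (β := a * p / 2) (by positivity) hx.le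
        have h2 := hexp hα hx.le
        have h3 : |D x| ≤ E / p * 2 := by
          refine (h.abs_rpow_sub_exp_le hp hc hx.le).trans ?_
          have h4 : γ x / p ≤ 1 := by
            rw [div_le_one hp0]
            exact (h.le_one x hx.le).trans hp
          have h5 : 0 ≤ E / p := by positivity
          exact mul_le_mul_of_nonneg_left (by linarith) h5
        have h5 : 2 * a * p * |D x| ≤ 2 * a * p * (E / p * 2) := by gcongr
        have h6 : 2 * a ^ 2 * K5 * Real.exp (a * p * x) ≤ 2 * a ^ 2 * K5 * 1 := by gcongr
        have h7 : 2 * a * p * (E / p * 2) = 4 * a * E := by field_simp; ring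
        linarith
      · rw [hF0 x hx, abs_zero]
        positivity
    · rw [hF x (hxy.trans_lt hy), hF y hy,
        show 1 / Z * D y + (1 / Z - a * p) * Real.exp (a * p * y) -
          (1 / Z * D x + (1 / Z - a * p) * Real.exp (a * p * x)) = 1 / Z * (D y - D x) +
          (1 / Z - a * p) * (Real.exp (a * p * y) - Real.exp (a * p * x)) by ring]
      refine (abs_add_le _ _).trans ?_
      have hEm : 0 ≤ Real.exp (a * p * y) - Real.exp (a * p * x) :=
        sub_nonneg.2 (Real.exp_le_exp.2 (by gcongr))
      rw [abs_mul, abs_mul, abs_of_pos hZi0, abs_of_nonneg hEm]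
      have h1 : 1 / Z * |D y - D x| ≤ 2 * a * p * (E / p * (Real.exp (a * p / 2 * y) + N y) -
          E / p * (Real.exp (a * p / 2 * x) + N x)) :=
        mul_le_mul hZi (h.abs_sub_sub_le hp hc hxy hy.le) (abs_nonneg _) (by positivity)
      have h2 := mul_le_mul_of_nonneg_right hd hEm
      have h3 : ∀ z, 2 * a * p * (E / p * z) = 2 * a * E * z := fun z => by field_simp
      rw [mul_sub, h3, h3] at h1
      linarith
  refine ⟨hZ0, hZi, isNear_of_varLe hvar ?_⟩
  obtain ⟨hDi, hDle⟩ := h.integral_abs_rpow_sub_exp_le hp hc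
  have hFint : ∫ s, |F s| ≤ 4 * a * K5 / p := by
    have hi2 := (integrable_expKernel hα).const_mul (2 * a ^ 2 * K5 * (a * p)⁻¹)
    have hFi : Integrable F := by
      have : Integrable ((Iio 0).indicator fun x => γ x ^ p / Z) := by
        have e : ((Iio (0 : ℝ)).indicator fun x => γ x ^ p / Z) =
            fun x => (Iio (0 : ℝ)).indicator (fun x => γ x ^ p) x / Z := by
          ext x
          rcases lt_or_ge x 0 with hx | hx
          · rw [indicator_Iio_of_neg _ hx, indicator_Iio_of_neg _ hx]
          · rw [indicator_Iio_of_nonneg _ hx, indicator_Iio_of_nonneg _ hx, zero_div]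
        rw [e]
        exact (h.integrable_rpow hp).div_const Z
      exact this.sub (integrable_expKernel hα)
    calc _ ≤ ∫ s, (2 * a * p * |(Iio 0).indicator D s| +
          2 * a ^ 2 * K5 * (a * p)⁻¹ * expKernel (a * p) s) := by
          refine integral_mono hFi.abs ((hDi.abs.const_mul _).add hi2) fun x => ?_
          simp only
          rcases lt_or_ge x 0 with hx | hx
          · refine (hFle x hx).trans (le_of_eq ?_)
            rw [indicator_Iio_of_neg _ hx, expKernel_of_neg hx]
            field_simp
          · rw [hF0 x hx, indicator_Iio_of_nonneg _ hx, expKernel_of_nonneg hx]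
            simp
      _ = 2 * a * p * (∫ s, |(Iio 0).indicator D s|) + 2 * a ^ 2 * K5 * (a * p)⁻¹ := by
          rw [integral_add (hDi.abs.const_mul _) hi2, integral_const_mul, integral_const_mul,
            integral_expKernel hα, mul_one]
      _ ≤ 2 * a * p * (K5 / p ^ 2) + 2 * a ^ 2 * K5 * (a * p)⁻¹ := by
          gcongr
      _ = _ := by field_simp; ring
  calc _ ≤ 4 * a * K5 / p + B / (a * p) := by gcongr
    _ = _ := by field_simp

end IsNormalPower

namespace IsNormalPower

variable {γ N : ℝ → ℝ} {a C δ c A p : ℝ}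

theorem isKernel_rpow (h : IsNormalPower γ N a C δ c A) (hp : 1 ≤ p) {Z : ℝ} (hZ : 0 < Z) :
    ∃ b, IsKernel ((Iio 0).indicator fun x => γ x ^ p / Z) b := by
  have e : ((Iio (0 : ℝ)).indicator fun x => γ x ^ p / Z) =
      fun x => (Iio (0 : ℝ)).indicator (fun x => γ x ^ p) x / Z := by
    ext x
    rcases lt_or_ge x 0 with hx | hx
    · rw [indicator_Iio_of_neg _ hx, indicator_Iio_of_neg _ hx]
    · rw [indicator_Iio_of_nonneg _ hx, indicator_Iio_of_nonneg _ hx, zero_div]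
  have hv : VarLe ((Iio 0).indicator fun x => γ x ^ p / Z) ((p * A + 1) / Z) := by
    intro x hx n
    rw [e]
    have := h.varLe_rpow hp x hx n
    simp only [varSum, ← sub_div, abs_div, abs_of_pos hZ, ← Finset.sum_div] at this ⊢
    exact div_le_div_of_nonneg_right this hZ.le
  refine ⟨_, hv.isKernel (fun s => indicator_nonneg (fun x hx => div_nonneg
    (Real.rpow_nonneg (h.nonneg x (le_of_lt hx)) p) hZ.le) s)
    (fun s hs => indicator_Iio_of_nonneg _ hs) ?_⟩
  rw [e]
  exact (h.integrable_rpow hp).div_const Z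

/-- The removed part is frozen at its value at `-δ` on `[-δ, 0]`. There `γ ≥ 1/2`, so the factor `2`
restores an integrable bound in terms of `γ x`. -/
theorem rpow_min_le (h : IsNormalPower γ N a C δ c A) (hp : 1 ≤ p) {x : ℝ} (hx : x < 0) :
    γ (min x (-δ)) ^ p ≤ γ x ^ p ∧ γ (min x (-δ)) ^ p ≤ 2 * c ^ (p - 1) * γ x ∧
      γ (min x (-δ)) ^ p ≤ c ^ (p - 1) := by
  have hδ := h.δ_pos
  have hc := Real.rpow_pos_of_pos h.c_pos (p - 1)
  have hm : min x (-δ) ≤ 0 := (min_le_left _ _).trans hx.le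
  have h0 := h.nonneg _ hm
  have h1 := h.rpow_le hp (min_le_right x (-δ))
  have h2 := h.le_one _ hm
  have hγ := h.nonneg x hx.le
  rcases le_total x (-δ) with hxδ | hxδ
  · rw [min_eq_left hxδ] at h1 h2 h0 ⊢
    refine ⟨le_rfl, ?_, ?_⟩ <;> nlinarith
  · rw [min_eq_right hxδ] at h1 h2 h0 ⊢
    have h3 := h.half_le x hxδ hx.le
    refine ⟨Real.rpow_le_rpow h0 (h.mono _ _ le_rfl hxδ hx.le) (by linarith), ?_, ?_⟩ <;> nlinarith

/-- The part of `γ ^ p` near `0`, which is a monotone kernel. -/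
theorem exists_isNear (h : IsNormalPower γ N a C δ c A) : ∃ K > 0, ∀ p, 1 ≤ p → ∀ Z, 0 < Z →
    1 / Z ≤ 2 * a * p → ∃ k b, IsKernel k b ∧
      (∀ s, k s ≤ (Iio 0).indicator (fun x => γ x ^ p / Z) s) ∧ MonotoneOn k (Iio 0) ∧
      (∀ u < 0, ∀ v < 0, secant k u v ≤ 4 * a * p * ((Iio 0).indicator (fun x => γ x ^ p / Z) u +
        (Iio 0).indicator (fun x => γ x ^ p / Z) v)) ∧
      IsNear ((Iio 0).indicator fun x => γ x ^ p / Z) k (a * p)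
        (K * (p ^ 2 * c ^ (p - 1)) / p) := by
  have ha := h.a_pos
  have hA := h.majorant_nonneg
  have hδ := h.δ_pos
  set I := ∫ x, (Iio 0).indicator γ x
  have hI : 0 ≤ I := h.integral_indicator_nonneg
  refine ⟨4 * a * I + 2 * (A + 1), by positivity, fun p hp Z hZ hZi => ?_⟩
  have hp0 : 0 < p := by linarith
  have hcp := Real.rpow_pos_of_pos h.c_pos (p - 1)
  obtain ⟨b₀, hκ⟩ := h.isKernel_rpow hp hZ
  set κ : ℝ → ℝ := (Iio 0).indicator fun x => γ x ^ p / Z with hκdef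
  have hκn : ∀ x < 0, κ x = γ x ^ p / Z := fun x hx => indicator_Iio_of_neg _ hx
  -- Subtracting the power at `min x (-δ)` removes everything left of `-δ`, where monotonicity may
  -- fail, and lowers the rest by a constant so that no jump appears at `-δ`.
  set k : ℝ → ℝ := (Iio 0).indicator fun x => (γ x ^ p - γ (min x (-δ)) ^ p) / Z with hkdef
  have hkn : ∀ x < 0, k x = (γ x ^ p - γ (min x (-δ)) ^ p) / Z :=
    fun x hx => indicator_Iio_of_neg _ hx
  have hk0 : ∀ x, 0 ≤ x → k x = 0 := fun x hx => indicator_Iio_of_nonneg _ hx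
  have hmz : ∀ {x : ℝ}, x < 0 → 0 ≤ γ (min x (-δ)) := fun hx =>
    h.nonneg _ ((min_le_left _ _).trans hx.le)
  have hknn : ∀ s, 0 ≤ k s := indicator_nonneg fun x hx =>
    div_nonneg (sub_nonneg.2 (h.rpow_min_le hp hx).1) hZ.le
  have hkκ : ∀ s, k s ≤ κ s := fun x => by
    rcases lt_or_ge x 0 with hx | hx
    · rw [hkn x hx, hκn x hx]
      have := Real.rpow_nonneg (hmz hx) p
      gcongr
      linarith
    · rw [hk0 x hx]
      exact hκ.nonneg x
  have hk1 : ∀ s, k s ≤ 1 / Z := fun x => by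
    refine (hkκ x).trans ?_
    rcases lt_or_ge x 0 with hx | hx
    · rw [hκn x hx]
      gcongr
      exact Real.rpow_le_one (h.nonneg x hx.le) (h.le_one x hx.le) hp0.le
    · rw [hκ.zero x hx]
      positivity
  have hkl : ∀ x ≤ -δ, k x = 0 := fun x hx => by
    rw [hkn x (by linarith), min_eq_left hx, sub_self, zero_div]
  have hmono : MonotoneOn k (Iio 0) := fun x hx y hy hxy => by
    rcases le_total x (-δ) with hxδ | hxδ
    · rw [hkl x hxδ]
      exact hknn y
    · rw [hkn x hx, hkn y hy, min_eq_right hxδ, min_eq_right (hxδ.trans hxy)]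
      have := Real.rpow_le_rpow (h.nonneg x (le_of_lt hx)) (h.mono x y hxδ hxy (le_of_lt hy)) hp0.le
      gcongr
  have hmk := (varLe_of_monotoneOn hmono hknn hk0 hk1)
  have hki : Integrable k := hκ.integrable.mono' hmk.measurable.aestronglyMeasurable
    (.of_forall fun x => by rw [Real.norm_of_nonneg (hknn x)]; exact hkκ x)
  refine ⟨k, _, hmk.isKernel hknn hk0 hki, hkκ, hmono, ?_, ?_⟩
  · have key : ∀ u < 0, ∀ v < 0, u < v → secant k u v ≤ 4 * a * p * (κ u + κ v) := by
      intro u hu v hv huv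
      have hv0 := h.nonneg v hv.le
      have hκu := hκ.nonneg u
      have hκv := hκ.nonneg v
      suffices hs : k v - k u ≤ 4 * a * p * κ v * (v - u) by
        rw [secant, div_le_iff₀ (sub_pos.2 huv)]
        refine hs.trans (mul_le_mul_of_nonneg_right ?_ (sub_pos.2 huv).le)
        exact mul_le_mul_of_nonneg_left (by linarith) (by positivity)
      have hvu := (sub_pos.2 huv).le
      rcases le_total v (-δ) with hvδ | hvδ
      · rw [hkl v hvδ, hkl u (by linarith), sub_self]
        positivity
      have hw : max u (-δ) ≤ v := max_le huv.le hvδ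
      have hw' : -δ ≤ max u (-δ) := le_max_right _ _
      have hw0 : max u (-δ) < 0 := hw.trans_lt hv
      have e : k u = k (max u (-δ)) := by
        rcases le_total u (-δ) with huδ | huδ
        · rw [max_eq_right huδ, hkl u huδ, hkl _ le_rfl]
        · rw [max_eq_left huδ]
      set w := max u (-δ)
      have hwu : v - w ≤ v - u := by linarith [le_max_left u (-δ)]
      have hhalf := h.half_le v hvδ hv.le
      have h1 := rpow_sub_rpow_le (h.nonneg w hw0.le) (h.mono w v hw' hw hv.le) hp
      have h2 := h.sub_le w v hw' hw hv.le
      -- As `γ v ≥ 1/2`, the slope `p γ ^ (p-1) · 2a` is bounded by `4 a p γ ^ p`; this makes the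
      -- secants proportional to the kernel itself.
      have h3 : γ v ^ (p - 1) ≤ 2 * γ v ^ p := by
        have h4 : γ v ^ p = γ v ^ (p - 1) * γ v := by
          rw [← Real.rpow_add_one (by linarith : γ v ≠ 0), sub_add_cancel]
        rw [h4]
        nlinarith [Real.rpow_nonneg hv0 (p - 1)]
      have h5 : γ v ^ p - γ w ^ p ≤ 4 * a * p * γ v ^ p * (v - u) := by
        calc _ ≤ p * γ v ^ (p - 1) * (γ v - γ w) := h1
          _ ≤ p * (2 * γ v ^ p) * (2 * a * (v - u)) := by
              refine mul_le_mul (mul_le_mul_of_nonneg_left h3 hp0.le) (h2.trans ?_)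
                (sub_nonneg.2 (h.mono w v hw' hw hv.le)) ?_
              · exact mul_le_mul_of_nonneg_left hwu (by positivity)
              · have := Real.rpow_nonneg hv0 p
                positivity
          _ = _ := by ring
      rw [e, hkn v hv, hkn w hw0, min_eq_right hvδ, min_eq_right hw', hκn v hv, ← sub_div,
        div_le_iff₀ hZ]
      refine le_trans (le_of_eq (by ring)) (h5.trans (le_of_eq ?_))
      field_simp
    intro u hu v hv
    rcases lt_trichotomy u v with huv | rfl | huv
    · exact key u hu v hv huv
    · rw [secant_self]
      have := hκ.nonneg u
      positivity
    · rw [secant_comm, add_comm]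
      exact key v hv u hu huv
  · have hd : ∀ x < 0, κ x - k x = 1 / Z * γ (min x (-δ)) ^ p := fun x hx => by
      rw [hκn x hx, hkn x hx]
      ring
    have hd0 : ∀ x, 0 ≤ x → κ x - k x = 0 := fun x hx => by
      rw [hκ.zero x hx, hk0 x hx, sub_zero]
    set τ := p ^ 2 * c ^ (p - 1) with hτ
    have hvar : VarLe (fun s => κ s - k s) (2 * a * τ * A + 2 * a * τ) := by
      refine varLe_of_le_sub_of_neg (N := fun x => 2 * a * τ * N (min x (-δ))) (fun x _ => ?_)
        (fun x => ?_) hd0 fun x y hxy hy => ?_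
      · have h1 := (h.majorant (min x (-δ))).1
        have h2 := (h.majorant (min x (-δ))).2
        exact ⟨by positivity, by gcongr⟩
      · rcases lt_or_ge x 0 with hx | hx
        · rw [hd x hx, abs_of_nonneg (mul_nonneg (by positivity) (Real.rpow_nonneg (hmz hx) p))]
          calc _ ≤ 2 * a * p * c ^ (p - 1) :=
                mul_le_mul hZi (h.rpow_min_le hp hx).2.2 (Real.rpow_nonneg (hmz hx) p)
                  (by positivity)
            _ ≤ 2 * a * p * c ^ (p - 1) * p := le_mul_of_one_le_right (by positivity) hp
            _ = _ := by rw [hτ]; ring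
        · rw [hd0 x hx, abs_zero]
          positivity
      · have hx := hxy.trans_lt hy
        have hle : min x (-δ) ≤ min y (-δ) := min_le_min_right _ hxy
        have hm : ∀ z, min z (-δ) ≤ -δ := fun z => min_le_right _ _
        rw [hd x hx, hd y hy, ← mul_sub, ← mul_sub, abs_mul, abs_of_pos (by positivity)]
        have h1 := abs_rpow_sub_le (hmz hy) (hmz hx) (h.le_c _ (hm y)) (h.le_c _ (hm x)) hp
        have h2 := h.abs_sub_le _ _ hle (by linarith [hm y])
        calc _ ≤ 2 * a * p * (p * c ^ (p - 1) * (N (min y (-δ)) - N (min x (-δ)))) :=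
              mul_le_mul hZi (h1.trans (mul_le_mul_of_nonneg_left h2 (by positivity)))
                (abs_nonneg _) (by positivity)
          _ = _ := by rw [hτ]; ring
    refine isNear_of_varLe hvar ?_
    have hint : ∫ s, |κ s - k s| ≤ 4 * a * p * c ^ (p - 1) * I := by
      rw [← integral_const_mul]
      refine integral_mono (hκ.integrable.sub hki).abs (h.integrable_indicator.const_mul _)
        fun x => ?_
      simp only
      rcases lt_or_ge x 0 with hx | hx
      · rw [hd x hx, indicator_Iio_of_neg _ hx,
          abs_of_nonneg (mul_nonneg (by positivity) (Real.rpow_nonneg (hmz hx) p))]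
        have hγ := h.nonneg x hx.le
        calc _ ≤ 2 * a * p * (2 * c ^ (p - 1) * γ x) :=
              mul_le_mul hZi (h.rpow_min_le hp hx).2.1 (Real.rpow_nonneg (hmz hx) p)
                (by positivity)
          _ = _ := by ring
      · rw [hd0 x hx, indicator_Iio_of_nonneg _ hx]
        simp
    calc _ ≤ 4 * a * p * c ^ (p - 1) * I + (2 * a * τ * A + 2 * a * τ) / (a * p) := by gcongr
      _ = _ := by
        rw [hτ]
        field_simp

theorem exists_isNearExponential (h : IsNormalPower γ N a C δ c A) : ∃ K > 0, ∀ p, 1 ≤ p →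
    8 * K ≤ p → p ^ 2 * c ^ (p - 1) ≤ 1 → IsNearExponential
      ((Iio 0).indicator fun x => γ x ^ p / ∫ x in Iic (0 : ℝ), γ x ^ p) (a * p) (K / p)
      (4 * a * p) (K * (p ^ 2 * c ^ (p - 1)) / p) := by
  obtain ⟨K₁, hK₁, h₁⟩ := h.isNear_expKernel
  obtain ⟨K₂, hK₂, h₂⟩ := h.exists_isNear
  refine ⟨K₁ + K₂, by positivity, fun p hp hKp hc => ?_⟩
  have hp0 : 0 < p := by linarith
  have hmass : ∫ x in Iic (0 : ℝ), γ x ^ p = ∫ x, (Iio 0).indicator (fun x => γ x ^ p) x := by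
    rw [integral_indicator measurableSet_Iio, integral_Iic_eq_integral_Iio]
  set Z := ∫ x in Iic (0 : ℝ), γ x ^ p
  obtain ⟨hZ, hZi, hn⟩ := h₁ p hp (by linarith) hc Z hmass
  obtain ⟨k, b, hk, hkκ, hmono, hsec, hn'⟩ := h₂ p hp Z hZ hZi
  have hτ : 0 ≤ p ^ 2 * c ^ (p - 1) := by
    have := Real.rpow_nonneg h.c_pos.le (p - 1)
    positivity
  have near_mono : ∀ {κ k : ℝ → ℝ} {α θ θ' : ℝ}, IsNear κ k α θ → θ ≤ θ' → IsNear κ k α θ' := by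
    rintro κ k α θ θ' ⟨h₀, hh₀, c, h1, h2⟩ hθ
    exact ⟨h₀, hh₀, c, h1, h2.trans hθ⟩
  refine ⟨mul_pos h.a_pos hp0, h.isKernel_rpow hp hZ, ?_, near_mono hn (by gcongr; linarith), ?_,
    ⟨k, b, hk, hkκ, hmono, hsec, near_mono hn' (by gcongr; linarith)⟩, ?_⟩
  · rw [integral_indicator measurableSet_Iio, integral_div, ← integral_Iic_eq_integral_Iio]
    exact div_self hZ.ne'
  · rw [div_le_iff₀ hp0]
    linarith
  · rw [div_le_iff₀ hp0]
    have := mul_le_mul_of_nonneg_left hc (by positivity : 0 ≤ K₁ + K₂)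
    linarith

end IsNormalPower

/-! ### Power kernels in normalised form -/

theorem tendsto_sq_mul_rpow {c : ℝ} (hc : 0 < c) (hc1 : c < 1) :
    Filter.Tendsto (fun p : ℝ => p ^ 2 * c ^ (p - 1)) Filter.atTop (𝓝 0) := by
  have h := (tendsto_rpow_mul_exp_neg_mul_atTop_nhds_zero 2 (-Real.log c)
    (neg_pos.2 (Real.log_neg hc hc1))).mul_const c⁻¹
  rw [zero_mul] at h
  refine h.congr fun p => ?_
  rw [neg_neg, Real.rpow_two, Real.rpow_sub_one hc.ne', Real.rpow_def_of_pos hc, div_eq_mul_inv,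
    mul_assoc]

/-- The difference of `log` and the identity on `[1/2, 1]`. -/
theorem abs_log_sub_log_sub_le {u v : ℝ} (hu : 1 / 2 ≤ u) (huv : u ≤ v) (hv : v ≤ 1) :
    |Real.log v - Real.log u - (v - u)| ≤ 2 * (v - u) * (1 - u) := by
  have hu0 : 0 < u := by linarith
  have hv0 : 0 < v := by linarith
  have h1 := Real.log_le_sub_one_of_pos (div_pos hv0 hu0)
  have h2 := Real.log_le_sub_one_of_pos (div_pos hu0 hv0)
  rw [Real.log_div hv0.ne' hu0.ne'] at h1
  rw [Real.log_div hu0.ne' hv0.ne'] at h2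
  have h3 : u / v - 1 ≤ -(v - u) := by
    rw [div_sub_one hv0.ne', div_le_iff₀ hv0]
    nlinarith
  have h4 : v / u - 1 ≤ (v - u) + 2 * (v - u) * (1 - u) := by
    rw [div_sub_one hu0.ne', div_le_iff₀ hu0]
    nlinarith [mul_nonneg (mul_nonneg (sub_nonneg.2 huv) (by linarith : 0 ≤ 1 - u))
      (by linarith : 0 ≤ 2 * u - 1)]
  have h5 : 0 ≤ 2 * (v - u) * (1 - u) :=
    mul_nonneg (by linarith) (by linarith)
  rw [abs_le]
  constructor <;> linarith

namespace IsPowerKernel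

variable {γ : ℝ → ℝ}

theorem zero_pos (h : IsPowerKernel γ) : 0 < γ 0 := by
  obtain ⟨c, hc, h1⟩ := h.max_at_zero 1 one_pos
  linarith [h1 (-1) le_rfl, h.nonneg (-1) (by norm_num)]

theorem le_zero (h : IsPowerKernel γ) {x : ℝ} (hx : x ≤ 0) : γ x ≤ γ 0 := by
  rcases hx.eq_or_lt with rfl | hx
  · exact le_rfl
  · obtain ⟨c, hc, h1⟩ := h.max_at_zero (-x) (by linarith)
    linarith [h1 x (by linarith)]

/-- Precomposing with `min · 0` extends the kernel to all of `ℝ` without increasing its variation.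
-/
theorem exists_majorant (h : IsPowerKernel γ) : ∃ (N : ℝ → ℝ) (A : ℝ), (∀ x, N x ∈ Icc 0 A) ∧
    ∀ x y, x ≤ y → y ≤ 0 → |γ y - γ x| ≤ N y - N x := by
  have hbv : BoundedVariationOn (γ ∘ fun x => min x 0) univ := by
    refine ne_top_of_le_ne_top h.bv (eVariationOn.comp_le_of_monotoneOn γ _ ?_ ?_)
    · exact fun x _ y _ hxy => min_le_min_right _ hxy
    · exact fun x _ => min_le_right x 0
  obtain ⟨N, -, hA, hN⟩ := (varLe_of_boundedVariationOn hbv).exists_monotone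
  refine ⟨N, _, hA, fun x y hxy hy => ?_⟩
  have := hN x y hxy
  simpa only [Function.comp, min_eq_left hy, min_eq_left (hxy.trans hy)] using this

theorem exists_isNormalPower (h : IsPowerKernel γ) :
    ∃ N a C δ c A, IsNormalPower (fun x => γ x / γ 0) N a C δ c A := by
  obtain ⟨a₀, ha₀, C₀, δ₀, hδ₀, hexp⟩ := h.expansion
  obtain ⟨N₀, A₀, hA, hN⟩ := h.exists_majorant
  have h0 := h.zero_pos
  set g := γ 0 with hg
  set a := a₀ / g with ha
  have ha0 : 0 < a := by positivity
  set C₁ := |C₀| / g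
  have hC₁ : 0 ≤ C₁ := by positivity
  -- The second term pays for passing from `γ` to `log γ`: it is `2 · (3a/2) · (3a/2)`, from the
  -- upper slope `3a/2` of the normalised kernel inserted into `abs_log_sub_log_sub_le`. The choice
  -- of `δ` then makes `C δ ≤ a/4`.
  set C := C₁ + 9 / 2 * a ^ 2 with hC
  have hC0 : 0 < C := by positivity
  set δ := min δ₀ (a / (4 * C)) with hδ
  have hδ0 : 0 < δ := lt_min hδ₀ (by positivity)
  have hCδ : C * δ ≤ a / 4 := by
    have := mul_le_mul_of_nonneg_left (min_le_right δ₀ (a / (4 * C))) hC0.le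
    refine this.trans (le_of_eq ?_)
    field_simp
  have haδ : 18 * (a * δ) ≤ 1 := by
    have h1 : 9 / 2 * a ^ 2 * δ ≤ a / 4 :=
      (mul_le_mul_of_nonneg_right (by linarith) hδ0.le).trans hCδ
    nlinarith
  obtain ⟨c₀, hc₀, hc⟩ := h.max_at_zero δ hδ0
  -- the expansion of the normalised kernel
  have hex : ∀ x y, -δ ≤ x → x ≤ y → y ≤ 0 →
      |γ y / g - γ x / g - a * (y - x)| ≤ C₁ * (-x) * (y - x) := fun x y hx hxy hy => by
    have hle : δ ≤ δ₀ := min_le_left _ _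
    have h1 := hexp y ⟨by linarith, hy⟩ x ⟨by linarith, by linarith⟩
    rw [abs_of_nonpos hy, abs_of_nonpos (hxy.trans hy), max_eq_right (by linarith),
      abs_of_nonneg (sub_nonneg.2 hxy)] at h1
    have e : γ y / g - γ x / g - a * (y - x) = (γ y - γ x - a₀ * (y - x)) / g := by
      rw [ha]; ring
    rw [e, abs_div, abs_of_pos h0, div_le_iff₀ h0]
    refine h1.trans ?_
    have e2 : C₁ * (-x) * (y - x) * g = |C₀| * (-x) * (y - x) := by
      simp only [C₁]; field_simp
    rw [e2]
    refine mul_le_mul_of_nonneg_right (mul_le_mul_of_nonneg_right (le_abs_self _) ?_)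
      (sub_nonneg.2 hxy)
    linarith
  have hslope : ∀ x y, -δ ≤ x → x ≤ y → y ≤ 0 → a / 2 * (y - x) ≤ γ y / g - γ x / g ∧
      γ y / g - γ x / g ≤ 3 / 2 * a * (y - x) := fun x y hx hxy hy => by
    have h1 : C₁ * (-x) ≤ a / 4 :=
      le_trans (mul_le_mul (by rw [hC]; nlinarith) (by linarith) (by linarith) hC0.le) hCδ
    have h2 := mul_le_mul_of_nonneg_right h1 (sub_nonneg.2 hxy)
    have h3 := abs_le.1 (hex x y hx hxy hy)
    have h4 := mul_nonneg ha0.le (sub_nonneg.2 hxy)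
    constructor <;> nlinarith [h3.1, h3.2]
  have hone : ∀ x ≤ 0, γ x / g ≤ 1 := fun x hx => by
    rw [div_le_one h0]
    exact h.le_zero hx
  have hlow : ∀ x, -δ ≤ x → x ≤ 0 → 1 - γ x / g ≤ 3 / 2 * a * (-x) := fun x hx hx0 => by
    have h1 := (hslope x 0 hx hx0 le_rfl).2
    rw [← hg, div_self h0.ne', zero_sub] at h1
    exact h1
  have hhalf : ∀ x, -δ ≤ x → x ≤ 0 → 1 / 2 ≤ γ x / g := fun x hx hx0 => by
    have h1 := hlow x hx hx0
    have h2 := mul_le_mul_of_nonneg_left (by linarith : -x ≤ δ) ha0.le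
    nlinarith
  have hmono : ∀ x y, -δ ≤ x → x ≤ y → y ≤ 0 → γ x / g ≤ γ y / g := fun x y hx hxy hy => by
    have := mul_nonneg ha0.le (sub_nonneg.2 hxy)
    linarith [(hslope x y hx hxy hy).1]
  -- The maximum with `1/2` keeps `c` positive, since the kernel may vanish left of `-δ`.
  refine ⟨fun x => N₀ x / g, a, C, δ, max (c₀ / g) (1 / 2), A₀ / g, ha0, hC0.le, hδ0,
    lt_max_of_lt_right (by norm_num), max_lt (by rwa [div_lt_one h0]) (by norm_num),
    div_self h0.ne', fun x hx => div_nonneg (h.nonneg x hx) h0.le, hone,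
    fun x hx => le_max_of_le_left (div_le_div_of_nonneg_right (hc x hx) h0.le),
    (h.integrable.mono_set Iio_subset_Iic_self).div_const g,
    fun x => ⟨div_nonneg (hA x).1 h0.le, div_le_div_of_nonneg_right (hA x).2 h0.le⟩,
    fun x y hxy hy => ?_, hhalf, hmono, fun x y hx hxy hy => ?_, fun x y hx hxy hy => ?_, hCδ⟩
  · rw [← sub_div, ← sub_div, abs_div, abs_of_pos h0]
    exact div_le_div_of_nonneg_right (hN x y hxy hy) h0.le
  · have := mul_nonneg ha0.le (sub_nonneg.2 hxy)
    linarith [(hslope x y hx hxy hy).2]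
  · have hx0 := hxy.trans hy
    have h1 := abs_log_sub_log_sub_le (hhalf x hx hx0) (hmono x y hx hxy hy) (hone y hy)
    have h2 := hex x y hx hxy hy
    have h3 : 2 * (γ y / g - γ x / g) * (1 - γ x / g) ≤
        2 * (3 / 2 * a * (y - x)) * (3 / 2 * a * (-x)) := by
      have hyx := sub_nonneg.2 hxy
      refine mul_le_mul ?_ (hlow x hx hx0) (sub_nonneg.2 (hone x hx0)) (by positivity)
      linarith [(hslope x y hx hxy hy).2]
    have h4 := abs_add_le (Real.log (γ y / g) - Real.log (γ x / g) - (γ y / g - γ x / g))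
      (γ y / g - γ x / g - a * (y - x))
    rw [sub_add_sub_cancel] at h4
    rw [hC]
    nlinarith

theorem powerScale_eq (h : IsPowerKernel γ) {η x : ℝ} (hx : x ≤ 0) : powerScale γ η x =
    (γ x / γ 0) ^ (1 / η) / ∫ y in Iic (0 : ℝ), (γ y / γ 0) ^ (1 / η) := by
  have h0 := h.zero_pos
  have h1 := Real.rpow_pos_of_pos h0 (1 / η)
  have e : ∫ y in Iic (0 : ℝ), (γ y / γ 0) ^ (1 / η) =
      (∫ y in Iic (0 : ℝ), γ y ^ (1 / η)) / γ 0 ^ (1 / η) := by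
    rw [← integral_div]
    exact setIntegral_congr_fun measurableSet_Iic fun y hy =>
      Real.div_rpow (h.nonneg y hy) h0.le _
  rw [e, Real.div_rpow (h.nonneg x hx) h0.le, powerScale, div_div_div_cancel_right₀ h1.ne']

/-- With `p = 1 / η` the product `α θ` is the constant `a K`, whereas `Λ θ'` is a multiple of `p² c
^ (p - 1)` and falls below any `e > 0`. The bound `D` is fixed before `e`: bounded suffices for the
variation, small is needed for the sup bound. -/
theorem exists_isNearExponential (h : IsPowerKernel γ) : ∃ D, ∀ e > 0, ∃ ε > 0, ∀ η ∈ Ioo 0 ε,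
    ∃ α θ Λ θ', 0 ≤ Λ ∧ α * θ ≤ D ∧ Λ * θ' ≤ e ∧
      IsNearExponential ((Iio 0).indicator (powerScale γ η)) α θ Λ θ' := by
  obtain ⟨N, a, C, δ, c, A, hγ⟩ := h.exists_isNormalPower
  obtain ⟨K, hK, hnear⟩ := hγ.exists_isNearExponential
  have ha := hγ.a_pos
  refine ⟨a * K, fun e he => ?_⟩
  have ht := tendsto_sq_mul_rpow hγ.c_pos hγ.c_lt
  obtain ⟨P, hP⟩ := Filter.eventually_atTop.1 (ht.eventually_le_const
    (lt_min one_pos (by positivity : 0 < e / (4 * a * K))))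
  set R := max (max 1 (8 * K)) P
  have hR : 0 < R := lt_of_lt_of_le one_pos ((le_max_left _ _).trans (le_max_left _ _))
  refine ⟨1 / R, by positivity, fun η hη => ?_⟩
  have hη0 := hη.1
  have hp : R ≤ 1 / η := by
    rw [le_div_iff₀ hη0, mul_comm, ← le_div_iff₀ hR]
    exact hη.2.le
  have h1 : 1 ≤ 1 / η := ((le_max_left _ _).trans (le_max_left _ _)).trans hp
  have h2 : 8 * K ≤ 1 / η := ((le_max_right _ _).trans (le_max_left _ _)).trans hp
  have h3 := hP (1 / η) ((le_max_right _ _).trans hp)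
  have hn := hnear (1 / η) h1 h2 (h3.trans (min_le_left _ _))
  have e1 : (Iio 0).indicator (powerScale γ η) = (Iio 0).indicator
      fun x => (γ x / γ 0) ^ (1 / η) / ∫ x in Iic (0 : ℝ), (γ x / γ 0) ^ (1 / η) :=
    indicator_congr fun x hx => h.powerScale_eq (le_of_lt hx)
  rw [← e1] at hn
  have hp0 : 0 < 1 / η := by linarith
  refine ⟨_, _, _, _, by positivity, le_of_eq ?_, ?_, hn⟩
  · field_simp
  · have h4 := h3.trans (min_le_right _ _)
    rw [le_div_iff₀ (by positivity)] at h4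
    set p := 1 / η
    refine le_trans (le_of_eq ?_) h4
    field_simp

end IsPowerKernel

end NonlocalCL

end

/-! ### The main theorem -/

open NonlocalCL

theorem mainTheorem3 (V : ℝ → ℝ) (q₀ : ℝ → ℝ) (Γ : ℝ → ℝ → ℝ)
    (hV : NonlocalCL.IsVelocity V) (hq₀ : NonlocalCL.IsBoundedTV q₀)
    (hΓ : NonlocalCL.IsAdmissibleFamily Γ) (T : ℝ) (hT : 0 < T) :
    ∃ ε > 0,
      (∀ η ∈ Set.Ioo 0 ε, ∀ q : C(Set.Icc (0 : ℝ) T, NonlocalCL.L1Loc),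
        NonlocalCL.IsWeakSolution V (Γ η) q₀ T q →
          ∃ w : C(Set.Icc (0 : ℝ) T, NonlocalCL.L1Loc), NonlocalCL.IsNonlocalTerm (Γ η) q w) ∧
      IsCompact (closure (NonlocalCL.nonlocalTerms V Γ q₀ T ε)) := by
  obtain ⟨g, A, Q, hgq, hA, hQ⟩ := hq₀.exists_varLe
  rcases hΓ with ⟨γ, hγ, hΓ⟩ | ⟨γ, hγ, hΓ⟩
  · have e : ∀ η > 0, (Iio 0).indicator (Γ η) = (Iio 0).indicator (rescale γ η) := fun η hη =>
      indicator_congr fun x hx => hΓ η hη x (le_of_lt hx)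
    refine ⟨1, one_pos, isCompact_closure_nonlocalTerms hT hV hA.measurable hQ hgq (S := Q)
      (A := A) (fun η hη => ?_) fun η hη => ?_⟩
    · rw [e η hη.1]
      exact (hγ.bounds hV hT.le hη.1 hQ hA).1
    · rw [e η hη.1]
      exact (hγ.bounds hV hT.le hη.1 hQ hA).2
  · have e : ∀ η > 0, (Iio 0).indicator (Γ η) = (Iio 0).indicator (powerScale γ η) := fun η hη =>
      indicator_congr fun x hx => hΓ η hη x (le_of_lt hx)
    -- A strictly positive bound is needed for a positive step length in the continuation argument.
    set R := max Q 1
    have hR0 : 0 < R := lt_max_of_lt_right one_pos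
    have hR : ∀ x, |g x| ≤ R := fun x => (hQ x).trans (le_max_left _ _)
    obtain ⟨L, hL⟩ := hV.lipschitz (4 * R)
    have hL0 : (0 : ℝ) ≤ L := L.2
    obtain ⟨D, hD⟩ := hγ.exists_isNearExponential
    -- The tolerance ensures `64 (Λθ') R L T ≤ 1/3`; `L + 1` replaces `L`, which may be zero. This
    -- is how `ε` comes to depend on `T`.
    obtain ⟨ε, hε, h⟩ := hD (1 / (3 * (64 * R * (L + 1) * T))) (by positivity)
    refine ⟨ε, hε, isCompact_closure_nonlocalTerms hT hV hA.measurable hQ hgq (S := 4 * R)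
      (A := 2 * (A * Real.exp (32 * D * R * L * T))) (fun η hη => ?_)
      fun η hη M C ρ X v hρ t ht => ?_⟩
    · rw [e η hη.1]
      obtain ⟨α, θ, Λ, θ', -, -, -, hn⟩ := h η hη
      exact hn.kernel
    · rw [e η hη.1] at hρ ⊢
      obtain ⟨α, θ, Λ, θ', hΛ, h1, h2, hn⟩ := h η hη
      have hsmall : 64 * (Λ * θ') * R * L * T ≤ 1 / 3 := by
        rw [le_div_iff₀ (by positivity)] at h2
        obtain ⟨k, c, -, -, -, -, hk⟩ := hn.approx
        have h3 : 0 ≤ 64 * (Λ * θ') * R * T := by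
          have := hk.nonneg hn.pos
          positivity
        linarith
      have hW : ∀ t ∈ Icc 0 T, ∀ x, conv ((Iio 0).indicator (powerScale γ η)) (ρ t) x ≤ 4 * R :=
        fun t ht x => hρ.conv_le_of_isNearExponential hV hT.le hR0 hR hA.measurable hL hΛ hn
          hsmall ht x
      refine ⟨hW t ht, fun x hx n =>
        (hρ.varLe_of_isNearExponential hV hT.le hR hA hL hn hW ht x hx n).trans ?_⟩
      have := hA.nonneg
      gcongr
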